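/- **Model.** $n\ge 2$ nodes with distinct UIDs from $[N]$ ($N\ge n$ is known to the nodes; $n$ and the parameters below are not) form in each synchronous round $1,2,\dots$ a connected undirected graph; the sequence of graphs is fixed in advance and has stability factor $\tau\in\{1,2,\dots\}\cup\{\infty\}$: at least $\tau$ rounds pass between two changes of the graph, and it never changes if $\tau=\infty$. In each round every node advertises one bit (tag length $b=1$), learns the UIDs and bits of its neighbours, and may send a connection proposal to one neighbour. A node that sent no proposal but received some accepts a uniformly random one of them, and the two nodes then interact. Let $\Delta$ be the largest degree in any round, and $\alpha$ the minimum over all rounds of the vertex expansion $\min_{0<|S|\le n/2}|\partial S|/|S|$. Initially the nodes hold pairwise disjoint sets of tokens, labelled by elements of $[N]$, with $k$ tokens in total. An algorithm *solves gossip in $f$ rounds* if with probability at least $1-1/n$ all nodes know all $k$ tokens by round $f$. Logarithms have base 2. **SimSharedBit.** Let $c,c',\beta,c_t\ge1$ be integer constants. A shared string consists of $cN^2+c'N^2\lceil\log N\rceil^6$ groups of $N$ bundles of $\lceil\log N\rceil+1$ bits. Let $\mathcal R'$ be a multiset of such strings with fixed labels. Initially every node independently chooses a uniformly random label (its seed).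 *Odd rounds (SharedBit).* In the $s$-th odd round, node $u$ uses group $s$ of the string whose label is the seed of $u$'s current candidate leader (when the groups are exhausted, SharedBit stops). It advertises the sum mod 2, over the tokens $t$ it knows, of the first bit of bundle $t$. If this bit is $1$ and some neighbours advertise $0$, then $u$ proposes to one of these, namely, in the order of UIDs, the one whose position (counted from 0) is the number given by the other bits of bundle $u$, modulo their number. Connected nodes run a token transfer subroutine: a binary search over $[N]$ for the smallest token known to exactly one of them, in which each equality test of two sets of labels compares polynomial fingerprints at private random points modulo the smallest prime $p\ge 2N$, with $\lceil\log(\lceil\log N\rceil N^{c_t})\rceil$ trials, so that the whole search errs with probability at most $N^{-c_t}$; the token found is given to the node that lacks it. *Even rounds (BitConvergence leader election).* Every node keeps a candidate leader, initially itself, with that candidate's identifier and seed. The identifier of a node is either (variant 1) its UID, with $\lceil\log N\rceil$ bits, or (variant 2) a uniformly random tag of $\beta\lceil\log N\rceil$ bits; candidates are ordered by identifier, then by UID. The even rounds are divided into groups of $2\lceil\log N\rceil$, and the groups into phases with one group per identifier bit. In the $j$-th group of a phase a node advertises the $j$-th most significant bit of its current candidate's identifier; a node advertising $0$ proposes to a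 uniformly random neighbour advertising $1$, if any. Connected nodes both adopt the smaller of their two candidates, with its seed. **Theorem.** There are constants $c,c',\beta,c_t\ge 1$, $C>0$ and $1\le d_1\le d_2$ such that, for both variants and for every $N\ge2$, there exists a multiset $\mathcal R'$ of bit strings (shared strings as above) with $N^{d_1}\le|\mathcal R'|\le N^{d_2}$ and the following property. For all $n$ with $2\le n\le N$, all assignments of UIDs, all $\tau\ge1$ (including $\tau=\infty$, where $1/\tau=0$), all dynamic graphs on $n$ nodes with stability factor $\tau$ and all initial token assignments, SimSharedBit using $\mathcal R'$, without any shared randomness, solves gossip in $$C\Big(kn+\frac1\alpha\,\Delta^{1/\tau}\log^6N\Big)$$ rounds. -/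

import Mathlib

/-! ## The mobile telephone model -/

/-- A (randomised, distributed) algorithm in the mobile telephone model in which every node knows
the upper bound `N` on the network size and its own UID from `[N] = Fin N`, in which tokens are
labelled by elements of `[N]`, and which uses advertising tags of `b` bits.  Every field is local:
it only sees what the model lets a node see.  Rounds are counted from `0` (so round `i` here is
round `i + 1` in the convention in which the first round is round `1`).

* `InitCoin`, `Coin`: the private random bits which a node draws (uniformly, independently) at the
  beginning of the execution, and in each round for use in a connection.
* `init u T c`: initial state of the node with UID `u` that starts with the token set `T` and has
  drawn `c`.
* `tag i u s`: the tag advertised in round `i`.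
* `targets i u s nbrs`: `nbrs` is the set of all (UID, tag) pairs of the neighbours in round `i`;
  the node proposes a connection to a uniformly random neighbour whose UID is in the returned set
  (and sends no proposal if there is none).
* `connect i s₁ s₂ c`: the new states after the interaction in round `i` of a proposer in state
  `s₁` with the acceptor, in state `s₂`, whose random bits are `c`.
* `tokens s`: the tokens known. -/
structure MTMAlgorithm (N b : ℕ) where
  State : Type
  InitCoin : Type
  Coin : Type
  [initCoinFintype : Fintype InitCoin]
  [initCoinNonempty : Nonempty InitCoin]
  [coinFintype : Fintype Coin]
  [coinNonempty : Nonempty Coin]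
  init : Fin N → Finset (Fin N) → InitCoin → State
  tag : ℕ → Fin N → State → (Fin b → Bool)
  targets : ℕ → Fin N → State → Finset (Fin N × (Fin b → Bool)) → Finset (Fin N)
  connect : ℕ → State → State → Coin → State × State
  tokens : State → Finset (Fin N)

attribute [instance] MTMAlgorithm.initCoinFintype MTMAlgorithm.initCoinNonempty
  MTMAlgorithm.coinFintype MTMAlgorithm.coinNonempty

namespace MTMAlgorithm

variable {N b : ℕ} {V : Type} [Fintype V]

open Classical in
/-- What node `u` learns in its scan: the UIDs and tags of its neighbours. -/
noncomputable def scan (A : MTMAlgorithm N b) (uid : V → Fin N) (G : SimpleGraph V) (i : ℕ)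
    (σ : V → A.State) (u : V) : Finset (Fin N × (Fin b → Bool)) :=
  (Finset.univ.filter fun v => G.Adj u v).image fun v => (uid v, A.tag i (uid v) (σ v))

open Classical in
/-- The possible proposals of `u`; each of them is equally likely. -/
noncomputable def proposals (A : MTMAlgorithm N b) (uid : V → Fin N) (G : SimpleGraph V) (i : ℕ)
    (σ : V → A.State) (u : V) : Finset (Option V) :=
  let cand := Finset.univ.filter fun v =>
    G.Adj u v ∧ uid v ∈ A.targets i (uid u) (σ u) (A.scan uid G i σ u)
  if cand.Nonempty then cand.image some else {none}

open Classical in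
/-- Given all proposals `prop`, the proposals which `v` may accept; each is equally likely.  A node
that has sent a proposal, or has received none, accepts nothing. -/
noncomputable def acceptances (prop : V → Option V) (v : V) : Finset (Option V) :=
  let inc := Finset.univ.filter fun u => prop v = none ∧ prop u = some v
  if inc.Nonempty then inc.image some else {none}

open Classical in
theorem proposals_nonempty (A : MTMAlgorithm N b) (uid : V → Fin N) (G : SimpleGraph V) (i : ℕ)
    (σ : V → A.State) : (Fintype.piFinset (A.proposals uid G i σ)).Nonempty := by
  refine Fintype.piFinset_nonempty.2 fun u => ?_
  simp only [proposals]
  split_ifs with h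
  · exact h.image _
  · exact Finset.singleton_nonempty _

open Classical in
theorem acceptances_nonempty (prop : V → Option V) :
    (Fintype.piFinset (acceptances prop)).Nonempty := by
  refine Fintype.piFinset_nonempty.2 fun u => ?_
  simp only [acceptances]
  split_ifs with h
  · exact h.image _
  · exact Finset.singleton_nonempty _

open Classical in
/-- The new state of `w`, when `prop` are the proposals sent, `acc` the proposals accepted, and
`coin` the random bits of the nodes. -/
noncomputable def update (A : MTMAlgorithm N b) (i : ℕ) (σ : V → A.State)
    (prop acc : V → Option V) (coin : V → A.Coin) (w : V) : A.State :=
  match acc w with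
  | some u => (A.connect i (σ u) (σ w) (coin w)).2
  | none =>
    match prop w with
    | some v => if acc v = some w then (A.connect i (σ w) (σ v) (coin v)).1 else σ w
    | none => σ w

open Classical in
/-- One round, with topology `G`.  A uniform element of `Fintype.piFinset S` consists of
independent uniform elements of the sets `S u`. -/
noncomputable def round (A : MTMAlgorithm N b) (uid : V → Fin N) (G : SimpleGraph V) (i : ℕ)
    (σ : V → A.State) : PMF (V → A.State) :=
  (PMF.uniformOfFinset _ (A.proposals_nonempty uid G i σ)).bind fun prop =>
    (PMF.uniformOfFinset _ (acceptances_nonempty prop)).bind fun acc =>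
      (PMF.uniformOfFintype (V → A.Coin)).map (A.update i σ prop acc)

open Classical in
/-- The law of the global state after `t` rounds, in the dynamic graph `G` (with `G i` the topology
of round `i`), with `T₀ v` the initial token set of `v`. -/
noncomputable def law (A : MTMAlgorithm N b) (uid : V → Fin N) (G : ℕ → SimpleGraph V)
    (T₀ : V → Finset (Fin N)) : ℕ → PMF (V → A.State)
  | 0 =>
    (PMF.uniformOfFintype (V → A.InitCoin)).map fun c v => A.init (uid v) (T₀ v) (c v)
  | t + 1 => (law A uid G T₀ t).bind (A.round uid (G t) t)

/-- With probability at least `1 - 1/n`, all nodes know all tokens by round `f`: that is, after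
any number `t ≥ f` of rounds. -/
def SolvesGossipBy (A : MTMAlgorithm N b) (uid : V → Fin N) (G : ℕ → SimpleGraph V)
    (T₀ : V → Finset (Fin N)) (f : ℝ) : Prop :=
  ∀ t : ℕ, f ≤ t →
    1 - 1 / (Fintype.card V : ENNReal) ≤
      (A.law uid G T₀ t).toOuterMeasure {σ | ∀ v w, T₀ w ⊆ A.tokens (σ v)}

end MTMAlgorithm

/-! ## Parameters of dynamic graphs -/

section Graphs

variable {V : Type} [Fintype V]

open Classical in
/-- The boundary `∂S`. -/
noncomputable def vertexBoundary (G : SimpleGraph V) (S : Finset V) : Finset V :=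
  Finset.univ.filter fun v => v ∉ S ∧ ∃ u ∈ S, G.Adj v u

/-- `α(G) = min |∂S| / |S|` over all `S` with `0 < |S| ≤ n/2`. -/
noncomputable def vertexExpansion (G : SimpleGraph V) : ℝ :=
  ⨅ S : {S : Finset V // 0 < S.card ∧ 2 * S.card ≤ Fintype.card V},
    ((vertexBoundary G S.1).card : ℝ) / (S.1.card : ℝ)

/-- `α` of a dynamic graph. -/
noncomputable def dynExpansion (G : ℕ → SimpleGraph V) : ℝ := ⨅ i, vertexExpansion (G i)

open Classical in
/-- `Δ` of a dynamic graph (a supremum of numbers that are at most `n`). -/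
noncomputable def dynMaxDegree (G : ℕ → SimpleGraph V) : ℕ := ⨆ i, (G i).maxDegree

/-- Stability factor `τ`: at least `τ` rounds pass between any two changes of the topology, and
for `τ = ∞` the topology never changes. -/
def IsStable (G : ℕ → SimpleGraph V) : ℕ∞ → Prop
  | ⊤ => ∀ i, G i = G 0
  | (τ : ℕ) => ∀ i j, i < j → G (i + 1) ≠ G i → G (j + 1) ≠ G j → i + τ ≤ j

/-- The exponent `1/τ`, with `1/∞ = 0`. -/
noncomputable def stabilityExponent : ℕ∞ → ℝ
  | ⊤ => 0
  | (τ : ℕ) => 1 / (τ : ℝ)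

end Graphs

/-! ## The token transfer subroutine -/

/-- The smallest prime `p ≥ 2N`. -/
noncomputable def eqPrime (N : ℕ) : ℕ := Nat.find (Nat.exists_infinite_primes (2 * N))

instance eqPrime_neZero (N : ℕ) : NeZero (eqPrime N) :=
  ⟨(Nat.find_spec (Nat.exists_infinite_primes (2 * N))).2.ne_zero⟩

/-- The fingerprint at the point `x` of the part of `T` in the interval `[a, m]`: the value at `x`
of the polynomial over `ZMod p` with exponents in `T ∩ [a, m]`. -/
noncomputable def fingerprint {N : ℕ} (T : Finset (Fin N)) (a m : ℕ) (x : ZMod (eqPrime N)) :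
    ZMod (eqPrime N) :=
  ∑ t ∈ T.filter (fun t => a ≤ t.val ∧ t.val ≤ m), x ^ t.val

/-- Repeated randomised equality test of `T₁ ∩ [a, m]` and `T₂ ∩ [a, m]`, one trial for each of the
`q` random points `x j`: the two parties compare their fingerprints.  Equal sets always pass; since
different sets have polynomials that agree at no more than `N - 1` of the `p ≥ 2N` points, they
pass one trial with probability at most `1/2`. -/
def EQTest {N q : ℕ} (T₁ T₂ : Finset (Fin N)) (a m : ℕ) (x : Fin q → ZMod (eqPrime N)) : Prop :=
  ∀ j, fingerprint T₁ a m (x j) = fingerprint T₂ a m (x j)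

open Classical in
/-- Binary search in `[a, b]` for the smallest token which exactly one party knows; one list entry
of random points is used in each iteration. -/
noncomputable def transferSearch {N q : ℕ} (T₁ T₂ : Finset (Fin N)) :
    List (Fin q → ZMod (eqPrime N)) → ℕ → ℕ → ℕ
  | [], a, _ => a
  | x :: xs, a, b =>
    if a = b then a
    else if EQTest T₁ T₂ a ((a + b) / 2) x then transferSearch T₁ T₂ xs ((a + b) / 2 + 1) b
    else transferSearch T₁ T₂ xs a ((a + b) / 2)

/-- The number `⌈log (log N / ε)⌉` of trials in each equality test, for `ε = N ^ (-ct)`. -/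
def transferTrials (ct N : ℕ) : ℕ := Nat.clog 2 (Nat.clog 2 N * N ^ ct)

/-- Random points for one call of the transfer subroutine: `⌈log N⌉` iterations. -/
abbrev TransferCoin (ct N : ℕ) : Type :=
  Fin (Nat.clog 2 N) → Fin (transferTrials ct N) → ZMod (eqPrime N)

/-- `Transfer(N ^ (-ct))`: the two token sets after the interaction.  The token found by the search
is given to the other party by each party that knows it. -/
noncomputable def transfer {ct N : ℕ} (T₁ T₂ : Finset (Fin N)) (x : TransferCoin ct N) :
    Finset (Fin N) × Finset (Fin N) :=
  let a := transferSearch T₁ T₂ (List.ofFn x) 0 (N - 1)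
  (T₁ ∪ T₂.filter (fun t => t.val = a), T₂ ∪ T₁.filter (fun t => t.val = a))

/-! ## SimSharedBit -/

/-- The constants in the description of the algorithm: strings have
`c * N ^ 2 + cBC * N ^ 2 * ⌈log N⌉ ^ 6` groups, random ID tags have `β * ⌈log N⌉` bits, and token
transfer has error bound `N ^ (-ct)`. -/
structure SSBConstants where
  c : ℕ
  cBC : ℕ
  β : ℕ
  ct : ℕ
  c_pos : 1 ≤ c
  cBC_pos : 1 ≤ cBC
  β_pos : 1 ≤ β
  ct_pos : 1 ≤ ct

/-- The two variants of the identifiers of leader candidates whose bits are advertised in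
BitConvergence: the UID itself, or a random ID tag (with ties broken by the UID). -/
inductive IdMode where
  | uid
  | randomTag

/-- The number of bits of an identifier. -/
def SSBConstants.idBits (P : SSBConstants) (N : ℕ) : IdMode → ℕ
  | .uid => Nat.clog 2 N
  | .randomTag => P.β * Nat.clog 2 N

/-- The number `t_SB + t_BC` of groups of a shared string. -/
def SSBConstants.groups (P : SSBConstants) (N : ℕ) : ℕ :=
  P.c * N ^ 2 + P.cBC * N ^ 2 * Nat.clog 2 N ^ 6

/-- The bit strings that are used as shared strings, partitioned into groups, each group into `N`
bundles, and each bundle into `⌈log N⌉ + 1` bits. -/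
abbrev SharedString (P : SSBConstants) (N : ℕ) : Type :=
  Fin (P.groups N) → Fin N → Fin (Nat.clog 2 N + 1) → Bool

/-- State of a node: the known tokens, the current candidate leader (its identifier and UID), and
its payload, which is the seed, i.e. the label of the string selected by that candidate. -/
structure SSBState (N m : ℕ) where
  tokens : Finset (Fin N)
  leaderId : ℕ
  leader : Fin N
  seed : Fin m

namespace SSBState

variable {N m : ℕ}

/-- The candidate of `s` is smaller than the candidate of `s'`. -/
def Less (s s' : SSBState N m) : Prop :=
  s.leaderId < s'.leaderId ∨ (s.leaderId = s'.leaderId ∧ s.leader < s'.leader)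

open Classical in
/-- Adopt the candidate, with its payload, of `s'` if it is smaller. -/
noncomputable def adopt (s s' : SSBState N m) : SSBState N m :=
  if s'.Less s then { s with leaderId := s'.leaderId, leader := s'.leader, seed := s'.seed } else s

end SSBState

/-- The bit advertised by BitConvergence in its `s`-th round (`s = 0, 1, …`).  Its rounds are
partitioned into groups of `2⌈log N⌉` rounds, and the groups into phases of `len` groups, where
`len` is the number of bits of an identifier; in the `j`-th group of a phase a node advertises the
`j`-th bit (most significant first) of the identifier of its current candidate. -/
def bitConvergenceBit (N len s : ℕ) (ident : ℕ) : Bool :=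
  ident.testBit (len - 1 - (s / (2 * Nat.clog 2 N)) % len)

/-- The bit advertised by SharedBit for the token set `T`, when `g` is the current group of the
shared string: the sum mod `2` of the first bits of the bundles of the tokens in `T`. -/
def sharedBitTag {N L : ℕ} (g : Fin N → Fin (L + 1) → Bool) (T : Finset (Fin N)) : Bool :=
  decide ((T.filter fun t => g t 0 = true).card % 2 = 1)

/-- The neighbour selected by SharedBit, among those with UIDs in `Z`, by the last `L` bits of
the bundle `bundle`: the number with these binary digits, mod `|Z|`, is its position in `Z`. -/
def sharedBitChoice {N L : ℕ} (bundle : Fin (L + 1) → Bool) (Z : Finset (Fin N)) :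
    Finset (Fin N) :=
  ((Z.sort (· ≤ ·))[(∑ j : Fin L, if bundle j.succ then 2 ^ j.val else 0) % Z.card]?).toFinset

section SimSharedBit

variable (P : SSBConstants) (mode : IdMode) {N m : ℕ} [NeZero m] (R : Fin m → SharedString P N)

/-- Group number `s` of the string that the seed of the candidate leader points to (if any).  After
the last group, SharedBit has terminated: nodes advertise `0` and send no proposals. -/
def currentGroup (s : ℕ) (st : SSBState N m) : Option (Fin N → Fin (Nat.clog 2 N + 1) → Bool) :=
  if h : s < P.groups N then some (R st.seed ⟨s, h⟩) else none

/-- The UIDs of the neighbours that advertise the bit `x`. -/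
def nbrsWithBit (nbrs : Finset (Fin N × (Fin 1 → Bool))) (x : Bool) : Finset (Fin N) :=
  (nbrs.filter fun q => q.2 0 = x).image Prod.fst

/-- The tag in round `i`.  The 1st, 3rd, 5th, … rounds (`i = 0, 2, 4, …`) are rounds number
`i / 2 = 0, 1, 2, …` of SharedBit, the others are rounds number `i / 2` of BitConvergence. -/
def ssbTag (i : ℕ) (st : SSBState N m) : Bool :=
  if i % 2 = 0 then
    match currentGroup P R (i / 2) st with
    | some g => sharedBitTag g st.tokens
    | none => false
  else bitConvergenceBit N (P.idBits N mode) (i / 2) st.leaderId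

/-- The proposals.  In SharedBit, a node that advertises `1` chooses a neighbour that advertises `0`
by means of the bits in the bundle of its own UID.  In BitConvergence, a node that advertises `0`
chooses a uniformly random neighbour that advertises `1`. -/
def ssbTargets (i : ℕ) (u : Fin N) (st : SSBState N m) (nbrs : Finset (Fin N × (Fin 1 → Bool))) :
    Finset (Fin N) :=
  if i % 2 = 0 then
    match currentGroup P R (i / 2) st with
    | some g =>
      if sharedBitTag g st.tokens = true then sharedBitChoice (g u) (nbrsWithBit nbrs false) else ∅
    | none => ∅
  else
    if bitConvergenceBit N (P.idBits N mode) (i / 2) st.leaderId = false then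
      nbrsWithBit nbrs true
    else ∅

/-- Connections: token transfer in rounds of SharedBit, exchange of the candidates and their
payloads in rounds of BitConvergence. -/
noncomputable def ssbConnect (i : ℕ) (s₁ s₂ : SSBState N m) (x : TransferCoin P.ct N) :
    SSBState N m × SSBState N m :=
  if i % 2 = 0 then
    ({ s₁ with tokens := (transfer s₁.tokens s₂.tokens x).1 },
     { s₂ with tokens := (transfer s₁.tokens s₂.tokens x).2 })
  else (s₁.adopt s₂, s₂.adopt s₁)

/-- SimSharedBit with the multiset of strings `R`, whose strings are labelled by `Fin m`, and with
tags of one bit.  At the beginning every node draws an ID tag and a seed uniformly at random. -/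
noncomputable def simSharedBit : MTMAlgorithm N 1 where
  State := SSBState N m
  InitCoin := Fin (2 ^ P.idBits N mode) × Fin m
  Coin := TransferCoin P.ct N
  init u T c :=
    { tokens := T
      leaderId := match mode with
        | .uid => u.val
        | .randomTag => c.1.val
      leader := u
      seed := c.2 }
  tag i _ st := fun _ => ssbTag P mode R i st
  targets := ssbTargets P mode R
  connect := ssbConnect P
  tokens := SSBState.tokens

end SimSharedBit

/-!
# SimSharedBit solves gossip in time `O(k n + log⁶ N · Δ^{1/τ} / α)`

Write `L = ⌈log₂ N⌉`.  The proof bounds the time until a leader is elected, then the time in which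
SharedBit spreads the tokens once all nodes use the string of the leader, and finally removes the
shared randomness.  Both times are bounded by `O(k n + L⁶ / α)` for `k ≥ 1`, which suffices since
`Δ^{1/τ} ≥ 1`.

*Leader election.*  The bits of the smallest identifier are settled one after the other, the most
significant one first.  Assume that all candidates agree with the smallest identifier in the higher
bits.  In a round in which the next bit is advertised, the nodes that disagree with the smallest
identifier in this bit are those that advertise `1` (`ssbTag_eq_true_iff`), and each of them that
receives a proposal gets into agreement (`card_agreeing_update`).  With `q = L²`, if both the `z`
nodes that agree and the `n - z` others are numerous compared to `q² / α`, then typically about `2q`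
of the ones receive a proposal (`expect_proposedOnes_le`).  Indeed, either at least `q` zeros have
`2q` or more ones as neighbours, and then few of their proposals coincide; or else, by expansion,
at least `(2q)²` ones have a zero with fewer than `2q` such neighbours next to them, and are hit by
nearly independent proposals.  For the other `z`, connectivity provides at least one new agreeing
node per round.  So `O(n / q + q² / α)` rounds suffice for one bit: the exponential of
`remainingWork` decreases in expectation by a constant factor in every relevant round, from which
`expect_no_leader_le` follows.  A bit is advertised only in one round out of `O(L)`, and there are
`O(L)` bits, which gives `O(n + L⁶ / α)` rounds in total.

*Spreading the tokens.*  If all nodes use the same string and some token is missing somewhere, then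
two neighbours know different sets.  They advertise different bits with probability `1/2` for a
random group of the string (`expect_sharedBitTag_eq`), and then some pair of nodes with different
sets connects and moves a token with probability at least `1/2` (`expect_transfer_fails_le`).  As at
most `n k` tokens have to be moved, `O(n k + L)` rounds suffice.  Again this is phrased by a
potential, averaged over the string (`expect_string_tokenPotential_le`); a group of the string is
used in a single round only, so that it is still uniformly random when it is used.  The argument
works for arbitrary strings of the nodes other than the leader, which matters only before a leader
is elected.

*Derandomisation.*  Up to the time that is relevant, the failure probability as a function of the
string of the leader is determined by one of finitely many codes (`InstanceCode`), namely
`2 ^ poly(N)` of them, which comprise the strings of all other nodes.  By a Chernoff and a union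
bound, some multiset of `N ^ 32` strings does almost as well as the set of all strings for all codes
simultaneously (`exists_sample`, `exists_strings`).  The seed of the leader is uniformly distributed
and independent of the identifiers and of all other seeds, so the algorithm may draw the string of
the leader from this multiset (`expect_seeds_failProb_le`).  Random tags of `4L` bits are distinct
with sufficient probability (`expect_identifier_not_injective_le`), and UIDs always are.
-/

open scoped ENNReal

/-! ### Expectations -/

namespace PMF

variable {α β : Type*}

/-- The expectation of an `ℝ≥0∞`-valued function of a random element with law `p`. -/
noncomputable def expect (p : PMF α) (f : α → ℝ≥0∞) : ℝ≥0∞ := ∑' a, p a * f a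

theorem expect_bind (p : PMF α) (k : α → PMF β) (f : β → ℝ≥0∞) :
    (p.bind k).expect f = p.expect fun a => (k a).expect f := by
  simp only [expect, bind_apply, ← ENNReal.tsum_mul_right, ← ENNReal.tsum_mul_left, mul_assoc]
  exact ENNReal.tsum_comm

theorem expect_pure (a : α) (f : α → ℝ≥0∞) : (PMF.pure a).expect f = f a := by
  rw [expect, tsum_eq_single a]
  · simp
  · intro b hb
    simp [hb]

theorem expect_map (p : PMF α) (g : α → β) (f : β → ℝ≥0∞) :
    (p.map g).expect f = p.expect fun a => f (g a) := by
  rw [PMF.map, expect_bind]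
  simp [expect_pure]

theorem expect_mono_of_mem_support {p : PMF α} {f g : α → ℝ≥0∞}
    (h : ∀ a ∈ p.support, f a ≤ g a) : p.expect f ≤ p.expect g := by
  refine ENNReal.tsum_le_tsum fun a => ?_
  by_cases ha : a ∈ p.support
  · exact mul_le_mul_right (h a ha) _
  · simp [(PMF.apply_eq_zero_iff p a).2 ha]

theorem expect_mono {p : PMF α} {f g : α → ℝ≥0∞} (h : ∀ a, f a ≤ g a) :
    p.expect f ≤ p.expect g :=
  expect_mono_of_mem_support fun a _ => h a

theorem expect_const (p : PMF α) (c : ℝ≥0∞) : (p.expect fun _ => c) = c := by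
  rw [expect, ENNReal.tsum_mul_right, p.tsum_coe, one_mul]

theorem expect_mul_const (p : PMF α) (f : α → ℝ≥0∞) (c : ℝ≥0∞) :
    (p.expect fun a => f a * c) = p.expect f * c := by
  simp only [expect, ← mul_assoc, ENNReal.tsum_mul_right]

theorem expect_const_mul (p : PMF α) (f : α → ℝ≥0∞) (c : ℝ≥0∞) :
    (p.expect fun a => c * f a) = c * p.expect f := by
  simpa only [mul_comm] using p.expect_mul_const f c

theorem expect_add (p : PMF α) (f g : α → ℝ≥0∞) :
    (p.expect fun a => f a + g a) = p.expect f + p.expect g := by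
  simp only [expect, mul_add, ENNReal.tsum_add]

theorem expect_finsetSum {ι : Type*} (p : PMF α) (s : Finset ι) (f : ι → α → ℝ≥0∞) :
    (p.expect fun a => ∑ i ∈ s, f i a) = ∑ i ∈ s, p.expect (f i) := by
  classical
  induction s using Finset.induction_on with
  | empty => simpa using p.expect_const 0
  | insert i s hi ih => simp [Finset.sum_insert hi, expect_add, ih]

theorem expect_le_of_le {p : PMF α} {f : α → ℝ≥0∞} {c : ℝ≥0∞}
    (h : ∀ a ∈ p.support, f a ≤ c) : p.expect f ≤ c :=
  (expect_mono_of_mem_support h).trans (p.expect_const c).le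

theorem toOuterMeasure_eq_expect (p : PMF α) (s : Set α) :
    p.toOuterMeasure s = p.expect (s.indicator fun _ => 1) := by
  rw [toOuterMeasure_apply, expect]
  congr 1
  ext a
  by_cases ha : a ∈ s <;> simp [ha]

theorem expect_uniformOfFinset (s : Finset α) (hs : s.Nonempty) (f : α → ℝ≥0∞) :
    (uniformOfFinset s hs).expect f = (∑ a ∈ s, f a) / s.card := by
  rw [expect, tsum_eq_sum (s := s)]
  · rw [ENNReal.div_eq_inv_mul, Finset.mul_sum]
    exact Finset.sum_congr rfl fun a ha => by rw [uniformOfFinset_apply_of_mem hs ha]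
  · intro a ha
    rw [uniformOfFinset_apply_of_notMem hs ha, zero_mul]

theorem expect_uniformOfFintype [Fintype α] [Nonempty α] (f : α → ℝ≥0∞) :
    (uniformOfFintype α).expect f = (∑ a, f a) / Fintype.card α :=
  expect_uniformOfFinset _ _ f

section Pi

variable {ι : Type*} [Fintype ι] [DecidableEq ι]

/-- Replacing one coordinate of a uniformly random element of a product by a fresh one does not
change its law. -/
theorem expect_resample {S : ι → Finset α} (hS : (Fintype.piFinset S).Nonempty) (i : ι)
    (hi : (S i).Nonempty) (f : (ι → α) → ℝ≥0∞) :
    ((uniformOfFinset _ hS).expect fun p =>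
      (uniformOfFinset _ hi).expect fun x => f (Function.update p i x)) =
    (uniformOfFinset _ hS).expect f := by
  simp only [expect_uniformOfFinset]
  have h0 : ((S i).card : ℝ≥0∞) ≠ 0 := by simpa using hi.ne_empty
  have key : ∑ p ∈ Fintype.piFinset S, ∑ x ∈ S i, f (Function.update p i x) =
      (∑ p ∈ Fintype.piFinset S, f p) * (S i).card := by
    rw [← Finset.sum_product']
    have : (∑ p ∈ Fintype.piFinset S, f p) * (S i).card =
        ∑ q ∈ Fintype.piFinset S ×ˢ S i, f q.1 := by
      rw [Finset.sum_product (f := fun q : (ι → α) × α => f q.1), Finset.sum_mul]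
      exact Finset.sum_congr rfl fun p _ => by simp [mul_comm]
    rw [this]
    -- exchanging the coordinate `i` with the fresh value is an involution
    refine Finset.sum_nbij' (fun q => (Function.update q.1 i q.2, q.1 i))
      (fun q => (Function.update q.1 i q.2, q.1 i)) ?_ ?_ ?_ ?_ ?_
    · rintro ⟨p, x⟩ h
      simp only [Finset.mem_product, Fintype.mem_piFinset] at h ⊢
      refine ⟨fun j => ?_, h.1 i⟩
      by_cases hj : j = i
      · subst hj; simpa using h.2
      · simpa [hj] using h.1 j
    · rintro ⟨p, x⟩ h
      simp only [Finset.mem_product, Fintype.mem_piFinset] at h ⊢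
      refine ⟨fun j => ?_, h.1 i⟩
      by_cases hj : j = i
      · subst hj; simpa using h.2
      · simpa [hj] using h.1 j
    · rintro ⟨p, x⟩ _; simp
    · rintro ⟨p, x⟩ _; simp
    · rintro ⟨p, x⟩ _; simp
  simp only [ENNReal.div_eq_inv_mul, ← Finset.mul_sum, key]
  rw [mul_comm (∑ p ∈ _, f p), ← mul_assoc, ← mul_assoc, mul_assoc _ _ ((S i).card : ℝ≥0∞),
    ENNReal.inv_mul_cancel h0 (ENNReal.natCast_ne_top _), mul_one]

theorem expect_resample_univ [Fintype α] [Nonempty α] (i : ι)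
    (f : (ι → α) → ℝ≥0∞) :
    ((uniformOfFintype (ι → α)).expect fun p =>
      (uniformOfFintype α).expect fun x => f (Function.update p i x)) =
    (uniformOfFintype (ι → α)).expect f := by
  have hne : (Fintype.piFinset fun _ : ι => (Finset.univ : Finset α)).Nonempty :=
    Fintype.piFinset_nonempty.2 fun _ => Finset.univ_nonempty
  have h : ∀ g : (ι → α) → ℝ≥0∞, (uniformOfFintype (ι → α)).expect g =
      (uniformOfFinset _ hne).expect g := by
    intro g
    rw [expect_uniformOfFinset, expect_uniformOfFintype, Fintype.piFinset_univ, Finset.card_univ]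
  rw [h, h]
  exact expect_resample hne i Finset.univ_nonempty f

/-- The coordinates of a uniformly random element of a product are independent. -/
theorem expect_prod {S : ι → Finset α} (hS : (Fintype.piFinset S).Nonempty)
    (f : ι → α → ℝ≥0∞) :
    ((uniformOfFinset _ hS).expect fun p => ∏ i, f i (p i)) =
      ∏ i, (∑ x ∈ S i, f i x) / (S i).card := by
  rw [expect_uniformOfFinset, ← Finset.prod_univ_sum, Fintype.card_piFinset]
  simp only [ENNReal.div_eq_inv_mul, Finset.prod_mul_distrib]
  congr 1
  push_cast
  rw [ENNReal.prod_inv_distrib]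
  intro i _ j _ _
  right
  exact ENNReal.natCast_ne_top _

end Pi

end PMF

/-! ### Executions from a fixed initial state -/

namespace MTMAlgorithm

variable {N b : ℕ} {V : Type} [Fintype V]

/-- The law of the global state after `t` rounds, when the initial global state is `σ₀`. -/
noncomputable def lawFrom (A : MTMAlgorithm N b) (uid : V → Fin N) (G : ℕ → SimpleGraph V)
    (σ₀ : V → A.State) : ℕ → PMF (V → A.State)
  | 0 => PMF.pure σ₀
  | t + 1 => (lawFrom A uid G σ₀ t).bind (A.round uid (G t) t)

/-- The execution given the initial random choices of the nodes. -/
theorem law_eq_bind_lawFrom [DecidableEq V] (A : MTMAlgorithm N b) (uid : V → Fin N)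
    (G : ℕ → SimpleGraph V) (T₀ : V → Finset (Fin N)) (t : ℕ) :
    A.law uid G T₀ t = (PMF.uniformOfFintype (V → A.InitCoin)).bind fun c =>
      A.lawFrom uid G (fun v => A.init (uid v) (T₀ v) (c v)) t := by
  obtain rfl : ‹DecidableEq V› = fun a b => Classical.propDecidable (a = b) :=
    Subsingleton.elim _ _
  induction t with
  | zero => rfl
  | succ t ih => simp only [law, lawFrom, ih, PMF.bind_bind]

theorem lawFrom_congr (A : MTMAlgorithm N b) (uid : V → Fin N) {G G' : ℕ → SimpleGraph V}
    (σ₀ : V → A.State) {t : ℕ} (h : ∀ i < t, G i = G' i) :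
    A.lawFrom uid G σ₀ t = A.lawFrom uid G' σ₀ t := by
  induction t with
  | zero => rfl
  | succ t ih =>
    rw [lawFrom, lawFrom, ih fun i hi => h i (hi.trans t.lt_succ_self), h t t.lt_succ_self]

open Classical in
theorem expect_round (A : MTMAlgorithm N b) (uid : V → Fin N) (G : SimpleGraph V) (i : ℕ)
    (σ : V → A.State) (f : (V → A.State) → ℝ≥0∞) :
    (A.round uid G i σ).expect f =
      (PMF.uniformOfFinset _ (A.proposals_nonempty uid G i σ)).expect fun prop =>
        (PMF.uniformOfFinset _ (acceptances_nonempty prop)).expect fun acc =>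
          (PMF.uniformOfFintype (V → A.Coin)).expect fun coin =>
            f (A.update i σ prop acc coin) := by
  simp only [round, PMF.expect_bind, PMF.expect_map]

open Classical in
theorem exists_of_mem_support_round {A : MTMAlgorithm N b} {uid : V → Fin N} {G : SimpleGraph V}
    {i : ℕ} {σ σ' : V → A.State} (h : σ' ∈ (A.round uid G i σ).support) :
    ∃ prop ∈ Fintype.piFinset (A.proposals uid G i σ),
      ∃ acc ∈ Fintype.piFinset (acceptances prop), ∃ coin, σ' = A.update i σ prop acc coin := by
  simp only [round, PMF.mem_support_bind_iff, PMF.mem_support_uniformOfFinset_iff,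
    PMF.mem_support_map_iff] at h
  obtain ⟨prop, hp, acc, ha, coin, -, rfl⟩ := h
  exact ⟨prop, hp, acc, ha, coin, rfl⟩

/-- A property that every round preserves holds at all times. -/
theorem mem_support_lawFrom {A : MTMAlgorithm N b} {uid : V → Fin N} {G : ℕ → SimpleGraph V}
    {σ₀ : V → A.State} (Inv : (V → A.State) → Prop) (h₀ : Inv σ₀)
    (hInv : ∀ i σ σ', Inv σ → σ' ∈ (A.round uid (G i) i σ).support → Inv σ') (t : ℕ) :
    ∀ σ ∈ (A.lawFrom uid G σ₀ t).support, Inv σ := by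
  induction t with
  | zero =>
    intro σ hσ
    simp only [lawFrom, PMF.support_pure, Set.mem_singleton_iff] at hσ
    exact hσ ▸ h₀
  | succ t ih =>
    intro σ hσ
    simp only [lawFrom, PMF.mem_support_bind_iff] at hσ
    obtain ⟨σ₁, h₁, h₂⟩ := hσ
    exact hInv t σ₁ σ (ih σ₁ h₁) h₂

/-- A time-dependent potential whose expectation does not increase in any round from `a` to `b`,
from states that satisfy an invariant, does not increase in expectation from `a` to `b`. -/
theorem expect_lawFrom_le {A : MTMAlgorithm N b} {uid : V → Fin N} {G : ℕ → SimpleGraph V}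
    {σ₀ : V → A.State} (Inv : (V → A.State) → Prop) (h₀ : Inv σ₀)
    (hInv : ∀ i σ σ', Inv σ → σ' ∈ (A.round uid (G i) i σ).support → Inv σ')
    (Φ : ℕ → (V → A.State) → ℝ≥0∞) {s t : ℕ} (hst : s ≤ t)
    (hstep : ∀ i, s ≤ i → i < t → ∀ σ, Inv σ →
      (A.round uid (G i) i σ).expect (Φ (i + 1)) ≤ Φ i σ) :
    (A.lawFrom uid G σ₀ t).expect (Φ t) ≤ (A.lawFrom uid G σ₀ s).expect (Φ s) := by
  induction t, hst using Nat.le_induction with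
  | base => exact le_rfl
  | succ t hst ih =>
    rw [lawFrom, PMF.expect_bind]
    refine le_trans (PMF.expect_mono_of_mem_support fun σ hσ => ?_)
      (ih fun i hi hit => hstep i hi (hit.trans t.lt_succ_self))
    exact hstep t hst t.lt_succ_self σ (mem_support_lawFrom Inv h₀ hInv t σ hσ)

open Classical in
theorem acceptances_some {prop acc : V → Option V}
    (hacc : acc ∈ Fintype.piFinset (acceptances prop)) {u v : V} (h : acc v = some u) :
    prop v = none ∧ prop u = some v := by
  have := Fintype.mem_piFinset.1 hacc v
  simp only [acceptances, h] at this
  split_ifs at this with h'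
  · simpa using this
  · simp at this

open Classical in
theorem exists_acceptance {prop acc : V → Option V}
    (hacc : acc ∈ Fintype.piFinset (acceptances prop)) {u v : V} (hv : prop v = none)
    (hu : prop u = some v) : ∃ w, acc v = some w ∧ prop w = some v := by
  have := Fintype.mem_piFinset.1 hacc v
  simp only [acceptances] at this
  rw [if_pos ⟨u, by simp [hv, hu]⟩] at this
  obtain ⟨w, hw, hw'⟩ := Finset.mem_image.1 this
  exact ⟨w, hw'.symm, (Finset.mem_filter.1 hw).2.2⟩

omit [Fintype V] in
/-- The new state of a node that accepts a proposal. -/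
theorem update_of_acc (A : MTMAlgorithm N b) (i : ℕ) (σ : V → A.State) (prop : V → Option V)
    {acc : V → Option V} (coin : V → A.Coin) {u w : V} (h : acc w = some u) :
    A.update i σ prop acc coin w = (A.connect i (σ u) (σ w) (coin w)).2 := by
  simp [update, h]

omit [Fintype V] in
/-- The new state of a node whose proposal is accepted. -/
theorem update_of_acc' (A : MTMAlgorithm N b) (i : ℕ) (σ : V → A.State) {prop : V → Option V}
    {acc : V → Option V} (coin : V → A.Coin) {u w : V} (hw : acc w = none)
    (hp : prop w = some u) (h : acc u = some w) :
    A.update i σ prop acc coin w = (A.connect i (σ w) (σ u) (coin u)).1 := by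
  simp [update, h, hw, hp]

omit [Fintype V] in
theorem update_cases (A : MTMAlgorithm N b) (i : ℕ) (σ : V → A.State) (prop acc : V → Option V)
    (coin : V → A.Coin) (w : V) :
    A.update i σ prop acc coin w = σ w ∨
      (∃ u c, A.update i σ prop acc coin w = (A.connect i (σ u) (σ w) c).2) ∨
      ∃ u c, A.update i σ prop acc coin w = (A.connect i (σ w) (σ u) c).1 := by
  unfold update
  split
  · exact Or.inr (Or.inl ⟨_, _, rfl⟩)
  · split
    · split_ifs
      · exact Or.inr (Or.inr ⟨_, _, rfl⟩)
      · exact Or.inl rfl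
    · exact Or.inl rfl

end MTMAlgorithm

/-! ### Rounds of SimSharedBit -/

section SimSharedBit

variable {P : SSBConstants} {mode : IdMode} {N m : ℕ} [NeZero m] {R : Fin m → SharedString P N}
  {V : Type} [Fintype V] {uid : V → Fin N} {G : SimpleGraph V} {i : ℕ}

/-- One round of SimSharedBit. -/
noncomputable abbrev ssbRound (P : SSBConstants) (mode : IdMode) (R : Fin m → SharedString P N)
    (uid : V → Fin N) (G : SimpleGraph V) (i : ℕ) (σ : V → SSBState N m) :
    PMF (V → SSBState N m) :=
  (simSharedBit P mode R).round uid G i σ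

/-- The law of the global state of SimSharedBit after `t` rounds. -/
noncomputable abbrev ssbLaw (P : SSBConstants) (mode : IdMode) (R : Fin m → SharedString P N)
    (uid : V → Fin N) (G : ℕ → SimpleGraph V) (σ₀ : V → SSBState N m) (t : ℕ) :
    PMF (V → SSBState N m) :=
  (simSharedBit P mode R).lawFrom uid G σ₀ t

/-- The global state after a round of SimSharedBit with given random choices. -/
noncomputable abbrev ssbUpdate (P : SSBConstants) (mode : IdMode) (R : Fin m → SharedString P N)
    (i : ℕ) (σ : V → SSBState N m) (prop acc : V → Option V) (coin : V → TransferCoin P.ct N) :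
    V → SSBState N m :=
  (simSharedBit P mode R).update i σ prop acc coin

/-- The possible proposals of a node in a round of SimSharedBit. -/
noncomputable abbrev ssbProposals (P : SSBConstants) (mode : IdMode)
    (R : Fin m → SharedString P N) (uid : V → Fin N) (G : SimpleGraph V) (i : ℕ)
    (σ : V → SSBState N m) : V → Finset (Option V) :=
  (simSharedBit P mode R).proposals uid G i σ

open Classical in
theorem expect_ssbRound (σ : V → SSBState N m) (f : (V → SSBState N m) → ℝ≥0∞) :
    (ssbRound P mode R uid G i σ).expect f =
      (PMF.uniformOfFinset (Fintype.piFinset (ssbProposals P mode R uid G i σ))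
        ((simSharedBit P mode R).proposals_nonempty uid G i σ)).expect fun prop =>
        (PMF.uniformOfFinset _ (MTMAlgorithm.acceptances_nonempty prop)).expect fun acc =>
          (PMF.uniformOfFintype (V → TransferCoin P.ct N)).expect fun coin =>
            f (ssbUpdate P mode R i σ prop acc coin) :=
  MTMAlgorithm.expect_round _ _ _ _ _ _

theorem mem_nbrsWithBit_scan (σ : V → SSBState N m) (u : V) (x : Bool) (U : Fin N) :
    U ∈ nbrsWithBit ((simSharedBit P mode R).scan uid G i σ u) x ↔
      ∃ v, G.Adj u v ∧ ssbTag P mode R i (σ v) = x ∧ uid v = U := by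
  simp only [nbrsWithBit, MTMAlgorithm.scan, simSharedBit, Finset.mem_image, Finset.mem_filter,
    Finset.mem_univ, true_and]
  constructor
  · rintro ⟨q, ⟨⟨v, hv, rfl⟩, hq⟩, rfl⟩
    exact ⟨v, hv, hq, rfl⟩
  · rintro ⟨v, hv, hx, rfl⟩
    exact ⟨_, ⟨⟨v, hv, rfl⟩, hx⟩, rfl⟩

open Classical in
/-- In a round of BitConvergence, a node that advertises `0` proposes to a uniformly random
neighbour that advertises `1`. -/
theorem ssbProposals_odd (huid : Function.Injective uid) (hi : i % 2 = 1)
    (σ : V → SSBState N m) (u : V) :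
    ssbProposals P mode R uid G i σ u =
      let cand := Finset.univ.filter fun v => G.Adj u v ∧
        ssbTag P mode R i (σ u) = false ∧ ssbTag P mode R i (σ v) = true
      if cand.Nonempty then cand.image some else {none} := by
  have key : ∀ v, (G.Adj u v ∧ uid v ∈ (simSharedBit P mode R).targets i (uid u) (σ u)
      ((simSharedBit P mode R).scan uid G i σ u)) ↔
      (G.Adj u v ∧ ssbTag P mode R i (σ u) = false ∧ ssbTag P mode R i (σ v) = true) := by
    intro v
    refine and_congr_right fun hadj => ?_
    have h1 : (simSharedBit P mode R).targets i (uid u) (σ u)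
      ((simSharedBit P mode R).scan uid G i σ u) =
      if ssbTag P mode R i (σ u) = false then
        nbrsWithBit ((simSharedBit P mode R).scan uid G i σ u) true else ∅ := by
      simp [simSharedBit, ssbTargets, ssbTag, hi]
    rw [h1]
    split_ifs with h
    · simp only [mem_nbrsWithBit_scan, h, true_and]
      constructor
      · rintro ⟨v', -, h', hv'⟩
        rwa [← huid hv']
      · intro h'
        exact ⟨v, hadj, h', rfl⟩
    · simp [h]
  simp only [ssbProposals, MTMAlgorithm.proposals]
  rw [show (Finset.univ.filter fun v => G.Adj u v ∧ uid v ∈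
    (simSharedBit P mode R).targets i (uid u) (σ u)
      ((simSharedBit P mode R).scan uid G i σ u)) = _ from Finset.filter_congr fun v _ => key v]

/-- Since the position is taken modulo the number of elements, some element is always chosen. -/
theorem sharedBitChoice_spec {L : ℕ} (bundle : Fin (L + 1) → Bool) {Z : Finset (Fin N)}
    (hZ : Z.Nonempty) : ∃ z ∈ Z, sharedBitChoice bundle Z = {z} := by
  have hlt : (∑ j : Fin L, if bundle j.succ then 2 ^ j.val else 0) % Z.card <
      (Z.sort (· ≤ ·)).length := by
    rw [Finset.length_sort]
    exact Nat.mod_lt _ hZ.card_pos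
  refine ⟨(Z.sort (· ≤ ·))[_]'hlt, (Finset.mem_sort _).1 (List.getElem_mem hlt), ?_⟩
  rw [sharedBitChoice, List.getElem?_eq_getElem hlt]
  simp

open Classical in
/-- In a round of SharedBit, a node that advertises `0` sends no proposal. -/
theorem ssbProposals_even_of_tag_false (hi : i % 2 = 0) (σ : V → SSBState N m) {u : V}
    (hu : ssbTag P mode R i (σ u) = false) : ssbProposals P mode R uid G i σ u = {none} := by
  have h1 : (simSharedBit P mode R).targets i (uid u) (σ u)
      ((simSharedBit P mode R).scan uid G i σ u) = ∅ := by
    simp only [ssbTag, hi, if_true] at hu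
    simp only [simSharedBit, ssbTargets, hi, if_true]
    split
    · rename_i g hg
      rw [hg] at hu
      simp only at hu
      simp [hu]
    · rfl
  simp [ssbProposals, MTMAlgorithm.proposals, h1]

open Classical in
/-- In a round of SharedBit, a node that advertises `1` and has a neighbour that advertises `0`
proposes to such a neighbour. -/
theorem ssbProposals_even_of_tag_true (huid : Function.Injective uid) (hi : i % 2 = 0)
    (σ : V → SSBState N m) {u v : V}
    (hu : ssbTag P mode R i (σ u) = true) (huv : G.Adj u v)
    (hv : ssbTag P mode R i (σ v) = false) :
    ∃ w, ssbTag P mode R i (σ w) = false ∧ ssbProposals P mode R uid G i σ u = {some w} := by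
  set Z := nbrsWithBit ((simSharedBit P mode R).scan uid G i σ u) false with hZdef
  have hZ : Z.Nonempty := ⟨uid v, (mem_nbrsWithBit_scan σ u false _).2 ⟨v, huv, hv, rfl⟩⟩
  have h1 : ∃ z ∈ Z, (simSharedBit P mode R).targets i (uid u) (σ u)
      ((simSharedBit P mode R).scan uid G i σ u) = {z} := by
    simp only [ssbTag, hi, if_true] at hu
    simp only [simSharedBit, ssbTargets, hi, if_true]
    split
    · rename_i g hg
      rw [hg] at hu
      simp only at hu
      simp only [hu, if_true]
      exact sharedBitChoice_spec _ hZ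
    · rename_i hg
      rw [hg] at hu
      simp at hu
  obtain ⟨z, hz, h1⟩ := h1
  obtain ⟨w, hw, hwt, rfl⟩ := (mem_nbrsWithBit_scan σ u false _).1 hz
  refine ⟨w, hwt, ?_⟩
  have h2 : (Finset.univ.filter fun v => G.Adj u v ∧ uid v ∈
      (simSharedBit P mode R).targets i (uid u) (σ u)
        ((simSharedBit P mode R).scan uid G i σ u)) = {w} := by
    ext v'
    simp only [h1, Finset.mem_filter, Finset.mem_univ, true_and, Finset.mem_singleton]
    constructor
    · rintro ⟨-, h⟩
      exact huid h
    · rintro rfl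
      exact ⟨hw, rfl⟩
  simp only [ssbProposals, MTMAlgorithm.proposals]
  rw [h2]
  simp

open Classical in
/-- In a round of SharedBit, whoever sends a proposal advertises `1`. -/
theorem ssbTag_of_proposal_even (hi : i % 2 = 0)
    (σ : V → SSBState N m) {prop : V → Option V}
    (hprop : prop ∈ Fintype.piFinset (ssbProposals P mode R uid G i σ)) {u v : V}
    (huv : prop u = some v) :
    ssbTag P mode R i (σ u) = true := by
  by_contra h
  have := Fintype.mem_piFinset.1 hprop u
  rw [ssbProposals_even_of_tag_false hi σ (by simpa using h), huv] at this
  simp at this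

omit [Fintype V] in
/-- The effect of one round on one node: it may learn tokens of another node, and adopt its
candidate. -/
theorem ssbUpdate_spec (σ : V → SSBState N m) (prop acc : V → Option V)
    (coin : V → TransferCoin P.ct N) (w : V) :
    ∃ u, (σ w).tokens ⊆ (ssbUpdate P mode R i σ prop acc coin w).tokens ∧
      (ssbUpdate P mode R i σ prop acc coin w).tokens ⊆ (σ w).tokens ∪ (σ u).tokens ∧
      (ssbUpdate P mode R i σ prop acc coin w).leaderId ≤ (σ w).leaderId ∧
      ∃ x, (ssbUpdate P mode R i σ prop acc coin w).leaderId = (σ x).leaderId ∧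
        (ssbUpdate P mode R i σ prop acc coin w).leader = (σ x).leader ∧
        (ssbUpdate P mode R i σ prop acc coin w).seed = (σ x).seed := by
  have hadopt : ∀ u, ((σ w).adopt (σ u)).leaderId ≤ (σ w).leaderId ∧
      ((σ w).adopt (σ u)).tokens = (σ w).tokens ∧
      ∃ x, ((σ w).adopt (σ u)).leaderId = (σ x).leaderId ∧
        ((σ w).adopt (σ u)).leader = (σ x).leader ∧ ((σ w).adopt (σ u)).seed = (σ x).seed := by
    intro u
    unfold SSBState.adopt
    split_ifs with h
    · refine ⟨?_, rfl, u, rfl, rfl, rfl⟩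
      rcases h with h | h
      · exact h.le
      · exact h.1.le
    · exact ⟨le_rfl, rfl, w, rfl, rfl, rfl⟩
  rcases (simSharedBit P mode R).update_cases i σ prop acc coin w with h | ⟨u, c, h⟩ | ⟨u, c, h⟩
  · refine ⟨w, ?_⟩
    simp only [ssbUpdate, h]
    exact ⟨subset_rfl, Finset.subset_union_left, le_rfl, w, rfl, rfl, rfl⟩
  · refine ⟨u, ?_⟩
    simp only [ssbUpdate, h]
    simp only [simSharedBit, ssbConnect]
    split_ifs
    · refine ⟨Finset.subset_union_left, ?_, le_rfl, w, rfl, rfl, rfl⟩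
      exact Finset.union_subset_union_right (Finset.filter_subset _ _)
    · obtain ⟨h1, h2, h3⟩ := hadopt u
      exact ⟨h2.symm.subset, h2.subset.trans Finset.subset_union_left, h1, h3⟩
  · refine ⟨u, ?_⟩
    simp only [ssbUpdate, h]
    simp only [simSharedBit, ssbConnect]
    split_ifs
    · refine ⟨Finset.subset_union_left, ?_, le_rfl, w, rfl, rfl, rfl⟩
      exact Finset.union_subset_union_right (Finset.filter_subset _ _)
    · obtain ⟨h1, h2, h3⟩ := hadopt u
      exact ⟨h2.symm.subset, h2.subset.trans Finset.subset_union_left, h1, h3⟩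

/-- Renaming of seeds. -/
def SSBState.mapSeed {m' : ℕ} (S : Fin m' → Fin m) (s : SSBState N m') : SSBState N m where
  tokens := s.tokens
  leaderId := s.leaderId
  leader := s.leader
  seed := S s.seed

omit [NeZero m] in
theorem SSBState.mapSeed_adopt {m' : ℕ} (S : Fin m' → Fin m) (s s' : SSBState N m') :
    (s.mapSeed S).adopt (s'.mapSeed S) = (s.adopt s').mapSeed S := by
  unfold adopt
  have : (s'.mapSeed S).Less (s.mapSeed S) ↔ s'.Less s := Iff.rfl
  by_cases h : s'.Less s
  · rw [if_pos h, if_pos (this.2 h)]; rfl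
  · rw [if_neg h, if_neg (mt this.1 h)]

omit [Fintype V] in
theorem ssbUpdate_mapSeed {m' : ℕ} [NeZero m'] (S : Fin m' → Fin m) (σ : V → SSBState N m')
    (prop acc : V → Option V) (coin : V → TransferCoin P.ct N) :
    ssbUpdate P mode R i (fun v => (σ v).mapSeed S) prop acc coin =
      fun v => (ssbUpdate P mode (fun k => R (S k)) i σ prop acc coin v).mapSeed S := by
  have hconn : ∀ s₁ s₂ : SSBState N m', ∀ c, ssbConnect P i (s₁.mapSeed S) (s₂.mapSeed S) c =
      ((ssbConnect P i s₁ s₂ c).1.mapSeed S, (ssbConnect P i s₁ s₂ c).2.mapSeed S) := by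
    intro s₁ s₂ c
    unfold ssbConnect
    split_ifs
    · rfl
    · rw [SSBState.mapSeed_adopt, SSBState.mapSeed_adopt]
  funext w
  simp only [ssbUpdate, MTMAlgorithm.update, simSharedBit, hconn]
  split
  · rfl
  · split
    · split_ifs <;> rfl
    · rfl

open Classical in
/-- SimSharedBit only uses a seed to look up the string with this label. -/
theorem ssbRound_mapSeed {m' : ℕ} [NeZero m'] (S : Fin m' → Fin m) (σ : V → SSBState N m') :
    ssbRound P mode R uid G i (fun v => (σ v).mapSeed S) =
      (ssbRound P mode (fun k => R (S k)) uid G i σ).map fun τ v => (τ v).mapSeed S := by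
  have hu : ∀ prop acc : V → Option V,
      (simSharedBit P mode R).update i (fun v => (σ v).mapSeed S) prop acc =
      (fun τ v => (τ v).mapSeed S) ∘ (simSharedBit P mode (fun k => R (S k))).update i σ prop acc :=
    fun prop acc => funext fun coin => ssbUpdate_mapSeed S σ prop acc coin
  refine Eq.trans ?_ (PMF.map_bind _ _ _).symm
  refine congrArg (PMF.bind _) (funext fun prop => ?_)
  refine Eq.trans ?_ (PMF.map_bind _ _ _).symm
  refine congrArg (PMF.bind _) (funext fun acc => ?_)
  refine Eq.trans ?_ (PMF.map_comp _ _ _).symm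
  rw [hu]
  rfl

/-- Renaming the seeds and relabelling the strings accordingly yields the same execution. -/
theorem ssbLaw_mapSeed {G : ℕ → SimpleGraph V} {m' : ℕ} [NeZero m'] (S : Fin m' → Fin m)
    (σ₀ : V → SSBState N m') (t : ℕ) :
    ssbLaw P mode R uid G (fun v => (σ₀ v).mapSeed S) t =
      (ssbLaw P mode (fun k => R (S k)) uid G σ₀ t).map fun τ v => (τ v).mapSeed S := by
  induction t with
  | zero => exact (PMF.pure_map (fun (τ : V → SSBState N m') v => (τ v).mapSeed S) σ₀).symm
  | succ t ih =>
    have h1 : ssbLaw P mode R uid G (fun v => (σ₀ v).mapSeed S) (t + 1) =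
        (ssbLaw P mode R uid G (fun v => (σ₀ v).mapSeed S) t).bind
          (ssbRound P mode R uid (G t) t) := rfl
    have h2 : ssbLaw P mode (fun k => R (S k)) uid G σ₀ (t + 1) =
        (ssbLaw P mode (fun k => R (S k)) uid G σ₀ t).bind
          (ssbRound P mode (fun k => R (S k)) uid (G t) t) := rfl
    rw [h1, h2, ih, PMF.bind_map, PMF.map_bind]
    congr 1
    funext τ
    exact ssbRound_mapSeed S τ

end SimSharedBit

/-! ### Vertex expansion -/

section Expansion

variable {V : Type} [Fintype V]

theorem vertexExpansion_mul_card_le (G : SimpleGraph V) {S : Finset V}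
    (hS : 2 * S.card ≤ Fintype.card V) :
    vertexExpansion G * S.card ≤ (vertexBoundary G S).card := by
  rcases S.card.eq_zero_or_pos with h0 | h0
  · simp [h0]
  · rw [← le_div_iff₀ (by exact_mod_cast h0)]
    refine ciInf_le ⟨0, ?_⟩ (⟨S, h0, hS⟩ : {S : Finset V // 0 < S.card ∧ 2 * S.card ≤ Fintype.card V})
    rintro _ ⟨S, rfl⟩
    positivity

theorem vertexExpansion_nonneg (G : SimpleGraph V) : 0 ≤ vertexExpansion G :=
  Real.iInf_nonneg fun S => by positivity

/-- The expansion exceeds `1` only because of the rounding in `|S| ≤ n / 2`: a set with `⌊n / 2⌋`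
elements has at most `⌈n / 2⌉` boundary nodes. -/
theorem vertexExpansion_le_two (hV : 2 ≤ Fintype.card V) (G : SimpleGraph V) :
    vertexExpansion G ≤ 2 := by
  classical
  obtain ⟨S, -, hS⟩ := Finset.exists_subset_card_eq (s := (Finset.univ : Finset V))
    (n := Fintype.card V / 2) (by rw [Finset.card_univ]; omega)
  have h1 := vertexExpansion_mul_card_le G (S := S) (by omega)
  have h2 : (vertexBoundary G S).card ≤ 2 * S.card := by
    have : (vertexBoundary G S).card ≤ Sᶜ.card :=
      Finset.card_le_card fun v hv => by
        simp only [vertexBoundary, Finset.mem_filter] at hv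
        simpa using hv.2.1
    rw [Finset.card_compl] at this
    omega
  have h3 : (0 : ℝ) < S.card := by
    have : 0 < S.card := by omega
    exact_mod_cast this
  have h4 : ((vertexBoundary G S).card : ℝ) ≤ 2 * S.card := by exact_mod_cast h2
  exact le_of_mul_le_mul_right (h1.trans h4) h3

omit [Fintype V] in
/-- An edge of a connected graph that leaves a given set. -/
theorem exists_adj_of_connected {G : SimpleGraph V} (hG : G.Connected) {S : Set V} {a b : V}
    (ha : a ∈ S) (hb : b ∉ S) : ∃ u ∈ S, ∃ v ∉ S, G.Adj u v := by
  obtain ⟨p⟩ := hG.preconnected a b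
  obtain ⟨d, hd, h1, h2⟩ := p.exists_boundary_dart S ha hb
  exact ⟨d.fst, h1, d.snd, h2, d.adj⟩

theorem inv_card_le_vertexExpansion (hV : 2 ≤ Fintype.card V) {G : SimpleGraph V}
    (hG : G.Connected) : 1 / (Fintype.card V : ℝ) ≤ vertexExpansion G := by
  classical
  obtain ⟨x⟩ : Nonempty V := Fintype.card_pos_iff.1 (by omega)
  have : Nonempty {S : Finset V // 0 < S.card ∧ 2 * S.card ≤ Fintype.card V} :=
    ⟨⟨{x}, by simp, by simpa using hV⟩⟩
  refine le_ciInf fun ⟨S, h0, hS⟩ => ?_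
  obtain ⟨a, ha⟩ := Finset.card_pos.1 h0
  obtain ⟨b, hb⟩ : ∃ b, b ∉ S := by
    by_contra! h
    rw [Finset.eq_univ_of_forall h, Finset.card_univ] at hS
    omega
  obtain ⟨u, hu, v, hv, huv⟩ := exists_adj_of_connected hG (S := (S : Set V)) ha hb
  have h1 : 1 ≤ (vertexBoundary G S).card := Finset.card_pos.2 ⟨v, by
    simp only [vertexBoundary, Finset.mem_filter, Finset.mem_univ, true_and]
    exact ⟨hv, u, hu, huv.symm⟩⟩
  have h2 : S.card ≤ Fintype.card V := S.card_le_univ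
  have h3 : (1 : ℝ) ≤ (vertexBoundary G S).card := by exact_mod_cast h1
  have h4 : (S.card : ℝ) ≤ Fintype.card V := by exact_mod_cast h2
  have h5 : (0 : ℝ) < S.card := by exact_mod_cast h0
  gcongr

theorem dynExpansion_le (G : ℕ → SimpleGraph V) (i : ℕ) :
    dynExpansion G ≤ vertexExpansion (G i) :=
  ciInf_le ⟨0, by rintro _ ⟨i, rfl⟩; exact vertexExpansion_nonneg _⟩ i

theorem inv_card_le_dynExpansion (hV : 2 ≤ Fintype.card V) {G : ℕ → SimpleGraph V}
    (hG : ∀ i, (G i).Connected) : 1 / (Fintype.card V : ℝ) ≤ dynExpansion G :=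
  le_ciInf fun i => inv_card_le_vertexExpansion hV (hG i)

end Expansion

/-! ### Random proposals from zeros to ones -/

section Proposals

variable {V : Type} [Fintype V]

open Classical in
/-- The neighbours to which `u` may propose: those labelled `true`, if `u` is labelled `false`. -/
noncomputable def oneNbrs (G : SimpleGraph V) (tag : V → Bool) (u : V) : Finset V :=
  Finset.univ.filter fun v => G.Adj u v ∧ tag u = false ∧ tag v = true

open Classical in
/-- The possible proposals of `u`; `none` is a proposal only if there is no other. -/
noncomputable def oneProposals (G : SimpleGraph V) (tag : V → Bool) (u : V) : Finset (Option V) :=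
  if (oneNbrs G tag u).Nonempty then (oneNbrs G tag u).image some else {none}

open Classical in
/-- The nodes labelled `true` that receive a proposal. -/
noncomputable def proposedOnes (tag : V → Bool) (prop : V → Option V) : Finset V :=
  Finset.univ.filter fun v => tag v = true ∧ ∃ u, prop u = some v

open Classical in
theorem oneProposals_nonempty (G : SimpleGraph V) (tag : V → Bool) :
    (Fintype.piFinset (oneProposals G tag)).Nonempty := by
  refine Fintype.piFinset_nonempty.2 fun u => ?_
  unfold oneProposals
  split_ifs with h
  · exact h.image _
  · exact Finset.singleton_nonempty _

theorem card_oneProposals_of_nonempty {G : SimpleGraph V} {tag : V → Bool} {u : V}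
    (h : (oneNbrs G tag u).Nonempty) : (oneProposals G tag u).card = (oneNbrs G tag u).card := by
  classical
  rw [oneProposals, if_pos h, Finset.card_image_of_injective _ (Option.some_injective V)]

open Classical in
theorem mem_proposedOnes {G : SimpleGraph V} {tag : V → Bool} {prop : V → Option V}
    (hprop : prop ∈ Fintype.piFinset (oneProposals G tag)) {u v : V} (h : prop u = some v) :
    v ∈ proposedOnes tag prop := by
  have := Fintype.mem_piFinset.1 hprop u
  simp only [oneProposals, h] at this
  split_ifs at this with h'
  · simp only [Finset.mem_image, Option.some.injEq, exists_eq_right, oneNbrs,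
      Finset.mem_filter] at this
    simp only [proposedOnes, Finset.mem_filter, Finset.mem_univ, true_and]
    exact ⟨this.2.2.2, u, h⟩
  · simp at this

/-- If the nodes of `B` choose uniformly from sets that are at least twice as large as `B`, then
every choice is with probability at least `1/2` different from those of the nodes before, whatever
these are. -/
theorem expect_pow_card_image_le [DecidableEq V] {β : Type} [DecidableEq β] {S : V → Finset β}
    (hS : (Fintype.piFinset S).Nonempty) (s : ℕ) (θ : ℝ≥0∞) (hθ : θ ≤ 1) (B : Finset V)
    (hB : B.card ≤ s) (hSB : ∀ u ∈ B, 2 * s ≤ (S u).card) :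
    ((PMF.uniformOfFinset _ hS).expect fun p => θ ^ (B.image p).card) ≤
      ((1 + θ) / 2) ^ B.card := by
  induction B using Finset.induction_on with
  | empty => simp [PMF.expect_const]
  | insert b B hb ih =>
    rw [Finset.card_insert_of_notMem hb] at hB
    have hSb := hSB b (Finset.mem_insert_self _ _)
    have hpos : 0 < (S b).card := by omega
    -- draw the choice of `b` last
    rw [← PMF.expect_resample hS b (Finset.card_pos.1 hpos), Finset.card_insert_of_notMem hb,
      pow_succ]
    have ih' := ih (by omega) fun u hu => hSB u (Finset.mem_insert_of_mem hu)
    refine le_trans ?_ (mul_le_mul_left ih' _)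
    rw [← PMF.expect_mul_const]
    refine PMF.expect_mono fun p => ?_
    set I := B.image p with hI
    have himg : ∀ x, (insert b B).image (Function.update p b x) = insert x I := by
      intro x
      rw [Finset.image_insert, Function.update_self]
      congr 1
      refine Finset.image_congr fun u hu => ?_
      rw [Function.update_of_ne]
      rintro rfl
      exact hb hu
    have hpow : ∀ x, θ ^ (insert x I).card = θ ^ I.card * if x ∈ I then 1 else θ := by
      intro x
      split_ifs with h
      · rw [Finset.insert_eq_of_mem h, mul_one]
      · rw [Finset.card_insert_of_notMem h, pow_succ]
    simp only [himg, hpow]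
    rw [PMF.expect_const_mul]
    refine mul_le_mul_right ?_ _
    rw [PMF.expect_uniformOfFinset, Finset.sum_ite]
    have hcard := Finset.card_filter_add_card_filter_not (s := S b) (fun x => x ∈ I)
    have hin : ((S b).filter fun x => x ∈ I).card ≤ B.card :=
      (Finset.card_le_card fun x hx => (Finset.mem_filter.1 hx).2).trans Finset.card_image_le
    -- the choice of `b` is new with probability at least `1/2`
    obtain ⟨e, he⟩ : ∃ e, ((S b).filter fun x => x ∉ I).card =
        ((S b).filter fun x => x ∈ I).card + e := Nat.exists_eq_add_of_le (by omega)
    simp only [Finset.sum_const, nsmul_eq_mul, mul_one]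
    rw [← hcard, he]
    set c := ((S b).filter fun x => x ∈ I).card
    have hne : ((c + (c + e) : ℕ) : ℝ≥0∞) ≠ 0 := by
      have : c + (c + e) ≠ 0 := by omega
      exact_mod_cast this
    rw [ENNReal.div_le_iff hne (ENNReal.natCast_ne_top _), ENNReal.div_eq_inv_mul, mul_assoc,
      ← ENNReal.div_eq_inv_mul, ENNReal.le_div_iff_mul_le (by simp) (by simp)]
    push_cast
    have : (e : ℝ≥0∞) * θ ≤ e := by simpa using mul_le_mul_right hθ (e : ℝ≥0∞)
    calc ((c : ℝ≥0∞) + (c + e) * θ) * 2 = (2 * c + 2 * c * θ + e * θ) + e * θ := by ring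
      _ ≤ (2 * c + 2 * c * θ + e * θ) + e := by gcongr
      _ = (1 + θ) * (c + (c + e)) := by ring

theorem exp_neg_le_one_sub_half {x : ℝ} (h0 : 0 ≤ x) (h1 : x ≤ 1) :
    Real.exp (-x) ≤ 1 - x / 2 := by
  rw [Real.exp_neg, inv_le_comm₀ (Real.exp_pos _) (by linarith)]
  refine le_trans ?_ (Real.add_one_le_exp x)
  rw [inv_le_comm₀ (by linarith) (by linarith), ← one_div, div_le_iff₀ (by linarith)]
  nlinarith

/-- The bound of `expect_pow_card_image_le` for `s` nodes and `θ = exp (-1 / (2 * s))`. -/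
theorem exp_half_pow_le {s : ℕ} (hs : 1 ≤ s) :
    ((1 + ENNReal.ofReal (Real.exp (-(1 / (2 * s : ℝ))))) / 2) ^ s ≤
      ENNReal.ofReal (Real.exp (-(1 / 8))) := by
  have hs' : (1 : ℝ) ≤ s := by exact_mod_cast hs
  set x : ℝ := 1 / (2 * s : ℝ) with hx
  have hx0 : 0 < x := by positivity
  have hx1 : x ≤ 1 := by
    rw [hx, div_le_one (by positivity)]; linarith
  have hexp := exp_neg_le_one_sub_half hx0.le hx1
  have h1 : (1 + ENNReal.ofReal (Real.exp (-x))) / 2 =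
      ENNReal.ofReal ((1 + Real.exp (-x)) / 2) := by
    rw [ENNReal.ofReal_div_of_pos two_pos, ENNReal.ofReal_add zero_le_one (Real.exp_pos _).le]
    simp
  rw [h1, ← ENNReal.ofReal_pow (by positivity)]
  refine ENNReal.ofReal_le_ofReal ?_
  calc ((1 + Real.exp (-x)) / 2) ^ s ≤ (Real.exp (-(x / 4))) ^ s := by
        refine pow_le_pow_left₀ (by positivity) ?_ _
        have := Real.add_one_le_exp (-(x / 4))
        linarith
    _ = Real.exp (-(1 / 8)) := by
        rw [← Real.exp_nat_mul]
        congr 1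
        rw [hx]
        field_simp
        norm_num

open Classical in
/-- Many nodes of high degree: few of their proposals coincide. -/
theorem expect_proposedOnes_le_of_high_degree {G : SimpleGraph V} {tag : V → Bool} {s : ℕ}
    (hs : 1 ≤ s) {B : Finset V} (hB : B.card = s)
    (hBd : ∀ u ∈ B, 2 * s ≤ (oneNbrs G tag u).card) :
    ((PMF.uniformOfFinset _ (oneProposals_nonempty G tag)).expect fun prop =>
      ENNReal.ofReal (Real.exp (-(1 / (2 * s : ℝ)))) ^ (proposedOnes tag prop).card) ≤
      ENNReal.ofReal (Real.exp (-(1 / 8))) := by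
  set θ := ENNReal.ofReal (Real.exp (-(1 / (2 * s : ℝ)))) with hθdef
  have hθ : θ ≤ 1 := by
    rw [hθdef, ← ENNReal.ofReal_one]
    refine ENNReal.ofReal_le_ofReal (Real.exp_le_one_iff.2 ?_)
    have : (0 : ℝ) ≤ 1 / (2 * s : ℝ) := by positivity
    linarith
  have hne : ∀ u ∈ B, (oneNbrs G tag u).Nonempty := fun u hu =>
    Finset.card_pos.1 (by have := hBd u hu; omega)
  refine le_trans ?_ ((expect_pow_card_image_le (oneProposals_nonempty G tag) s θ hθ B hB.le
    fun u hu => ?_).trans ?_)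
  · refine PMF.expect_mono_of_mem_support fun prop hprop => ?_
    rw [PMF.mem_support_uniformOfFinset_iff] at hprop
    refine pow_le_pow_right_of_le_one' hθ ?_
    rw [← Finset.card_image_of_injective (proposedOnes tag prop) (Option.some_injective V)]
    refine Finset.card_le_card fun x hx => ?_
    obtain ⟨u, hu, rfl⟩ := Finset.mem_image.1 hx
    have hpu := Fintype.mem_piFinset.1 hprop u
    rw [oneProposals, if_pos (hne u hu)] at hpu
    obtain ⟨v, -, hv⟩ := Finset.mem_image.1 hpu
    rw [← hv]
    exact Finset.mem_image_of_mem _ (mem_proposedOnes hprop hv.symm)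
  · rw [card_oneProposals_of_nonempty (hne u hu)]
    exact hBd u hu
  · rw [hB]
    exact exp_half_pow_le hs

open Classical in
/-- The chance that a zero with at most `d` neighbours among the ones does not propose to one of the
members of `F`, with a proposal to a member of `F` weighted by `t`. -/
theorem average_oneProposals_le {G : SimpleGraph V} {tag : V → Bool} {d : ℕ} (hd : 1 ≤ d) {t : ℝ}
    (ht0 : 0 < t) (ht1 : t ≤ 1 - 1 / d / 2) {u : V} {F : Finset V} (hF : F ⊆ oneNbrs G tag u)
    (hcard : F.Nonempty → (oneNbrs G tag u).card ≤ d) :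
    (∑ x ∈ oneProposals G tag u, ENNReal.ofReal (if x ∈ F.image some then t else 1)) /
      (oneProposals G tag u).card ≤ ENNReal.ofReal (Real.exp (-(1 / d / 2 * (F.card / d)))) := by
  have hd' : (1 : ℝ) ≤ d := by exact_mod_cast hd
  rcases F.eq_empty_or_nonempty with h0 | h0
  · simp [h0, ENNReal.div_self_le_one]
  · have hne : (oneNbrs G tag u).Nonempty := h0.mono hF
    have hpos : (0 : ℝ) < (oneNbrs G tag u).card := by exact_mod_cast hne.card_pos
    rw [card_oneProposals_of_nonempty hne, ← ENNReal.ofReal_sum_of_nonneg fun x _ => by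
      split_ifs <;> linarith, ← ENNReal.ofReal_natCast, ← ENNReal.ofReal_div_of_pos hpos]
    refine ENNReal.ofReal_le_ofReal ?_
    have hsum : (∑ x ∈ oneProposals G tag u, if x ∈ F.image some then t else 1) =
        (oneNbrs G tag u).card - (1 - t) * F.card := by
      rw [oneProposals, if_pos hne,
        Finset.sum_image fun x _ y _ h => Option.some_injective V h]
      have : ∀ x, (if some x ∈ F.image some then t else 1) = 1 - if x ∈ F then (1 - t) else 0 := by
        intro x
        simp only [Finset.mem_image, Option.some.injEq, exists_eq_right]
        split_ifs <;> ring
      simp only [this, Finset.sum_sub_distrib, Finset.sum_const, nsmul_eq_mul, mul_one,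
        ← Finset.sum_filter]
      rw [Finset.filter_mem_eq_inter, Finset.inter_eq_right.2 hF]
      ring
    rw [hsum]
    refine le_trans ?_ (Real.add_one_le_exp _)
    rw [div_le_iff₀ hpos]
    have hcard' : ((oneNbrs G tag u).card : ℝ) ≤ d := by exact_mod_cast hcard h0
    have e1 : F.card / (d : ℝ) * (oneNbrs G tag u).card ≤ F.card := by
      rw [div_mul_eq_mul_div, div_le_iff₀ (by positivity)]
      gcongr
    have e2 : (0 : ℝ) < 1 / d / 2 := by positivity
    have e3 := mul_le_mul_of_nonneg_left e1 e2.le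
    have e4 : 1 / (d : ℝ) / 2 * F.card ≤ (1 - t) * F.card := by
      gcongr
      linarith
    linarith

open Classical in
/-- Many ones with a neighbour of low degree among the zeros: assigning one such neighbour to each
of them, the events that a zero proposes to a one assigned to it are independent. -/
theorem expect_proposedOnes_le_of_low_degree {G : SimpleGraph V} {tag : V → Bool} {d : ℕ}
    (hd : 1 ≤ d) {A : Finset V} (hA : d ^ 2 ≤ A.card)
    (hAd : ∀ r ∈ A, ∃ u, r ∈ oneNbrs G tag u ∧ (oneNbrs G tag u).card ≤ d) :
    ((PMF.uniformOfFinset _ (oneProposals_nonempty G tag)).expect fun prop =>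
      ENNReal.ofReal (Real.exp (-(1 / (d : ℝ)))) ^ (proposedOnes tag prop).card) ≤
      ENNReal.ofReal (Real.exp (-(1 / 8))) := by
  have hd' : (1 : ℝ) ≤ d := by exact_mod_cast hd
  obtain ⟨t, ht⟩ : ∃ t, t = Real.exp (-(1 / (d : ℝ))) := ⟨_, rfl⟩
  have ht0 : 0 < t := ht ▸ Real.exp_pos _
  have hx0 : (0 : ℝ) < 1 / d := by positivity
  have ht1 : t ≤ 1 - (1 / d) / 2 := ht ▸ exp_neg_le_one_sub_half hx0.le
    (by rw [div_le_one (by positivity)]; linarith)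
  rw [← ht]
  have hθ : ENNReal.ofReal t ≤ 1 := by
    rw [← ENNReal.ofReal_one]
    exact ENNReal.ofReal_le_ofReal (by linarith)
  -- `a r` is the zero to which the one `r` is assigned, and `F u` is the set of ones assigned to `u`
  choose! a ha hac using hAd
  obtain ⟨F, hFdef⟩ : ∃ F : V → Finset V, ∀ u r, r ∈ F u ↔ r ∈ A ∧ a r = u :=
    ⟨fun u => A.filter fun r => a r = u, fun u r => Finset.mem_filter⟩
  have hF : ∀ u, F u ⊆ oneNbrs G tag u := by
    intro u r hr
    obtain ⟨h1, h2⟩ := (hFdef u r).1 hr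
    exact h2 ▸ ha r h1
  have hFA : (A.card : ℝ) = ∑ u, ((F u).card : ℝ) := by
    have h1 : A.card = ∑ u, (A.filter fun r => a r = u).card :=
      Finset.card_eq_sum_card_fiberwise fun x _ => Finset.mem_univ (a x)
    rw [h1]
    push_cast
    refine Finset.sum_congr rfl fun u _ => ?_
    congr 2
    ext r
    rw [Finset.mem_filter, hFdef]
  have hstep : ∀ prop ∈ Fintype.piFinset (oneProposals G tag),
      ENNReal.ofReal t ^ (proposedOnes tag prop).card ≤
        ∏ u, ENNReal.ofReal (if prop u ∈ (F u).image some then t else 1) := by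
    intro prop hprop
    have h1 : ∏ u, ENNReal.ofReal (if prop u ∈ (F u).image some then t else 1) =
        ENNReal.ofReal t ^ (Finset.univ.filter fun u => prop u ∈ (F u).image some).card := by
      simp only [apply_ite ENNReal.ofReal, ENNReal.ofReal_one]
      rw [Finset.prod_ite, Finset.prod_const, Finset.prod_const_one, mul_one]
    rw [h1]
    refine pow_le_pow_right_of_le_one' hθ ?_
    rw [← Finset.card_image_of_injective (proposedOnes tag prop) (Option.some_injective V)]
    refine Finset.card_le_card_of_injOn prop ?_ ?_
    · intro u hu
      obtain ⟨v, -, hv⟩ := Finset.mem_image.1 (Finset.mem_filter.1 hu).2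
      rw [← hv]
      exact Finset.mem_image_of_mem _ (mem_proposedOnes hprop hv.symm)
    · intro u hu u' hu' huu'
      obtain ⟨v, hv, hv'⟩ := Finset.mem_image.1 (Finset.mem_filter.1 hu).2
      obtain ⟨w, hw, hw'⟩ := Finset.mem_image.1 (Finset.mem_filter.1 hu').2
      have hvw : v = w := Option.some_injective _ (by rw [hv', hw', huu'])
      rw [← ((hFdef _ _).1 hv).2, ← ((hFdef _ _).1 hw).2, hvw]
  calc _ ≤ (PMF.uniformOfFinset _ (oneProposals_nonempty G tag)).expect fun prop =>
        ∏ u, ENNReal.ofReal (if prop u ∈ (F u).image some then t else 1) :=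
        PMF.expect_mono_of_mem_support fun prop hprop =>
          hstep prop ((PMF.mem_support_uniformOfFinset_iff _ _).1 hprop)
    _ = ∏ u, (∑ x ∈ oneProposals G tag u,
          ENNReal.ofReal (if x ∈ (F u).image some then t else 1)) / (oneProposals G tag u).card :=
        PMF.expect_prod (oneProposals_nonempty G tag)
          fun u x => ENNReal.ofReal (if x ∈ (F u).image some then t else 1)
    _ ≤ ∏ u, ENNReal.ofReal (Real.exp (-(1 / d / 2 * ((F u).card / d)))) := by
        refine Finset.prod_le_prod' fun u _ => average_oneProposals_le hd ht0 ht1 (hF u) ?_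
        rintro ⟨r, hr⟩
        obtain ⟨h1, h2⟩ := (hFdef u r).1 hr
        exact h2 ▸ hac r h1
    _ = ENNReal.ofReal (Real.exp (-(1 / d / 2 * (A.card / d)))) := by
        rw [← ENNReal.ofReal_prod_of_nonneg fun _ _ => (Real.exp_pos _).le, ← Real.exp_sum,
          Finset.sum_neg_distrib, ← Finset.mul_sum, ← Finset.sum_div, ← hFA]
    _ ≤ _ := by
        refine ENNReal.ofReal_le_ofReal (Real.exp_le_exp.2 ?_)
        have hA' : (d : ℝ) ^ 2 ≤ A.card := by exact_mod_cast hA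
        have : 1 / (d : ℝ) / 2 * (A.card / d) = A.card / d ^ 2 / 2 := by field_simp
        rw [this]
        have : 1 ≤ (A.card : ℝ) / d ^ 2 := by rw [le_div_iff₀ (by positivity)]; linarith
        linarith

open Classical in
/-- If there are many zeros and many ones, relative to the expansion, then in one round of random
proposals the number of ones that receive a proposal is typically of order `2 * s`, whatever the
degrees are: either many zeros have more than `2 * s` ones as neighbours, or by expansion many ones
have a zero of degree at most `2 * s` as neighbour. -/
theorem expect_proposedOnes_le (hV : 2 ≤ Fintype.card V) (G : SimpleGraph V) (tag : V → Bool)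
    {s : ℕ} (hs : 1 ≤ s)
    (h0 : 4 * (2 * s : ℝ) ^ 2 < vertexExpansion G * (Finset.univ.filter fun v => tag v = false).card)
    (h1 : 4 * (2 * s : ℝ) ^ 2 < vertexExpansion G * (Finset.univ.filter fun v => tag v = true).card) :
    ((PMF.uniformOfFinset _ (oneProposals_nonempty G tag)).expect fun prop =>
      ENNReal.ofReal (Real.exp (-(1 / (2 * s : ℝ)))) ^ (proposedOnes tag prop).card) ≤
      ENNReal.ofReal (Real.exp (-(1 / 8))) := by
  set I := Finset.univ.filter fun v => tag v = false with hI
  set J := Finset.univ.filter fun v => tag v = true with hJ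
  have hIJ : I.card + J.card = Fintype.card V := by
    have := Finset.card_filter_add_card_filter_not (s := (Finset.univ : Finset V))
      (fun v => tag v = false)
    simpa [hI, hJ] using this
  set B := Finset.univ.filter fun u => 2 * s ≤ (oneNbrs G tag u).card with hB
  set A := Finset.univ.filter fun r => ∃ u, r ∈ oneNbrs G tag u ∧ (oneNbrs G tag u).card < 2 * s
    with hA
  -- `B` consists of the nodes of high degree, and `A` of the ones with a neighbour of low degree
  by_cases hBs : s ≤ B.card
  · obtain ⟨B', hB', hB's⟩ := Finset.exists_subset_card_eq hBs
    exact expect_proposedOnes_le_of_high_degree hs hB's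
      fun u hu => (Finset.mem_filter.1 (hB' hu)).2
  · have hAcard : (2 * s) ^ 2 ≤ A.card := by
      by_contra hlt
      push Not at hBs hlt
      have hα2 := vertexExpansion_le_two hV G
      have hα0 := vertexExpansion_nonneg G
      have hBr : (B.card : ℝ) ≤ s := by exact_mod_cast hBs.le
      have hAr : (A.card : ℝ) ≤ (2 * s) ^ 2 := by exact_mod_cast hlt.le
      have hsr : (1 : ℝ) ≤ s := by exact_mod_cast hs
      have hAB : ∀ u v, tag u = false → tag v = true → G.Adj u v → u ∈ B ∨ v ∈ A := by
        intro u v hu hv huv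
        by_cases h : 2 * s ≤ (oneNbrs G tag u).card
        · exact Or.inl (by simp [hB, h])
        · refine Or.inr ?_
          simp only [hA, Finset.mem_filter, Finset.mem_univ, true_and]
          exact ⟨u, by simp [oneNbrs, huv, hu, hv], by omega⟩
      have hbd : ∀ S : Finset V, vertexBoundary G S ⊆ A ∪ B →
          2 * S.card ≤ Fintype.card V → vertexExpansion G * S.card ≤ (2 * s) ^ 2 + s := by
        intro S hS hS2
        refine (vertexExpansion_mul_card_le G hS2).trans ?_
        have h3 := (Finset.card_le_card hS).trans (Finset.card_union_le A B)
        have h4 : ((vertexBoundary G S).card : ℝ) ≤ A.card + B.card := by exact_mod_cast h3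
        linarith
      -- All edges between `I` and `J` have an end in `A` or `B`, so after removal of these few nodes
      -- the smaller one of `I` and `J` has a boundary that is too small.
      by_cases hI2 : 2 * I.card ≤ Fintype.card V
      · have hS1 : I.card ≤ (I \ B).card + B.card := by
          have := Finset.le_card_sdiff B I
          omega
        have hS2 := hbd (I \ B) (fun v hv => by
          simp only [vertexBoundary, Finset.mem_filter, Finset.mem_univ, true_and,
            Finset.mem_sdiff, hI] at hv
          obtain ⟨hv, u, ⟨hu, huB⟩, hadj⟩ := hv
          cases htv : tag v with
          | false =>
            rw [Finset.mem_union]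
            by_contra h
            exact hv ⟨htv, fun h' => h (Or.inr h')⟩
          | true =>
            exact Finset.mem_union_left _ ((hAB u v hu htv hadj.symm).resolve_left huB))
          (by have := Finset.card_le_card (Finset.sdiff_subset (s := I) (t := B)); omega)
        have hS3 : (I.card : ℝ) ≤ (I \ B).card + B.card := by exact_mod_cast hS1
        nlinarith [mul_le_mul_of_nonneg_left hS3 hα0, mul_le_mul hα2 hBr (by positivity) (by positivity)]
      · have hS1 : J.card ≤ (J \ A).card + A.card := by
          have := Finset.le_card_sdiff A J
          omega
        have hS2 := hbd (J \ A) (fun v hv => by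
          simp only [vertexBoundary, Finset.mem_filter, Finset.mem_univ, true_and,
            Finset.mem_sdiff, hJ] at hv
          obtain ⟨hv, u, ⟨hu, huA⟩, hadj⟩ := hv
          cases htv : tag v with
          | true =>
            rw [Finset.mem_union]
            by_contra h
            exact hv ⟨htv, fun h' => h (Or.inl h')⟩
          | false =>
            exact Finset.mem_union_right _ ((hAB v u htv hu hadj).resolve_right huA))
          (by have := Finset.card_le_card (Finset.sdiff_subset (s := J) (t := A)); omega)
        have hS3 : (J.card : ℝ) ≤ (J \ A).card + A.card := by exact_mod_cast hS1
        nlinarith [mul_le_mul_of_nonneg_left hS3 hα0, mul_le_mul hα2 hAr (by positivity) (by positivity)]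
    have := expect_proposedOnes_le_of_low_degree (G := G) (tag := tag) (d := 2 * s) (by omega) hAcard
      fun r hr => by
        obtain ⟨u, hu, hu'⟩ := (Finset.mem_filter.1 hr).2
        exact ⟨u, hu, hu'.le⟩
    simpa using this

end Proposals

/-! ### Invariants of SimSharedBit -/

section Invariants

variable {P : SSBConstants} {mode : IdMode} {N m : ℕ} [NeZero m] {R : Fin m → SharedString P N}
  {V : Type} [Fintype V] {uid : V → Fin N} {G : SimpleGraph V} {i : ℕ}

open Classical in
/-- Invariants of an execution in which node `v` has identifier `ids v` and, as its seed, its UID,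
where `ℓ` has the smallest identifier.  (Strings are labelled by the UID of the node that selected
them.) -/
structure SSBInvariant (ids : V → ℕ) (uid : V → Fin N) (T₀ : V → Finset (Fin N)) (ℓ : V)
    (σ : V → SSBState N N) : Prop where
  ids_min : ∀ w, ids ℓ ≤ ids w
  candidate : ∀ v, ∃ w, (σ v).leaderId = ids w ∧ (σ v).leader = uid w ∧ (σ v).seed = uid w
  leaderId_min : (σ ℓ).leaderId = ids ℓ
  subset_tokens : ∀ v, T₀ v ⊆ (σ v).tokens
  tokens_subset : ∀ v, (σ v).tokens ⊆ Finset.univ.biUnion T₀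

/-- The initial state in which node `v` has identifier `ids v` and, as its seed, its UID. -/
def ssbInit (ids : V → ℕ) (uid : V → Fin N) (T₀ : V → Finset (Fin N)) (v : V) : SSBState N N where
  tokens := T₀ v
  leaderId := ids v
  leader := uid v
  seed := uid v

theorem ssbInvariant_ssbInit {ids : V → ℕ} (uid : V → Fin N) (T₀ : V → Finset (Fin N)) {ℓ : V}
    (h : ∀ w, ids ℓ ≤ ids w) : SSBInvariant ids uid T₀ ℓ (ssbInit ids uid T₀) where
  ids_min := h
  candidate v := ⟨v, rfl, rfl, rfl⟩
  leaderId_min := rfl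
  subset_tokens _ := subset_rfl
  tokens_subset v := Finset.subset_biUnion_of_mem T₀ (Finset.mem_univ v)

variable {ids : V → ℕ} {T₀ : V → Finset (Fin N)} {ℓ : V}

theorem SSBInvariant.le_leaderId {σ : V → SSBState N N} (h : SSBInvariant ids uid T₀ ℓ σ) (v : V) :
    ids ℓ ≤ (σ v).leaderId := by
  obtain ⟨w, hw, -⟩ := h.candidate v
  exact hw ▸ h.ids_min w

theorem leaderId_le_of_mem_support {σ σ' : V → SSBState N m}
    (h : σ' ∈ (ssbRound P mode R uid G i σ).support) (v : V) :
    (σ' v).leaderId ≤ (σ v).leaderId ∧ (σ v).tokens ⊆ (σ' v).tokens := by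
  obtain ⟨prop, -, acc, -, coin, rfl⟩ := MTMAlgorithm.exists_of_mem_support_round h
  obtain ⟨u, h1, -, h2, -⟩ := ssbUpdate_spec (mode := mode) (R := R) (i := i) σ prop acc coin v
  exact ⟨h2, h1⟩

theorem SSBInvariant.update {R : Fin N → SharedString P N} [NeZero N] {σ : V → SSBState N N}
    (h : SSBInvariant ids uid T₀ ℓ σ) (prop acc : V → Option V) (coin : V → TransferCoin P.ct N) :
    SSBInvariant ids uid T₀ ℓ (ssbUpdate P mode R i σ prop acc coin) := by
  have hc : ∀ v, ∃ w, (ssbUpdate P mode R i σ prop acc coin v).leaderId = ids w ∧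
      (ssbUpdate P mode R i σ prop acc coin v).leader = uid w ∧
      (ssbUpdate P mode R i σ prop acc coin v).seed = uid w := by
    intro v
    obtain ⟨-, -, -, -, x, h1, h2, h3⟩ :=
      ssbUpdate_spec (mode := mode) (R := R) (i := i) σ prop acc coin v
    obtain ⟨w, h1', h2', h3'⟩ := h.candidate x
    exact ⟨w, h1.trans h1', h2.trans h2', h3.trans h3'⟩
  refine ⟨h.ids_min, hc, ?_, ?_, ?_⟩
  · obtain ⟨w, hw, -⟩ := hc ℓ
    obtain ⟨-, -, -, h1, -⟩ := ssbUpdate_spec (mode := mode) (R := R) (i := i) σ prop acc coin ℓ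
    rw [h.leaderId_min] at h1
    exact le_antisymm h1 (hw ▸ h.ids_min w)
  · intro v
    obtain ⟨u, h1, -⟩ := ssbUpdate_spec (mode := mode) (R := R) (i := i) σ prop acc coin v
    exact (h.subset_tokens v).trans h1
  · intro v
    obtain ⟨u, -, h1, -⟩ := ssbUpdate_spec (mode := mode) (R := R) (i := i) σ prop acc coin v
    exact h1.trans (Finset.union_subset (h.tokens_subset v) (h.tokens_subset u))

theorem SSBInvariant.of_mem_support {R : Fin N → SharedString P N} [NeZero N]
    {σ σ' : V → SSBState N N} (h : SSBInvariant ids uid T₀ ℓ σ)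
    (hσ' : σ' ∈ (ssbRound P mode R uid G i σ).support) : SSBInvariant ids uid T₀ ℓ σ' := by
  obtain ⟨prop, -, acc, -, coin, rfl⟩ := MTMAlgorithm.exists_of_mem_support_round hσ'
  exact h.update prop acc coin

end Invariants

/-! ### One bit of the leader election -/

section LeaderElection

variable {P : SSBConstants} {mode : IdMode} {N : ℕ} [NeZero N] {R : Fin N → SharedString P N}
  {V : Type} [Fintype V] {uid : V → Fin N} {G : SimpleGraph V} {i : ℕ}
  {ids : V → ℕ} {T₀ : V → Finset (Fin N)} {ℓ : V} {σ : V → SSBState N N} {k : ℕ}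

open Classical in
/-- The nodes whose candidate's identifier agrees with `b` in all bits from the `k`-th, counted from
the least significant one. -/
noncomputable def agreeing (b k : ℕ) (σ : V → SSBState N N) : Finset V :=
  Finset.univ.filter fun v => (σ v).leaderId / 2 ^ k = b / 2 ^ k

omit [NeZero N] in
theorem mem_agreeing {b : ℕ} {v : V} :
    v ∈ agreeing b k σ ↔ (σ v).leaderId / 2 ^ k = b / 2 ^ k := by
  simp [agreeing]

omit [NeZero N] in
/-- Identifiers of candidates only decrease and never fall below the smallest one, so agreement is
never lost. -/
theorem agreeing_subset {σ' : V → SSBState N N}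
    (h' : SSBInvariant ids uid T₀ ℓ σ') (hle : ∀ v, (σ' v).leaderId ≤ (σ v).leaderId) :
    agreeing (ids ℓ) k σ ⊆ agreeing (ids ℓ) k σ' := by
  intro v hv
  rw [mem_agreeing] at hv ⊢
  exact le_antisymm (hv ▸ Nat.div_le_div_right (hle v)) (Nat.div_le_div_right (h'.le_leaderId v))

/-- Round `i` is a round of BitConvergence in which bit `k` of the identifiers is advertised. -/
def AdvertisesBit (P : SSBConstants) (mode : IdMode) (N i k : ℕ) : Prop :=
  i % 2 = 1 ∧ P.idBits N mode - 1 - i / 2 / (2 * Nat.clog 2 N) % P.idBits N mode = k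

omit [NeZero N] in
theorem ssbTag_of_advertisesBit (hi : AdvertisesBit P mode N i k) (s : SSBState N N) :
    ssbTag P mode R i s = s.leaderId.testBit k := by
  obtain ⟨h1, rfl⟩ := hi
  simp [ssbTag, h1, bitConvergenceBit]

omit [NeZero N] in
/-- When all identifiers agree with the smallest one in the more significant bits, but not in
bit `k`, the nodes that disagree are those that advertise `1`. -/
theorem ssbTag_eq_true_iff (hi : AdvertisesBit P mode N i k)
    (h : SSBInvariant ids uid T₀ ℓ σ) (h1 : agreeing (ids ℓ) (k + 1) σ = Finset.univ)
    (h0 : agreeing (ids ℓ) k σ ≠ Finset.univ) (v : V) :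
    ssbTag P mode R i (σ v) = true ↔ v ∉ agreeing (ids ℓ) k σ := by
  have key : ∀ v, v ∉ agreeing (ids ℓ) k σ →
      (σ v).leaderId.testBit k = true ∧ (ids ℓ).testBit k = false := by
    intro v hv
    rw [mem_agreeing] at hv
    have h2 := mem_agreeing.1 (h1 ▸ Finset.mem_univ v)
    rw [pow_succ, ← Nat.div_div_eq_div_mul, ← Nat.div_div_eq_div_mul] at h2
    have h3 : ids ℓ / 2 ^ k ≤ (σ v).leaderId / 2 ^ k := Nat.div_le_div_right (h.le_leaderId v)
    simp only [Nat.testBit_eq_decide_div_mod_eq, decide_eq_true_eq, decide_eq_false_iff_not]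
    omega
  obtain ⟨w, hw⟩ : ∃ w, w ∉ agreeing (ids ℓ) k σ := by
    by_contra! hall
    exact h0 (Finset.eq_univ_of_forall hall)
  rw [ssbTag_of_advertisesBit hi]
  refine ⟨fun hv hmem => ?_, fun hv => (key v hv).1⟩
  have h2 := (key w hw).2
  rw [mem_agreeing] at hmem
  simp only [Nat.testBit_eq_decide_div_mod_eq, hmem] at hv h2
  simp [h2] at hv

/-- Every node that receives a proposal gets into agreement with the smallest identifier. -/
theorem card_agreeing_update (huid : Function.Injective uid) (hi : AdvertisesBit P mode N i k)
    (h : SSBInvariant ids uid T₀ ℓ σ) (h1 : agreeing (ids ℓ) (k + 1) σ = Finset.univ)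
    (h0 : agreeing (ids ℓ) k σ ≠ Finset.univ) {prop acc : V → Option V}
    (hprop : ∀ u, prop u ∈ ssbProposals P mode R uid G i σ u)
    (hacc : ∀ v, acc v ∈ MTMAlgorithm.acceptances prop v) (coin : V → TransferCoin P.ct N) :
    (agreeing (ids ℓ) k σ).card +
        (proposedOnes (fun v => ssbTag P mode R i (σ v)) prop).card ≤
      (agreeing (ids ℓ) k (ssbUpdate P mode R i σ prop acc coin)).card := by
  classical
  have htag := ssbTag_eq_true_iff (R := R) hi h h1 h0
  have hprop' : ∀ u v, prop u = some v →
      ssbTag P mode R i (σ u) = false ∧ ssbTag P mode R i (σ v) = true := by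
    intro u v huv
    have := hprop u
    rw [ssbProposals_odd huid hi.1] at this
    simp only at this
    split_ifs at this with hne
    · rw [huv] at this
      obtain ⟨w, hw, hwv⟩ := Finset.mem_image.1 this
      obtain rfl := Option.some_injective _ hwv
      exact (Finset.mem_filter.1 hw).2.2
    · simp [huv] at this
  rw [← Finset.card_union_of_disjoint]
  · refine Finset.card_le_card (Finset.union_subset ?_ ?_)
    · refine agreeing_subset (h.update prop acc coin) fun v => ?_
      obtain ⟨-, -, -, h2, -⟩ := ssbUpdate_spec (mode := mode) (R := R) (i := i) σ prop acc coin v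
      exact h2
    · intro r hr
      obtain ⟨hr1, u, hu⟩ := (Finset.mem_filter.1 hr).2
      have hpr : prop r = none := by
        by_contra hne
        obtain ⟨x, hx⟩ := Option.ne_none_iff_exists'.1 hne
        have := (hprop' r x hx).1
        simp [hr1] at this
      obtain ⟨w, hw, hw'⟩ := MTMAlgorithm.exists_acceptance (Fintype.mem_piFinset.2 hacc) hpr hu
      have hup : ssbUpdate P mode R i σ prop acc coin r = (σ r).adopt (σ w) := by
        have h2 := (simSharedBit P mode R).update_of_acc i σ prop coin hw
        refine h2.trans ?_
        simp [simSharedBit, ssbConnect, hi.1]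
      have hwmem : w ∈ agreeing (ids ℓ) k σ := by
        by_contra hwm
        have := (hprop' w r hw').1
        simp [(htag w).2 hwm] at this
      have hrn := (htag r).1 hr1
      rw [mem_agreeing] at hwmem hrn ⊢
      have h3 : ids ℓ / 2 ^ k ≤ (σ r).leaderId / 2 ^ k := Nat.div_le_div_right (h.le_leaderId r)
      have hlt : (σ w).leaderId < (σ r).leaderId := by
        refine lt_of_not_ge fun hge => ?_
        have := Nat.div_le_div_right (c := 2 ^ k) hge
        omega
      rw [hup, SSBState.adopt, if_pos (show (σ w).Less (σ r) from Or.inl hlt)]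
      exact hwmem
  · rw [Finset.disjoint_left]
    intro v hv hv'
    exact (htag v).1 (Finset.mem_filter.1 hv').2.1 hv

/-- The work that remains for one bit of the identifiers when `z` of `n` nodes agree: every further
node counts `1`, but only `1 / d` in the range in which, for a graph with expansion `α`, about `d`
nodes come into agreement in every round. -/
noncomputable def remainingWork (α : ℝ) (d n z : ℕ) : ℝ :=
  ∑ y ∈ Finset.Ico z n,
    if 4 * (d : ℝ) ^ 2 < α * y ∧ 4 * (d : ℝ) ^ 2 < α * (n - y : ℝ) then 1 / (d : ℝ) else 1

theorem remainingWork_nonneg (α : ℝ) (d n z : ℕ) : 0 ≤ remainingWork α d n z :=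
  Finset.sum_nonneg fun y _ => by split_ifs <;> positivity

/-- When `h` further nodes come into agreement, at least `h / d` of the work is done. -/
theorem remainingWork_add_le {α : ℝ} {d n z z' h : ℕ} (hd : 1 ≤ d) (hz : z + h ≤ z')
    (hn : z' ≤ n) : remainingWork α d n z' + h / d ≤ remainingWork α d n z := by
  have hd' : (1 : ℝ) ≤ d := by exact_mod_cast hd
  have h1 : (1 : ℝ) / d ≤ 1 := by rw [div_le_one (by positivity)]; linarith
  unfold remainingWork
  rw [← Finset.sum_Ico_consecutive _ (show z ≤ z' by omega) hn, add_comm]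
  gcongr
  calc (h : ℝ) / d ≤ ∑ y ∈ Finset.Ico z z', (1 : ℝ) / d := by
        rw [Finset.sum_const, Nat.card_Ico, nsmul_eq_mul, mul_one_div]
        gcongr
        omega
    _ ≤ _ := Finset.sum_le_sum fun y _ => by split_ifs <;> linarith

/-- Outside the range of fast progress, one further node is worth `1`. -/
theorem remainingWork_add_one_le {α : ℝ} {d n z z' : ℕ} (hz : z < z') (hn : z' ≤ n)
    (hzs : ¬(4 * (d : ℝ) ^ 2 < α * z ∧ 4 * (d : ℝ) ^ 2 < α * (n - z : ℝ))) :
    remainingWork α d n z' + 1 ≤ remainingWork α d n z := by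
  unfold remainingWork
  rw [← Finset.sum_Ico_consecutive _ hz.le hn, add_comm, Finset.sum_eq_sum_Ico_succ_bot hz,
    if_neg hzs]
  have : 0 ≤ ∑ y ∈ Finset.Ico (z + 1) z',
    if 4 * (d : ℝ) ^ 2 < α * y ∧ 4 * (d : ℝ) ^ 2 < α * (n - y : ℝ) then 1 / (d : ℝ) else 1 :=
    Finset.sum_nonneg fun y _ => by split_ifs <;> positivity
  linarith

/-- The range of fast progress contributes at most `n / d`, and no more than `O(d² / α)` numbers are
outside of it, at either end. -/
theorem remainingWork_le {α : ℝ} (hα : 0 < α) (d n z : ℕ) :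
    remainingWork α d n z ≤ n / d + 2 * (4 * (d : ℝ) ^ 2 / α + 1) := by
  set K := 4 * (d : ℝ) ^ 2 / α with hK
  have hK0 : 0 ≤ K := by positivity
  set f := ⌊K⌋₊
  have hfK : (f : ℝ) ≤ K := Nat.floor_le hK0
  have hsub : remainingWork α d n z ≤ ∑ y ∈ Finset.range n,
      ((1 / (d : ℝ) + if y < f + 1 then 1 else 0) + if n ≤ y + f then 1 else 0) := by
    unfold remainingWork
    refine (Finset.sum_le_sum_of_subset_of_nonneg (t := Finset.range n) (fun y hy => ?_) ?_).trans
      (Finset.sum_le_sum fun y hy => ?_)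
    · rw [Finset.mem_Ico] at hy
      exact Finset.mem_range.2 hy.2
    · intro y _ _
      split_ifs <;> positivity
    · have h0 : (0 : ℝ) ≤ 1 / d := by positivity
      split_ifs with h1 h2 h3 h3 h2 h3 h3 <;> try linarith
      exfalso
      refine h1 ⟨?_, ?_⟩
      · have : K < y := (Nat.floor_lt hK0).1 (by omega)
        rw [hK, div_lt_iff₀ hα] at this
        linarith
      · have h5 : f < n - y := by omega
        have h6 : y ≤ n := by omega
        have : K < ((n - y : ℕ) : ℝ) := (Nat.floor_lt hK0).1 h5
        rw [Nat.cast_sub h6, hK, div_lt_iff₀ hα] at this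
        linarith
  refine hsub.trans ?_
  rw [Finset.sum_add_distrib, Finset.sum_add_distrib, Finset.sum_const, Finset.card_range,
    ← Finset.sum_filter, ← Finset.sum_filter, Finset.sum_const, Finset.sum_const]
  have h1 : ((Finset.range n).filter fun y => y < f + 1).card ≤ f + 1 := by
    refine (Finset.card_le_card (t := Finset.range (f + 1)) fun y hy => ?_).trans_eq
      (Finset.card_range _)
    exact Finset.mem_range.2 (Finset.mem_filter.1 hy).2
  have h2 : ((Finset.range n).filter fun y => n ≤ y + f).card ≤ f := by
    refine (Finset.card_le_card (t := Finset.Ico (n - f) n) fun y hy => ?_).trans ?_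
    · obtain ⟨h1, h2⟩ := Finset.mem_filter.1 hy
      rw [Finset.mem_range] at h1
      rw [Finset.mem_Ico]
      omega
    · rw [Nat.card_Ico]
      omega
  have h1' : (((Finset.range n).filter fun y => y < f + 1).card : ℝ) ≤ f + 1 := by exact_mod_cast h1
  have h2' : (((Finset.range n).filter fun y => n ≤ y + f).card : ℝ) ≤ f := by exact_mod_cast h2
  simp only [nsmul_eq_mul, mul_one, mul_one_div]
  linarith

open Classical in
/-- In a round in which the bit that is to be settled is advertised, the exponential of the remaining
work decreases in expectation by a constant factor. -/
theorem expect_exp_remainingWork_le (hV : 2 ≤ Fintype.card V) (huid : Function.Injective uid)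
    (hG : G.Connected) {α : ℝ} (hα : α ≤ vertexExpansion G) {s : ℕ} (hs : 1 ≤ s)
    (hi : AdvertisesBit P mode N i k)
    (h : SSBInvariant ids uid T₀ ℓ σ) (h1 : agreeing (ids ℓ) (k + 1) σ = Finset.univ)
    (h0 : agreeing (ids ℓ) k σ ≠ Finset.univ) :
    ((ssbRound P mode R uid G i σ).expect fun σ' => ENNReal.ofReal (Real.exp
      (remainingWork α (2 * s) (Fintype.card V) (agreeing (ids ℓ) k σ').card))) ≤
    ENNReal.ofReal (Real.exp (-(1 / 8) +
      remainingWork α (2 * s) (Fintype.card V) (agreeing (ids ℓ) k σ).card)) := by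
  set z := (agreeing (ids ℓ) k σ).card with hz
  set n := Fintype.card V with hn
  set tag := fun v => ssbTag P mode R i (σ v) with htagdef
  have htag := ssbTag_eq_true_iff (R := R) hi h h1 h0
  have hprops : ssbProposals P mode R uid G i σ = oneProposals G tag :=
    funext fun u => ssbProposals_odd huid hi.1 σ u
  have hcard := fun prop hprop acc hacc coin => card_agreeing_update (G := G) (R := R) huid hi h h1 h0
    (prop := prop) (acc := acc) hprop hacc coin
  have hle : ∀ σ' : V → SSBState N N, (agreeing (ids ℓ) k σ').card ≤ n :=
    fun σ' => Finset.card_le_univ _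
  by_cases hbig : 4 * ((2 * s : ℕ) : ℝ) ^ 2 < α * z ∧ 4 * ((2 * s : ℕ) : ℝ) ^ 2 < α * (n - z : ℝ)
  · rw [expect_ssbRound]
    have hfalse : (Finset.univ.filter fun v => tag v = false) = agreeing (ids ℓ) k σ := by
      ext v
      have := htag v
      simp only [Finset.mem_filter, Finset.mem_univ, true_and, tag]
      cases hv : ssbTag P mode R i (σ v) <;> simp [hv] at this ⊢ <;> exact this
    have htrue : (Finset.univ.filter fun v => tag v = true) = (agreeing (ids ℓ) k σ)ᶜ := by
      ext v
      simp only [Finset.mem_filter, Finset.mem_univ, true_and, tag, htag v, Finset.mem_compl]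
    have hB := expect_proposedOnes_le hV G tag hs (by
        rw [hfalse]
        have := hbig.1
        push_cast at this
        exact this.trans_le (mul_le_mul_of_nonneg_right hα (by positivity))) (by
        rw [htrue, Finset.card_compl, Nat.cast_sub (hle σ)]
        have := hbig.2
        push_cast at this
        refine this.trans_le (mul_le_mul_of_nonneg_right hα ?_)
        have : (z : ℝ) ≤ n := by exact_mod_cast hle σ
        linarith)
    rw [Real.exp_add, ENNReal.ofReal_mul (Real.exp_pos _).le]
    refine le_trans ?_ (mul_le_mul_left hB _)
    rw [← PMF.expect_mul_const]
    simp only [hprops]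
    refine PMF.expect_mono_of_mem_support fun prop hprop => PMF.expect_le_of_le fun acc hacc =>
      PMF.expect_le_of_le fun coin _ => ?_
    rw [PMF.mem_support_uniformOfFinset_iff] at hprop hacc
    have hc := hcard prop (fun u => hprops ▸ Fintype.mem_piFinset.1 hprop u) acc
      (fun v => Fintype.mem_piFinset.1 hacc v) coin
    have hw := remainingWork_add_le (α := α) (d := 2 * s) (by omega) hc (hle _)
    rw [← ENNReal.ofReal_pow (Real.exp_pos _).le, ← ENNReal.ofReal_mul (by positivity),
      ← Real.exp_nat_mul, ← Real.exp_add]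
    refine ENNReal.ofReal_le_ofReal (Real.exp_le_exp.2 ?_)
    push_cast at hw
    rw [mul_neg, mul_one_div]
    linarith
  · refine PMF.expect_le_of_le fun σ' hσ' => ?_
    obtain ⟨prop, hprop, acc, hacc, coin, rfl⟩ := MTMAlgorithm.exists_of_mem_support_round hσ'
    have hprop' := fun u => Fintype.mem_piFinset.1 hprop u
    have hc := hcard prop hprop' acc (fun v => Fintype.mem_piFinset.1 hacc v) coin
    have hpos : 0 < (proposedOnes tag prop).card := by
      obtain ⟨b, hb⟩ : ∃ b, b ∉ agreeing (ids ℓ) k σ := by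
        by_contra! hall
        exact h0 (Finset.eq_univ_of_forall hall)
      obtain ⟨u, hu, v, hv, huv⟩ := exists_adj_of_connected hG
        (S := (agreeing (ids ℓ) k σ : Set V)) (a := ℓ) (b := b)
        (Finset.mem_coe.2 (mem_agreeing.2 (by rw [h.leaderId_min]))) (by simpa using hb)
      have hne : (oneNbrs G tag u).Nonempty := ⟨v, by
        simp only [oneNbrs, Finset.mem_filter, Finset.mem_univ, true_and]
        refine ⟨huv, ?_, (htag v).2 (by simpa using hv)⟩
        by_contra hut
        exact (htag u).1 (by simpa using hut) hu⟩
      have h2 : prop u ∈ oneProposals G tag u := hprops ▸ hprop' u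
      rw [oneProposals, if_pos hne] at h2
      obtain ⟨w, -, hw⟩ := Finset.mem_image.1 h2
      exact Finset.card_pos.2 ⟨w, mem_proposedOnes (G := G) (Fintype.mem_piFinset.2 fun u => hprops ▸ hprop' u) hw.symm⟩
    refine ENNReal.ofReal_le_ofReal (Real.exp_le_exp.2 ?_)
    have hw := remainingWork_add_one_le (α := α) (d := 2 * s) (n := n) (z := z)
      (z' := (agreeing (ids ℓ) k (ssbUpdate P mode R i σ prop acc coin)).card)
      (lt_of_lt_of_le (Nat.lt_add_of_pos_right hpos) hc) (hle _) hbig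
    have : remainingWork α (2 * s) n (agreeing (ids ℓ) k (ssbUpdate P mode R i σ prop acc coin)).card
      ≤ -(1 / 8) + remainingWork α (2 * s) n z := by linarith
    exact this

end LeaderElection

/-! ### The time until a leader is elected -/

section LeaderElectionTime

variable {P : SSBConstants} {mode : IdMode} {N : ℕ} [NeZero N] {R : Fin N → SharedString P N}
  {V : Type} [Fintype V] {uid : V → Fin N}
  {ids : V → ℕ} {T₀ : V → Finset (Fin N)} {ℓ : V} {k : ℕ}

open Classical in
/-- An upper bound on the probability that bit `k` is not settled after `r` more rounds in which it
is advertised.  It is `1` unless the more significant bits are settled; due to the minimum with `1`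
it can be used whether or not they are settled at the beginning. -/
noncomputable def bitPotential (b k : ℕ) (α : ℝ) (d r : ℕ) (σ : V → SSBState N N) : ℝ≥0∞ :=
  if agreeing b (k + 1) σ = Finset.univ then
    if agreeing b k σ = Finset.univ then 0
    else min 1 (ENNReal.ofReal (Real.exp
      (remainingWork α d (Fintype.card V) (agreeing b k σ).card - r / 8)))
  else 1

omit [NeZero N] in
theorem bitPotential_le_one (b k : ℕ) (α : ℝ) (d r : ℕ) (σ : V → SSBState N N) :
    bitPotential b k α d r σ ≤ 1 := by
  unfold bitPotential
  split_ifs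
  · exact zero_le_one
  · exact min_le_left _ _
  · exact le_rfl

open Classical in
/-- The potential of a bit does not increase in expectation in any round. -/
theorem expect_bitPotential_le (hV : 2 ≤ Fintype.card V) (huid : Function.Injective uid)
    {G : SimpleGraph V} (hG : G.Connected) {α : ℝ} (hα : α ≤ vertexExpansion G) {s : ℕ}
    (hs : 1 ≤ s) (i r : ℕ) {σ : V → SSBState N N} (h : SSBInvariant ids uid T₀ ℓ σ) :
    (ssbRound P mode R uid G i σ).expect (bitPotential (ids ℓ) k α (2 * s) r) ≤
      bitPotential (ids ℓ) k α (2 * s) (r + if AdvertisesBit P mode N i k then 1 else 0) σ := by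
  have hmono : ∀ k, ∀ σ' ∈ (ssbRound P mode R uid G i σ).support,
      agreeing (ids ℓ) k σ ⊆ agreeing (ids ℓ) k σ' := fun k σ' hσ' =>
    agreeing_subset (h.of_mem_support hσ') fun v => (leaderId_le_of_mem_support hσ' v).1
  have huniv : ∀ k, agreeing (ids ℓ) k σ = Finset.univ →
      ∀ σ' ∈ (ssbRound P mode R uid G i σ).support, agreeing (ids ℓ) k σ' = Finset.univ :=
    fun k hk σ' hσ' => Finset.univ_subset_iff.1 (hk ▸ hmono k σ' hσ')
  by_cases h1 : agreeing (ids ℓ) (k + 1) σ = Finset.univ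
  · by_cases h0 : agreeing (ids ℓ) k σ = Finset.univ
    · refine PMF.expect_le_of_le fun σ' hσ' => ?_
      rw [bitPotential, if_pos (huniv _ h1 σ' hσ'), if_pos (huniv _ h0 σ' hσ')]
      exact zero_le
    · rw [bitPotential, if_pos h1, if_neg h0]
      refine le_min (PMF.expect_le_of_le fun _ _ => bitPotential_le_one _ _ _ _ _ _) ?_
      have hle : ∀ σ' ∈ (ssbRound P mode R uid G i σ).support,
          bitPotential (ids ℓ) k α (2 * s) r σ' ≤
          ENNReal.ofReal (Real.exp (remainingWork α (2 * s) (Fintype.card V)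
            (agreeing (ids ℓ) k σ').card)) * ENNReal.ofReal (Real.exp (-(r / 8))) := by
        intro σ' hσ'
        rw [bitPotential, if_pos (huniv _ h1 σ' hσ')]
        split_ifs
        · exact zero_le
        · refine (min_le_right _ _).trans_eq ?_
          rw [sub_eq_add_neg, Real.exp_add, ENNReal.ofReal_mul (Real.exp_pos _).le]
      by_cases hi : AdvertisesBit P mode N i k
      · refine (PMF.expect_mono_of_mem_support hle).trans ?_
        rw [PMF.expect_mul_const]
        refine (mul_le_mul_left (expect_exp_remainingWork_le hV huid hG hα hs hi h h1 h0) _).trans ?_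
        rw [← ENNReal.ofReal_mul (Real.exp_pos _).le, ← Real.exp_add, if_pos hi]
        refine ENNReal.ofReal_le_ofReal (Real.exp_le_exp.2 ?_)
        push_cast
        linarith
      · refine PMF.expect_le_of_le fun σ' hσ' => (hle σ' hσ').trans ?_
        rw [← ENNReal.ofReal_mul (Real.exp_pos _).le, ← Real.exp_add, if_neg hi]
        refine ENNReal.ofReal_le_ofReal (Real.exp_le_exp.2 ?_)
        have := remainingWork_add_le (α := α) (d := 2 * s) (n := Fintype.card V) (h := 0) (by omega)
          (z := (agreeing (ids ℓ) k σ).card) (Finset.card_le_card (hmono k σ' hσ'))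
          (Finset.card_le_univ _)
        simp only [Nat.cast_zero, zero_div, add_zero] at this ⊢
        linarith
  · rw [bitPotential, if_neg h1]
    exact PMF.expect_le_of_le fun _ _ => bitPotential_le_one _ _ _ _ _ _

open Classical in
/-- The probability that bit `k` is not settled at time `t`, in terms of the probability that the
more significant bits are not settled at time `s` and of the number of rounds in between in which
bit `k` is advertised. -/
theorem expect_not_agreeing_le (hV : 2 ≤ Fintype.card V) (huid : Function.Injective uid)
    {G : ℕ → SimpleGraph V} (hG : ∀ i, (G i).Connected) {q : ℕ} (hq : 1 ≤ q)
    (hα : 0 < dynExpansion G) (hℓ : ∀ w, ids ℓ ≤ ids w) {s t u : ℕ} (hst : s ≤ t)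
    (hu : u ≤ ((Finset.Ico s t).filter fun i => AdvertisesBit P mode N i k).card) :
    ((ssbLaw P mode R uid G (ssbInit ids uid T₀) t).expect fun σ =>
        if agreeing (ids ℓ) k σ = Finset.univ then 0 else 1) ≤
      ((ssbLaw P mode R uid G (ssbInit ids uid T₀) s).expect fun σ =>
        if agreeing (ids ℓ) (k + 1) σ = Finset.univ then 0 else 1) +
      ENNReal.ofReal (Real.exp (Fintype.card V / (2 * q : ℝ) +
        2 * (4 * (2 * q : ℝ) ^ 2 / dynExpansion G + 1) - u / 8)) := by
  let r : ℕ → ℕ := fun i => ((Finset.Ico i t).filter fun j => AdvertisesBit P mode N j k).card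
  have hr : ∀ i, i < t → r i = r (i + 1) + if AdvertisesBit P mode N i k then 1 else 0 := by
    intro i hi
    simp only [r]
    rw [← Finset.insert_Ico_add_one_left_eq_Ico hi, Finset.filter_insert]
    split_ifs
    · rw [Finset.card_insert_of_notMem (by simp)]
    · rfl
  have hpot := MTMAlgorithm.expect_lawFrom_le (A := simSharedBit P mode R) (uid := uid) (G := G)
    (σ₀ := ssbInit ids uid T₀)
    (SSBInvariant ids uid T₀ ℓ) (ssbInvariant_ssbInit uid T₀ hℓ)
    (fun i σ σ' h h' => h.of_mem_support h')
    (fun i => bitPotential (ids ℓ) k (dynExpansion G) (2 * q) (r i)) hst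
    (fun i _ hit σ hσ => by
      have := expect_bitPotential_le (P := P) (mode := mode) (R := R) (k := k) hV huid (hG i)
        (dynExpansion_le G i) hq i (r (i + 1)) hσ
      rwa [← hr i hit] at this)
  refine le_trans ?_ (hpot.trans ?_)
  · refine PMF.expect_mono fun σ => ?_
    split_ifs with h
    · exact zero_le
    · simp only [bitPotential, if_neg h]
      split_ifs
      · refine le_min le_rfl ?_
        rw [← ENNReal.ofReal_one]
        refine ENNReal.ofReal_le_ofReal (Real.one_le_exp ?_)
        simp only [r, Finset.Ico_self, Finset.filter_empty, Finset.card_empty]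
        simpa using remainingWork_nonneg _ _ _ _
      · exact le_rfl
  · refine (PMF.expect_mono (g := fun σ =>
      (if agreeing (ids ℓ) (k + 1) σ = Finset.univ then 0 else 1) +
        ENNReal.ofReal (Real.exp (Fintype.card V / (2 * q : ℝ) +
          2 * (4 * (2 * q : ℝ) ^ 2 / dynExpansion G + 1) - u / 8))) fun σ => ?_).trans_eq ?_
    · simp only [bitPotential]
      split_ifs
      · exact zero_le
      · rw [zero_add]
        refine (min_le_right _ _).trans (ENNReal.ofReal_le_ofReal (Real.exp_le_exp.2 ?_))
        have h1 := remainingWork_le hα (2 * q) (Fintype.card V) (agreeing (ids ℓ) k σ).card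
        have h2 : (u : ℝ) ≤ r s := by exact_mod_cast hu
        push_cast at h1
        linarith
      · exact le_self_add
    · exact (PMF.expect_add _ _ _).trans (congrArg (_ + ·) (PMF.expect_const _ _))

open Classical in
/-- Bit `len - 1 - a` of `len` is advertised in `2⌈log N⌉` rounds of every phase, hence in
`M * 2⌈log N⌉` rounds of the `a`-th block of `M` phases. -/
theorem card_advertisesBit_ge (P : SSBConstants) (mode : IdMode) {N : ℕ} (M : ℕ) {a : ℕ}
    (ha : a < P.idBits N mode) :
    M * (2 * Nat.clog 2 N) ≤ ((Finset.Ico (2 * (a * (M * (P.idBits N mode * (2 * Nat.clog 2 N)))))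
      (2 * ((a + 1) * (M * (P.idBits N mode * (2 * Nat.clog 2 N)))))).filter fun i =>
        AdvertisesBit P mode N i (P.idBits N mode - 1 - a)).card := by
  classical
  set len := P.idBits N mode with hlen
  set c := 2 * Nat.clog 2 N with hc
  rcases Nat.eq_zero_or_pos c with h0 | h0
  · simp [h0]
  have hMc : M * c = (Finset.range M ×ˢ Finset.range c).card := by simp
  rw [hMc]
  refine (Finset.card_le_card_of_injOn (s := Finset.range M ×ˢ Finset.range c)
    (fun y => 2 * (((a * M + y.1) * len + a) * c + y.2) + 1) ?_ ?_)
  -- `p` is the number of the phase, among the phases for this bit, and `x` that of the round in the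
  -- group
  · rintro ⟨p, x⟩ hpx
    simp only [Finset.coe_product, Finset.coe_range, Set.mem_prod, Set.mem_Iio] at hpx
    obtain ⟨hp, hx⟩ := hpx
    simp only [Finset.coe_filter, Finset.mem_Ico, Set.mem_ofPred_eq]
    have h1 : ((a * M + p) * len + a) * c + x < ((a * M + p) * len + a + 1) * c := by
      rw [add_one_mul]; omega
    have h2 : ((a * M + p) * len + a + 1) * c ≤ (a * M + p + 1) * len * c := by
      refine Nat.mul_le_mul_right _ ?_
      rw [add_one_mul]; omega
    have h3 : (a * M + p + 1) * len * c ≤ ((a + 1) * M) * len * c := by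
      refine Nat.mul_le_mul_right _ (Nat.mul_le_mul_right _ ?_)
      rw [add_one_mul]; omega
    have h4 : (a * M) * len * c ≤ ((a * M + p) * len + a) * c := by
      refine Nat.mul_le_mul_right _ ?_
      rw [add_mul]; omega
    have h5 : a * (M * (len * c)) = a * M * len * c := by ring
    have h6 : (a + 1) * (M * (len * c)) = ((a + 1) * M) * len * c := by ring
    refine ⟨⟨by omega, by omega⟩, by omega, ?_⟩
    have h7 : (2 * (((a * M + p) * len + a) * c + x) + 1) / 2 =
        ((a * M + p) * len + a) * c + x := by omega
    rw [h7, Nat.add_comm _ x, Nat.add_mul_div_right _ _ h0, Nat.div_eq_of_lt hx, zero_add,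
      Nat.add_comm, Nat.add_mul_mod_self_right, Nat.mod_eq_of_lt ha]
  · rintro ⟨p, x⟩ hpx ⟨p', x'⟩ hpx' heq
    simp only [Finset.coe_product, Finset.coe_range, Set.mem_prod, Set.mem_Iio] at hpx hpx'
    simp only at heq
    have h1 : ((a * M + p) * len + a) * c + x = ((a * M + p') * len + a) * c + x' := by omega
    have hx : x = x' := by
      have := congrArg (· % c) h1
      simpa [Nat.mul_add_mod', Nat.mod_eq_of_lt hpx.2, Nat.mod_eq_of_lt hpx'.2] using this
    subst hx
    have h2 : (a * M + p) * len + a = (a * M + p') * len + a :=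
      Nat.eq_of_mul_eq_mul_right h0 (by omega)
    have h3 : a * M + p = a * M + p' := Nat.eq_of_mul_eq_mul_right (by omega : 0 < len) (by omega)
    ext <;> simp; omega

open Classical in
/-- If `M` phases are devoted to each bit of the identifiers, all nodes finally have the candidate
with the smallest identifier, unless one of the bits was not settled in its phases. -/
theorem expect_no_leader_le (hV : 2 ≤ Fintype.card V) (huid : Function.Injective uid)
    {G : ℕ → SimpleGraph V} (hG : ∀ i, (G i).Connected) {q : ℕ} (hq : 1 ≤ q)
    (hα : 0 < dynExpansion G) (hℓ : ∀ w, ids ℓ ≤ ids w)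
    (hids : ∀ w, ids w < 2 ^ P.idBits N mode) (M : ℕ) :
    ((ssbLaw P mode R uid G (ssbInit ids uid T₀)
        (2 * (P.idBits N mode * (M * (P.idBits N mode * (2 * Nat.clog 2 N)))))).expect fun σ =>
        if agreeing (ids ℓ) 0 σ = Finset.univ then 0 else 1) ≤
      P.idBits N mode * ENNReal.ofReal (Real.exp (Fintype.card V / (2 * q : ℝ) +
        2 * (4 * (2 * q : ℝ) ^ 2 / dynExpansion G + 1) - (M * (2 * Nat.clog 2 N) : ℕ) / 8)) := by
  set len := P.idBits N mode with hlen
  set ε := ENNReal.ofReal (Real.exp (Fintype.card V / (2 * q : ℝ) +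
        2 * (4 * (2 * q : ℝ) ^ 2 / dynExpansion G + 1) - (M * (2 * Nat.clog 2 N) : ℕ) / 8))
  have key : ∀ a ≤ len, ((ssbLaw P mode R uid G (ssbInit ids uid T₀)
      (2 * (a * (M * (len * (2 * Nat.clog 2 N)))))).expect fun σ =>
        if agreeing (ids ℓ) (len - a) σ = Finset.univ then 0 else 1) ≤ a * ε := by
    intro a
    induction a with
    | zero =>
      intro _
      simp only [zero_mul, mul_zero, Nat.cast_zero]
      have : ssbLaw P mode R uid G (ssbInit ids uid T₀) 0 = PMF.pure (ssbInit ids uid T₀) := rfl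
      rw [this, PMF.expect_pure, if_pos]
      refine Finset.eq_univ_of_forall fun v => ?_
      rw [mem_agreeing, Nat.sub_zero, Nat.div_eq_of_lt (hids ℓ)]
      exact Nat.div_eq_of_lt (hids v)
    | succ a ih =>
      intro ha
      have h1 := expect_not_agreeing_le (P := P) (mode := mode) (R := R) (T₀ := T₀)
        hV huid hG hq hα hℓ
        (s := 2 * (a * (M * (len * (2 * Nat.clog 2 N)))))
        (t := 2 * ((a + 1) * (M * (len * (2 * Nat.clog 2 N)))))
        (by gcongr; omega) (card_advertisesBit_ge P mode M ha)
      rw [show len - 1 - a + 1 = len - a by omega] at h1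
      rw [show len - (a + 1) = len - 1 - a by omega]
      refine h1.trans ?_
      rw [Nat.cast_succ, add_mul, one_mul]
      exact add_le_add (ih (by omega)) le_rfl
  simpa using key len le_rfl

end LeaderElectionTime

/-! ### Token transfer -/

theorem PMF.expect_comm {α β : Type*} (p : PMF α) (q : PMF β) (f : α → β → ℝ≥0∞) :
    (p.expect fun a => q.expect (f a)) = q.expect fun b => p.expect fun a => f a b := by
  simp only [PMF.expect, ← ENNReal.tsum_mul_left]
  rw [ENNReal.tsum_comm]
  refine tsum_congr fun b => tsum_congr fun a => ?_
  rw [← mul_assoc, ← mul_assoc, mul_comm (p a)]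

theorem PMF.expect_uniformOfFintype_cons {α : Type*} [Fintype α] [Nonempty α] {k : ℕ}
    (f : (Fin (k + 1) → α) → ℝ≥0∞) :
    (PMF.uniformOfFintype (Fin (k + 1) → α)).expect f =
      (PMF.uniformOfFintype α).expect fun x => (PMF.uniformOfFintype (Fin k → α)).expect fun xs =>
        f (Fin.cons x xs) := by
  simp only [PMF.expect_uniformOfFintype, ENNReal.div_eq_inv_mul, ← Finset.mul_sum]
  rw [← mul_assoc, ← Fintype.sum_prod_type', ← (Fin.consEquiv fun _ => α).sum_comp f]
  congr 1
  rw [← ENNReal.mul_inv (by simp) (by simp)]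
  congr 1
  simp [pow_succ']

section Transfer

variable {N q : ℕ}

theorem eqPrime_spec (N : ℕ) : 2 * N ≤ eqPrime N ∧ (eqPrime N).Prime :=
  Nat.find_spec (Nat.exists_infinite_primes (2 * N))

theorem fingerprint_congr {T₁ T₂ : Finset (Fin N)} {a m : ℕ}
    (h : ∀ t : Fin N, a ≤ t.val → t.val ≤ m → (t ∈ T₁ ↔ t ∈ T₂)) (x : ZMod (eqPrime N)) :
    fingerprint T₁ a m x = fingerprint T₂ a m x := by
  unfold fingerprint
  congr 1
  ext t
  simp only [Finset.mem_filter]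
  constructor
  · rintro ⟨h1, h2, h3⟩; exact ⟨(h t h2 h3).1 h1, h2, h3⟩
  · rintro ⟨h1, h2, h3⟩; exact ⟨(h t h2 h3).2 h1, h2, h3⟩

open Polynomial in
open Classical in
/-- Different sets have the same fingerprint at no more than half of the points, since their
polynomials are different and of degree less than `N`. -/
theorem two_mul_card_fingerprint_eq_le {T₁ T₂ : Finset (Fin N)} {a m : ℕ} {t : Fin N}
    (ha : a ≤ t.val) (hm : t.val ≤ m) (ht : ¬(t ∈ T₁ ↔ t ∈ T₂)) :
    2 * (Finset.univ.filter fun x : ZMod (eqPrime N) =>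
      fingerprint T₁ a m x = fingerprint T₂ a m x).card ≤ eqPrime N := by
  have : Fact (eqPrime N).Prime := ⟨(eqPrime_spec N).2⟩
  let F : Finset (Fin N) → (ZMod (eqPrime N))[X] := fun T =>
    ∑ t ∈ T.filter (fun t => a ≤ t.val ∧ t.val ≤ m), X ^ t.val
  have hF : ∀ T x, (F T).eval x = fingerprint T a m x := fun T x => by
    simp [F, fingerprint, eval_finsetSum]
  have hdeg : ∀ T, (F T).natDegree ≤ N - 1 := fun T =>
    natDegree_sum_le_of_forall_le _ _ fun s _ => by
      rw [natDegree_X_pow]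
      have := s.2
      omega
  have hcoeff : ∀ T, (F T).coeff t.val = if t ∈ T then 1 else 0 := fun T => by
    simp only [F, finsetSum_coeff, coeff_X_pow, ← Fin.ext_iff, Finset.sum_ite_eq,
      Finset.mem_filter, ha, hm, and_true]
  have hne : F T₁ - F T₂ ≠ 0 := by
    intro h0
    have h1 := congrArg (fun p => p.coeff t.val) h0
    simp only [coeff_sub, hcoeff, coeff_zero] at h1
    by_cases h2 : t ∈ T₁ <;> by_cases h3 : t ∈ T₂ <;> simp [h2, h3] at h1 ht
  have hcard : (Finset.univ.filter fun x : ZMod (eqPrime N) =>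
      fingerprint T₁ a m x = fingerprint T₂ a m x).card ≤ N - 1 := by
    refine le_trans (Finset.card_le_card (t := (F T₁ - F T₂).roots.toFinset) fun x hx => ?_) ?_
    · rw [Multiset.mem_toFinset, mem_roots hne, IsRoot, eval_sub, hF, hF, sub_eq_zero]
      exact (Finset.mem_filter.1 hx).2
    · exact (Multiset.toFinset_card_le _).trans ((card_roots' _).trans
        ((natDegree_sub_le _ _).trans (max_le (hdeg _) (hdeg _))))
  have := (eqPrime_spec N).1
  omega

open Classical in
/-- The error probability of the equality test. -/
theorem expect_EQTest_le {T₁ T₂ : Finset (Fin N)} {a m : ℕ} {t : Fin N}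
    (ha : a ≤ t.val) (hm : t.val ≤ m) (ht : ¬(t ∈ T₁ ↔ t ∈ T₂)) :
    ((PMF.uniformOfFintype (Fin q → ZMod (eqPrime N))).expect fun x =>
      if EQTest T₁ T₂ a m x then 1 else 0) ≤ (2 ^ q)⁻¹ := by
  set Z := Finset.univ.filter fun x : ZMod (eqPrime N) =>
      fingerprint T₁ a m x = fingerprint T₂ a m x with hZ
  have h2 : 2 * Z.card ≤ eqPrime N := two_mul_card_fingerprint_eq_le ha hm ht
  have h3 : (Finset.univ.filter fun x : Fin q → ZMod (eqPrime N) => EQTest T₁ T₂ a m x) =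
      Fintype.piFinset fun _ => Z := by
    ext x
    simp only [hZ, Finset.mem_filter, Finset.mem_univ, true_and, Fintype.mem_piFinset]
    rfl
  rw [PMF.expect_uniformOfFintype, Finset.sum_boole, h3, Fintype.card_piFinset_const]
  have h4 : (2 : ℝ≥0∞) ^ q * (Z.card ^ q : ℕ) ≤ (Fintype.card (Fin q → ZMod (eqPrime N)) : ℝ≥0∞) := by
    have : 2 ^ q * Z.card ^ q ≤ eqPrime N ^ q := by
      rw [← mul_pow]
      exact Nat.pow_le_pow_left h2 q
    have hc : Fintype.card (Fin q → ZMod (eqPrime N)) = eqPrime N ^ q := by simp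
    rw [hc]
    exact_mod_cast this
  refine ENNReal.div_le_of_le_mul ?_
  rw [← ENNReal.div_eq_inv_mul, ENNReal.le_div_iff_mul_le (by simp) (by simp), mul_comm]
  exact h4

open Classical in
/-- The binary search finds a token known to exactly one party, unless an equality test errs. -/
theorem expect_transferSearch_le {T₁ T₂ : Finset (Fin N)} (k : ℕ) {a b : ℕ} {t : Fin N}
    (ha : a ≤ t.val) (hb : t.val ≤ b) (ht : ¬(t ∈ T₁ ↔ t ∈ T₂)) (hab : b < a + 2 ^ k) :
    ((PMF.uniformOfFintype (Fin k → Fin q → ZMod (eqPrime N))).expect fun x =>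
      if ∃ t : Fin N, t.val = transferSearch T₁ T₂ (List.ofFn x) a b ∧ ¬(t ∈ T₁ ↔ t ∈ T₂)
        then 0 else 1) ≤ k * (2 ^ q)⁻¹ := by
  induction k generalizing a b t with
  | zero =>
    have : t.val = a := by simp at hab; omega
    simp only [List.ofFn_zero, transferSearch]
    rw [if_pos ⟨t, this, ht⟩, PMF.expect_const]
    simp
  | succ k ih =>
    rw [PMF.expect_uniformOfFintype_cons]
    simp only [List.ofFn_succ, Fin.cons_zero, Fin.cons_succ, transferSearch]
    by_cases hab' : a = b
    · simp only [if_pos hab']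
      rw [if_pos ⟨t, by omega, ht⟩]
      simp [PMF.expect_const]
    · simp only [if_neg hab']
      rw [pow_succ] at hab
      by_cases hlow : ∃ t : Fin N, a ≤ t.val ∧ t.val ≤ (a + b) / 2 ∧ ¬(t ∈ T₁ ↔ t ∈ T₂)
      · obtain ⟨t', h1, h2, h3⟩ := hlow
        have hrec := ih h1 h2 h3 (by omega)
        calc _ ≤ (PMF.uniformOfFintype (Fin q → ZMod (eqPrime N))).expect fun x =>
              (if EQTest T₁ T₂ a ((a + b) / 2) x then 1 else 0) + k * (2 ^ q)⁻¹ := by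
              refine PMF.expect_mono fun x => ?_
              split_ifs
              · refine (PMF.expect_le_of_le (c := 1) fun xs _ => ?_).trans le_self_add
                split_ifs <;> simp
              · rw [zero_add]
                exact hrec
          _ ≤ (2 ^ q)⁻¹ + k * (2 ^ q)⁻¹ := by
              rw [PMF.expect_add, PMF.expect_const]
              exact add_le_add_left (expect_EQTest_le h1 h2 h3) _
          _ = _ := by push_cast; ring
      · push Not at hlow
        have hEQ : ∀ x : Fin q → ZMod (eqPrime N), EQTest T₁ T₂ a ((a + b) / 2) x := fun x j =>
          fingerprint_congr hlow _
        simp only [hEQ, if_true]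
        have h1 : (a + b) / 2 + 1 ≤ t.val := by
          by_contra h
          exact ht (hlow t ha (by omega))
        rw [PMF.expect_const]
        refine (ih h1 hb ht (by omega)).trans ?_
        gcongr
        simp

/-- The random points with which a transfer moves a token. -/
def TransferSucceeds {ct : ℕ} (T₁ T₂ : Finset (Fin N)) (x : TransferCoin ct N) : Prop :=
  ∃ t, (t ∈ T₁ ∧ t ∉ T₂ ∧ t ∈ (transfer T₁ T₂ x).2) ∨ (t ∉ T₁ ∧ t ∈ T₂ ∧ t ∈ (transfer T₁ T₂ x).1)

open Classical in
/-- A transfer between nodes with different token sets moves a token with probability at least `1/2`: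
each of the `⌈log N⌉` equality tests errs with probability at most `1 / (2⌈log N⌉)`. -/
theorem expect_transfer_fails_le (hN : 2 ≤ N) {ct : ℕ} (hct : 1 ≤ ct) {T₁ T₂ : Finset (Fin N)}
    (hT : T₁ ≠ T₂) :
    ((PMF.uniformOfFintype (TransferCoin ct N)).expect fun x =>
      if TransferSucceeds T₁ T₂ x then 0 else 1) ≤ 2⁻¹ := by
  obtain ⟨t, ht⟩ : ∃ t, ¬(t ∈ T₁ ↔ t ∈ T₂) := by
    by_contra! h
    exact hT (Finset.ext h)
  have hpow : N ≤ 2 ^ Nat.clog 2 N := Nat.le_pow_clog one_lt_two N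
  have h1 := expect_transferSearch_le (q := transferTrials ct N) (Nat.clog 2 N) (a := 0)
    (b := N - 1) (Nat.zero_le _) (by have := t.2; omega) ht (by omega)
  refine (PMF.expect_mono fun x => ?_).trans (h1.trans ?_)
  · by_cases h : ∃ t : Fin N, t.val = transferSearch T₁ T₂ (List.ofFn x) 0 (N - 1) ∧
        ¬(t ∈ T₁ ↔ t ∈ T₂)
    · rw [if_pos]
      · exact zero_le
      obtain ⟨t, h2, h3⟩ := h
      refine ⟨t, ?_⟩
      simp only [transfer, Finset.mem_union, Finset.mem_filter, h2]
      tauto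
    · rw [if_neg h]
      split_ifs <;> simp
  · have hL : 0 < Nat.clog 2 N := Nat.clog_pos one_lt_two hN
    have h2 : Nat.clog 2 N * 2 ≤ 2 ^ transferTrials ct N := by
      refine le_trans ?_ (Nat.le_pow_clog one_lt_two _)
      refine Nat.mul_le_mul_left _ ?_
      calc 2 ≤ N ^ 1 := by simpa using hN
        _ ≤ N ^ ct := Nat.pow_le_pow_right (by omega) hct
    rw [← ENNReal.div_eq_inv_mul.trans (mul_comm _ _)]
    refine ENNReal.div_le_of_le_mul ?_
    rw [← ENNReal.div_eq_inv_mul, ENNReal.le_div_iff_mul_le (by simp) (by simp)]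
    exact_mod_cast h2

end Transfer

/-! ### SharedBit with a common string -/

section SharedBit

variable {P : SSBConstants} {mode : IdMode} {N : ℕ} [NeZero N] {R : Fin N → SharedString P N}
  {V : Type} [Fintype V] {uid : V → Fin N} {G : SimpleGraph V}
  {ids : V → ℕ} {T₀ : V → Finset (Fin N)} {ℓ : V} {σ : V → SSBState N N}

theorem PMF.expect_bool_eq (c : Bool) :
    ((PMF.uniformOfFintype Bool).expect fun b => if b = c then (1 : ℝ≥0∞) else 0) = 2⁻¹ := by
  rw [PMF.expect_uniformOfFintype]
  cases c <;> simp

omit [NeZero N] in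
/-- The advertised bit as a function of the bundle of one token `t`. -/
theorem sharedBitTag_update {L : ℕ} (g : Fin N → Fin (L + 1) → Bool) (t : Fin N)
    (w : Fin (L + 1) → Bool) (T : Finset (Fin N)) :
    sharedBitTag (Function.update g t w) T =
      ((decide (t ∈ T) && w 0) ^^ sharedBitTag g (T.erase t)) := by
  have h1 : ∀ S : Finset (Fin N), t ∉ S →
      (S.filter fun s => Function.update g t w s 0 = true) = S.filter fun s => g s 0 = true := by
    intro S hS
    refine Finset.filter_congr fun s hs => ?_
    rw [Function.update_of_ne]
    rintro rfl
    exact hS hs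
  by_cases ht : t ∈ T
  · have h2 := h1 (T.erase t) (Finset.notMem_erase t T)
    unfold sharedBitTag
    rw [← h2]
    conv_lhs => rw [← Finset.insert_erase ht]
    rw [Finset.filter_insert]
    simp only [Function.update_self, ht, decide_true, Bool.true_and]
    cases hw : w 0 with
    | false => simp
    | true =>
      rw [if_pos rfl, Finset.card_insert_of_notMem (by simp)]
      rw [Bool.true_xor, ← decide_not]
      refine decide_eq_decide.2 ?_
      omega
  · unfold sharedBitTag
    rw [h1 T ht, Finset.erase_eq_of_notMem ht]
    simp [ht]

omit [NeZero N] in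
open Classical in
/-- Nodes that know different sets of tokens advertise the same bit with probability `1/2`. -/
theorem expect_sharedBitTag_eq {L : ℕ} {T₁ T₂ : Finset (Fin N)} (hT : T₁ ≠ T₂) :
    ((PMF.uniformOfFintype (Fin N → Fin (L + 1) → Bool)).expect fun g =>
      if sharedBitTag g T₁ = sharedBitTag g T₂ then (1 : ℝ≥0∞) else 0) = 2⁻¹ := by
  obtain ⟨t, ht⟩ : ∃ t, ¬(t ∈ T₁ ↔ t ∈ T₂) := by
    by_contra! h
    exact hT (Finset.ext h)
  rw [← PMF.expect_resample_univ t]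
  have key : ∀ g : Fin N → Fin (L + 1) → Bool, ∃ c : Bool, ∀ w,
      (sharedBitTag (Function.update g t w) T₁ = sharedBitTag (Function.update g t w) T₂ ↔
        w 0 = c) := by
    intro g
    refine ⟨sharedBitTag g (T₁.erase t) ^^ sharedBitTag g (T₂.erase t), fun w => ?_⟩
    rw [sharedBitTag_update, sharedBitTag_update]
    generalize sharedBitTag g (T₁.erase t) = c₁
    generalize sharedBitTag g (T₂.erase t) = c₂
    generalize w 0 = b
    by_cases h1 : t ∈ T₁ <;> by_cases h2 : t ∈ T₂ <;> simp [h1, h2] at ht ⊢ <;>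
      revert c₁ c₂ b <;> decide
  refine (congrArg _ (funext fun g => ?_)).trans (PMF.expect_const _ _)
  obtain ⟨c, hc⟩ := key g
  simp only [hc]
  rw [← PMF.expect_resample_univ (0 : Fin (L + 1))]
  simp only [Function.update_self]
  exact (PMF.expect_comm _ _ _).trans (by simp only [PMF.expect_const]; exact PMF.expect_bool_eq c)

open Classical in
/-- The number of pairs of a node and a token that it does not know. -/
noncomputable def missingTokens (K : Finset (Fin N)) (σ : V → SSBState N N) : ℕ :=
  ∑ v, (K \ (σ v).tokens).card

omit [NeZero N] in
theorem missingTokens_le {K : Finset (Fin N)} {σ σ' : V → SSBState N N}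
    (h : ∀ v, (σ v).tokens ⊆ (σ' v).tokens) : missingTokens K σ' ≤ missingTokens K σ :=
  Finset.sum_le_sum fun v _ => Finset.card_le_card (Finset.sdiff_subset_sdiff subset_rfl (h v))

omit [NeZero N] in
theorem missingTokens_lt {K : Finset (Fin N)} {σ σ' : V → SSBState N N}
    (h : ∀ v, (σ v).tokens ⊆ (σ' v).tokens) {v : V} {t : Fin N} (ht : t ∈ K)
    (h1 : t ∉ (σ v).tokens) (h2 : t ∈ (σ' v).tokens) :
    missingTokens K σ' < missingTokens K σ := by
  refine Finset.sum_lt_sum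
    (fun v _ => Finset.card_le_card (Finset.sdiff_subset_sdiff subset_rfl (h v)))
    ⟨v, Finset.mem_univ v, Finset.card_lt_card ⟨Finset.sdiff_subset_sdiff subset_rfl (h v), ?_⟩⟩
  intro hsub
  have := hsub (Finset.mem_sdiff.2 ⟨ht, h1⟩)
  exact (Finset.mem_sdiff.1 this).2 h2

omit [NeZero N] in
open Classical in
/-- As long as a token is missing somewhere, some neighbours know different tokens. -/
theorem exists_adj_tokens_ne (hG : G.Connected) (h : SSBInvariant ids uid T₀ ℓ σ)
    (hmiss : missingTokens (Finset.univ.biUnion T₀) σ ≠ 0) :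
    ∃ u v, G.Adj u v ∧ (σ u).tokens ≠ (σ v).tokens := by
  by_contra! hall
  have heq : ∀ v, (σ v).tokens = (σ ℓ).tokens := by
    intro v
    by_contra hv
    obtain ⟨x, hx, y, hy, hxy⟩ := exists_adj_of_connected hG
      (S := {w | (σ w).tokens = (σ ℓ).tokens}) (a := ℓ) (b := v) rfl hv
    exact hy ((hall x y hxy).symm.trans hx)
  refine hmiss (Finset.sum_eq_zero fun v _ => ?_)
  rw [Finset.card_eq_zero, Finset.sdiff_eq_empty_iff_subset, Finset.biUnion_subset]
  intro w _
  rw [heq v, ← heq w]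
  exact h.subset_tokens w

omit [NeZero N] in
theorem leaderId_eq_of_agreeing {b : ℕ} (h : agreeing b 0 σ = Finset.univ) (v : V) :
    (σ v).leaderId = b := by
  have := mem_agreeing.1 (h ▸ Finset.mem_univ v)
  rwa [pow_zero, Nat.div_one, Nat.div_one] at this

omit [NeZero N] in
theorem seed_eq_of_agreeing (hids : Function.Injective ids) (h : SSBInvariant ids uid T₀ ℓ σ)
    (hagree : agreeing (ids ℓ) 0 σ = Finset.univ) (v : V) : (σ v).seed = uid ℓ := by
  obtain ⟨w, h1, -, h3⟩ := h.candidate v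
  rw [leaderId_eq_of_agreeing hagree] at h1
  rw [h3, hids h1]

omit [NeZero N] in
theorem ssbTag_even {R : Fin N → SharedString P N} {s : ℕ} (hs : s < P.groups N)
    (st : SSBState N N) :
    ssbTag P mode R (2 * s) st = sharedBitTag (R st.seed ⟨s, hs⟩) st.tokens := by
  have h1 : 2 * s / 2 = s := by omega
  simp [ssbTag, currentGroup, h1, hs]

open Classical in
/-- If some neighbours advertise different bits, in a round of SharedBit with a common string, then
some nodes with different token sets connect, and with probability at least `1/2` their transfer
succeeds. -/
theorem expect_two_pow_missingTokens_le (hN : 2 ≤ N) (huid : Function.Injective uid)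
    (hids : Function.Injective ids)
    {s : ℕ} (hs : s < P.groups N) (h : SSBInvariant ids uid T₀ ℓ σ)
    (hagree : agreeing (ids ℓ) 0 σ = Finset.univ) {u v : V} (huv : G.Adj u v)
    (htag : sharedBitTag (R (uid ℓ) ⟨s, hs⟩) (σ u).tokens ≠
      sharedBitTag (R (uid ℓ) ⟨s, hs⟩) (σ v).tokens) :
    ((ssbRound P mode R uid G (2 * s) σ).expect fun σ' =>
      2 ^ missingTokens (Finset.univ.biUnion T₀) σ') ≤
      2 ^ missingTokens (Finset.univ.biUnion T₀) σ * (3 / 4 : ℝ≥0∞) := by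
  set K := Finset.univ.biUnion T₀ with hK
  have hi : 2 * s % 2 = 0 := by omega
  have htagσ : ∀ w, ssbTag P mode R (2 * s) (σ w) =
      sharedBitTag (R (uid ℓ) ⟨s, hs⟩) (σ w).tokens := fun w => by
    rw [ssbTag_even hs, seed_eq_of_agreeing hids h hagree]
  -- the neighbour that advertises `1` proposes
  obtain ⟨x, y, hxy, hx, hy⟩ : ∃ x y, G.Adj x y ∧ ssbTag P mode R (2 * s) (σ x) = true ∧
      ssbTag P mode R (2 * s) (σ y) = false := by
    rw [← htagσ, ← htagσ] at htag
    cases hu : ssbTag P mode R (2 * s) (σ u) <;> cases hv : ssbTag P mode R (2 * s) (σ v)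
    · simp [hu, hv] at htag
    · exact ⟨v, u, huv.symm, hv, hu⟩
    · exact ⟨u, v, huv, hu, hv⟩
    · simp [hu, hv] at htag
  obtain ⟨z, hz, hprops⟩ := ssbProposals_even_of_tag_true huid hi σ hx hxy hy
  rw [expect_ssbRound]
  refine PMF.expect_le_of_le fun prop hprop => PMF.expect_le_of_le fun acc hacc => ?_
  rw [PMF.mem_support_uniformOfFinset_iff] at hprop hacc
  have hpx : prop x = some z := by
    have := Fintype.mem_piFinset.1 hprop x
    rw [hprops] at this
    simpa using this
  have hpz : prop z = none := by
    have := Fintype.mem_piFinset.1 hprop z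
    rw [ssbProposals_even_of_tag_false hi σ hz] at this
    simpa using this
  -- the node `z` may accept the proposal of another node `w`, which also advertises `1`
  obtain ⟨w, hw, hpw⟩ := MTMAlgorithm.exists_acceptance hacc hpz hpx
  have hwt := ssbTag_of_proposal_even hi σ hprop hpw
  have haw : acc w = none := by
    by_contra hne
    obtain ⟨w', hw'⟩ := Option.ne_none_iff_exists'.1 hne
    have := (MTMAlgorithm.acceptances_some hacc hw').1
    simp [hpw] at this
  have hTne : (σ w).tokens ≠ (σ z).tokens := by
    intro heq
    rw [htagσ] at hwt hz
    rw [heq, hz] at hwt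
    simp at hwt
  rw [← PMF.expect_resample_univ z]
  refine PMF.expect_le_of_le fun coin _ => ?_
  have hcoin : ∀ c : TransferCoin P.ct N,
      (2 : ℝ≥0∞) ^ missingTokens K (ssbUpdate P mode R (2 * s) σ prop acc
        (Function.update coin z c)) ≤
      2 ^ missingTokens K σ * (2⁻¹ + 2⁻¹ *
        if TransferSucceeds (σ w).tokens (σ z).tokens c then 0 else 1) := by
    intro c
    set τ := ssbUpdate P mode R (2 * s) σ prop acc (Function.update coin z c) with hτ
    have hmono : ∀ v, (σ v).tokens ⊆ (τ v).tokens := fun v => by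
      obtain ⟨-, h1, -⟩ := ssbUpdate_spec (mode := mode) (R := R) (i := 2 * s) σ prop acc
        (Function.update coin z c) v
      exact h1
    split_ifs with hc
    · have hlt : missingTokens K τ < missingTokens K σ := by
        have hτz : τ z = { σ z with tokens := (transfer (σ w).tokens (σ z).tokens c).2 } := by
          refine ((simSharedBit P mode R).update_of_acc (2 * s) σ prop
            (Function.update coin z c) hw).trans ?_
          simp [simSharedBit, ssbConnect]
        have hτw : τ w = { σ w with tokens := (transfer (σ w).tokens (σ z).tokens c).1 } := by
          refine ((simSharedBit P mode R).update_of_acc' (2 * s) σ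
            (Function.update coin z c) haw hpw hw).trans ?_
          simp [simSharedBit, ssbConnect]
        obtain ⟨t, ⟨h1, h2, h3⟩ | ⟨h1, h2, h3⟩⟩ := hc
        · exact missingTokens_lt hmono (h.tokens_subset w h1) h2 (by rw [hτz]; exact h3)
        · exact missingTokens_lt hmono (h.tokens_subset z h2) h1 (by rw [hτw]; exact h3)
      rw [mul_zero, add_zero, ← ENNReal.div_eq_inv_mul.trans (mul_comm _ _),
        ENNReal.le_div_iff_mul_le (by simp) (by simp), ← pow_succ]
      exact pow_le_pow_right₀ one_le_two hlt
    · rw [mul_one, ENNReal.inv_two_add_inv_two, mul_one]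
      exact pow_le_pow_right₀ one_le_two (missingTokens_le hmono)
  refine (PMF.expect_mono hcoin).trans ?_
  rw [PMF.expect_const_mul, PMF.expect_add, PMF.expect_const, PMF.expect_const_mul]
  refine mul_le_mul_right ?_ _
  calc _ ≤ (2⁻¹ + 2⁻¹ * 2⁻¹ : ℝ≥0∞) := by
        gcongr
        exact expect_transfer_fails_le hN P.ct_pos hTne
    _ = 3 / 4 := by
        rw [← ENNReal.toReal_eq_toReal_iff' (by finiteness) (by finiteness),
          ENNReal.toReal_add (by finiteness) (by finiteness)]
        simp
        norm_num

end SharedBit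

/-! ### The time until the tokens are spread -/

section SharedBitTime

variable {P : SSBConstants} {mode : IdMode} {N : ℕ} [NeZero N] {R : Fin N → SharedString P N}
  {V : Type} [Fintype V] {uid : V → Fin N}
  {ids : V → ℕ} {T₀ : V → Finset (Fin N)} {ℓ : V}

omit [NeZero N] in
/-- A round only depends on the group of the strings that is used in it. -/
theorem ssbRound_congr {m : ℕ} [NeZero m] {R R' : Fin m → SharedString P N} {G : SimpleGraph V}
    {i : ℕ} (h : i % 2 = 0 → ∀ k, ∀ hi : i / 2 < P.groups N, R k ⟨i / 2, hi⟩ = R' k ⟨i / 2, hi⟩)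
    (σ : V → SSBState N m) :
    ssbRound P mode R uid G i σ = ssbRound P mode R' uid G i σ := by
  classical
  have hcur : i % 2 = 0 → ∀ st, currentGroup P R (i / 2) st = currentGroup P R' (i / 2) st := by
    intro hi st
    unfold currentGroup
    split_ifs with h'
    · rw [h hi]
    · rfl
  have htag : ∀ st, ssbTag P mode R i st = ssbTag P mode R' i st := by
    intro st
    unfold ssbTag
    split_ifs with hi
    · rw [hcur hi]
    · rfl
  have htargets : ∀ u st nbrs, ssbTargets P mode R i u st nbrs =
      ssbTargets P mode R' i u st nbrs := by
    intro u st nbrs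
    unfold ssbTargets
    split_ifs with hi
    · rw [hcur hi]
    · rfl
    · rfl
  have hscan : ∀ u, (simSharedBit P mode R).scan uid G i σ u =
      (simSharedBit P mode R').scan uid G i σ u := by
    intro u
    simp only [MTMAlgorithm.scan, simSharedBit, htag]
  have hprop : ssbProposals P mode R uid G i σ = ssbProposals P mode R' uid G i σ := by
    funext u
    have h1 : ∀ nbrs, (simSharedBit P mode R).targets i (uid u) (σ u) nbrs =
        (simSharedBit P mode R').targets i (uid u) (σ u) nbrs := htargets (uid u) (σ u)
    simp only [ssbProposals, MTMAlgorithm.proposals, hscan, h1]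
  have hunif : ∀ (S S' : V → Finset (Option V)) (hS : (Fintype.piFinset S).Nonempty)
      (hS' : (Fintype.piFinset S').Nonempty), S = S' →
      PMF.uniformOfFinset _ hS = PMF.uniformOfFinset _ hS' := by
    rintro S S' hS hS' rfl
    rfl
  unfold ssbRound MTMAlgorithm.round
  exact congrArg (PMF.bind · _) (hunif _ _ _ _ hprop)

omit [NeZero N] in
/-- An execution up to time `t` only depends on the groups of the strings used before `t`. -/
theorem ssbLaw_congr {m : ℕ} [NeZero m] {R R' : Fin m → SharedString P N} {G : ℕ → SimpleGraph V}
    {t : ℕ} (h : ∀ s, 2 * s < t → ∀ k, ∀ hs : s < P.groups N, R k ⟨s, hs⟩ = R' k ⟨s, hs⟩)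
    (σ₀ : V → SSBState N m) :
    ssbLaw P mode R uid G σ₀ t = ssbLaw P mode R' uid G σ₀ t := by
  induction t with
  | zero => rfl
  | succ t ih =>
    have h1 := ih fun s hs => h s (by omega)
    have h2 : ssbRound P mode R uid (G t) t = ssbRound P mode R' uid (G t) t :=
      funext fun σ => ssbRound_congr (fun ht k hk => h (t / 2) (by omega) k hk) σ
    exact congrArg₂ PMF.bind h1 h2

open Classical in
/-- An upper bound on the probability that some token is missing somewhere after `r` more rounds of
SharedBit.  It is `1` unless all nodes have the same candidate; due to the minimum with `1` it can
be used whether or not they have at the beginning. -/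
noncomputable def tokenPotential (b : ℕ) (K : Finset (Fin N)) (r : ℕ) (σ : V → SSBState N N) :
    ℝ≥0∞ :=
  if agreeing b 0 σ = Finset.univ then
    if missingTokens K σ = 0 then 0
    else min 1 (2 ^ missingTokens K σ * (7 / 8) ^ r)
  else 1

omit [NeZero N] in
theorem tokenPotential_le_one (b : ℕ) (K : Finset (Fin N)) (r : ℕ) (σ : V → SSBState N N) :
    tokenPotential b K r σ ≤ 1 := by
  unfold tokenPotential
  split_ifs
  · exact zero_le
  · exact min_le_left _ _
  · exact le_rfl

/-- The potential after a round that starts when all nodes have the same candidate. -/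
theorem tokenPotential_le_of_mem_support {G : SimpleGraph V} {i : ℕ} {K : Finset (Fin N)} (r : ℕ)
    {σ σ' : V → SSBState N N} (h : SSBInvariant ids uid T₀ ℓ σ)
    (hσ' : σ' ∈ (ssbRound P mode R uid G i σ).support)
    (hagree : agreeing (ids ℓ) 0 σ = Finset.univ) :
    tokenPotential (ids ℓ) K r σ' ≤ 2 ^ missingTokens K σ' * (7 / 8) ^ r ∧
    (missingTokens K σ = 0 → tokenPotential (ids ℓ) K r σ' = 0) ∧
    missingTokens K σ' ≤ missingTokens K σ := by
  have h1 : agreeing (ids ℓ) 0 σ' = Finset.univ := Finset.univ_subset_iff.1 (hagree ▸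
    agreeing_subset (h.of_mem_support hσ') fun v => (leaderId_le_of_mem_support hσ' v).1)
  have h2 : missingTokens K σ' ≤ missingTokens K σ :=
    missingTokens_le fun v => (leaderId_le_of_mem_support hσ' v).2
  refine ⟨?_, fun h3 => ?_, h2⟩
  · rw [tokenPotential, if_pos h1]
    split_ifs
    · exact zero_le
    · exact min_le_right _ _
  · rw [tokenPotential, if_pos h1, if_pos (by omega)]

/-- The potential does not increase in any round, whatever the strings are. -/
theorem expect_tokenPotential_le {G : SimpleGraph V} {i : ℕ} {K : Finset (Fin N)} (r : ℕ)
    {σ : V → SSBState N N} (h : SSBInvariant ids uid T₀ ℓ σ) :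
    (ssbRound P mode R uid G i σ).expect (tokenPotential (ids ℓ) K r) ≤
      tokenPotential (ids ℓ) K r σ := by
  rw [tokenPotential]
  split_ifs with h1 h2
  · refine PMF.expect_le_of_le fun σ' hσ' => ?_
    rw [(tokenPotential_le_of_mem_support r h hσ' h1).2.1 h2]
  · refine le_min (PMF.expect_le_of_le fun _ _ => tokenPotential_le_one _ _ _ _)
      (PMF.expect_le_of_le fun σ' hσ' => ?_)
    obtain ⟨h3, -, h4⟩ := tokenPotential_le_of_mem_support (K := K) r h hσ' h1
    refine h3.trans (mul_le_mul_left ?_ _)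
    exact pow_le_pow_right₀ one_le_two h4
  · exact PMF.expect_le_of_le fun _ _ => tokenPotential_le_one _ _ _ _

/-- In a round of SharedBit with a fresh random group, a failure probability for `r` more rounds
replaces one for `r + 1` more rounds: with probability `1/2` the potential is multiplied by at most
`3/4` in expectation, and it never increases otherwise, which is a factor of `7/8` on average. -/
theorem expect_expect_tokenPotential_le (hN : 2 ≤ N) (huid : Function.Injective uid)
    (hids : Function.Injective ids) {G : SimpleGraph V} (hG : G.Connected) (r : ℕ)
    {s : ℕ} (hs : s < P.groups N) (x : SharedString P N)
    {σ : V → SSBState N N} (h : SSBInvariant ids uid T₀ ℓ σ) :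
    ((PMF.uniformOfFintype (Fin N → Fin (Nat.clog 2 N + 1) → Bool)).expect fun g =>
      (ssbRound P mode (Function.update R (uid ℓ) (Function.update x ⟨s, hs⟩ g)) uid G
        (2 * s) σ).expect
        (tokenPotential (ids ℓ) (Finset.univ.biUnion T₀) r)) ≤
      tokenPotential (ids ℓ) (Finset.univ.biUnion T₀) (r + 1) σ := by
  classical
  set K := Finset.univ.biUnion T₀ with hK
  by_cases hagree : agreeing (ids ℓ) 0 σ = Finset.univ
  · by_cases hmiss : missingTokens K σ = 0
    · refine PMF.expect_le_of_le fun g _ => PMF.expect_le_of_le fun σ' hσ' => ?_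
      rw [(tokenPotential_le_of_mem_support r h hσ' hagree).2.1 hmiss]
      exact zero_le
    · rw [tokenPotential, if_pos hagree, if_neg hmiss]
      refine le_min (PMF.expect_le_of_le fun _ _ =>
        PMF.expect_le_of_le fun _ _ => tokenPotential_le_one _ _ _ _) ?_
      obtain ⟨u, v, huv, hne⟩ := exists_adj_tokens_ne hG h hmiss
      have hg : ∀ g : Fin N → Fin (Nat.clog 2 N + 1) → Bool,
          (ssbRound P mode (Function.update R (uid ℓ) (Function.update x ⟨s, hs⟩ g)) uid G
            (2 * s) σ).expect (tokenPotential (ids ℓ) K r) ≤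
          2 ^ missingTokens K σ * (7 / 8) ^ r * (3 / 4 + 4⁻¹ *
            if sharedBitTag g (σ u).tokens = sharedBitTag g (σ v).tokens then 1 else 0) := by
        intro g
        have h1 : (ssbRound P mode (Function.update R (uid ℓ) (Function.update x ⟨s, hs⟩ g)) uid G
            (2 * s) σ).expect (tokenPotential (ids ℓ) K r) ≤
            (ssbRound P mode (Function.update R (uid ℓ) (Function.update x ⟨s, hs⟩ g)) uid G
            (2 * s) σ).expect fun σ' => 2 ^ missingTokens K σ' * (7 / 8) ^ r :=
          PMF.expect_mono_of_mem_support fun σ' hσ' =>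
            (tokenPotential_le_of_mem_support r h hσ' hagree).1
        refine h1.trans ?_
        refine (PMF.expect_mul_const _ _ _).trans_le ?_
        split_ifs with heq
        · have h34 : (3 / 4 + 4⁻¹ * 1 : ℝ≥0∞) = 1 := by
            rw [← ENNReal.toReal_eq_toReal_iff' (by finiteness) (by finiteness),
              ENNReal.toReal_add (by finiteness) (by finiteness)]
            simp
            norm_num
          rw [h34, mul_one]
          refine mul_le_mul_left (PMF.expect_le_of_le fun σ' hσ' => ?_) _
          exact pow_le_pow_right₀ one_le_two (tokenPotential_le_of_mem_support r h hσ' hagree).2.2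
        · rw [mul_zero, add_zero, mul_right_comm]
          refine mul_le_mul_left ?_ _
          refine expect_two_pow_missingTokens_le hN huid hids hs h hagree huv ?_
          simpa using heq
      refine (PMF.expect_mono hg).trans ?_
      rw [PMF.expect_const_mul, PMF.expect_add, PMF.expect_const, PMF.expect_const_mul,
        expect_sharedBitTag_eq hne, pow_succ, ← mul_assoc]
      refine mul_le_mul_right (le_of_eq ?_) _
      rw [← ENNReal.toReal_eq_toReal_iff' (by finiteness) (by finiteness),
        ENNReal.toReal_add (by finiteness) (by finiteness)]
      simp
      norm_num
  · rw [tokenPotential, if_neg hagree]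
    exact PMF.expect_le_of_le fun _ _ => PMF.expect_le_of_le fun _ _ =>
      tokenPotential_le_one _ _ _ _

/-- The potential averaged over the string of the leader.  Its groups are used in different rounds,
so a group is still uniformly random when it is used. -/
theorem expect_string_tokenPotential_le (hN : 2 ≤ N) (huid : Function.Injective uid)
    (hids : Function.Injective ids) {G : ℕ → SimpleGraph V} (hG : ∀ i, (G i).Connected)
    (hℓ : ∀ w, ids ℓ ≤ ids w) (s₀ u : ℕ) (hu : s₀ + u ≤ P.groups N) :
    ((PMF.uniformOfFintype (SharedString P N)).expect fun x =>
      (ssbLaw P mode (Function.update R (uid ℓ) x) uid G (ssbInit ids uid T₀)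
        (2 * (s₀ + u))).expect (tokenPotential (ids ℓ) (Finset.univ.biUnion T₀) 0)) ≤
    ((PMF.uniformOfFintype (SharedString P N)).expect fun x =>
      (ssbLaw P mode (Function.update R (uid ℓ) x) uid G (ssbInit ids uid T₀)
        (2 * s₀)).expect (tokenPotential (ids ℓ) (Finset.univ.biUnion T₀) u)) := by
  classical
  set K := Finset.univ.biUnion T₀ with hK
  have hinv : ∀ (x : SharedString P N) (t : ℕ),
      ∀ σ ∈ (ssbLaw P mode (Function.update R (uid ℓ) x) uid G (ssbInit ids uid T₀) t).support,
      SSBInvariant ids uid T₀ ℓ σ := fun x t =>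
    MTMAlgorithm.mem_support_lawFrom
      (A := simSharedBit P mode (Function.update R (uid ℓ) x)) (σ₀ := ssbInit ids uid T₀)
      (SSBInvariant ids uid T₀ ℓ) (ssbInvariant_ssbInit uid T₀ hℓ)
      (fun i σ σ' h h' => h.of_mem_support h') t
  have hsucc : ∀ (x : SharedString P N) (t : ℕ) (f : (V → SSBState N N) → ℝ≥0∞),
      (ssbLaw P mode (Function.update R (uid ℓ) x) uid G (ssbInit ids uid T₀) (t + 1)).expect f =
      (ssbLaw P mode (Function.update R (uid ℓ) x) uid G (ssbInit ids uid T₀) t).expect fun σ =>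
        (ssbRound P mode (Function.update R (uid ℓ) x) uid (G t) t σ).expect f :=
    fun x t f => PMF.expect_bind _ _ _
  have key : ∀ a ≤ u, ((PMF.uniformOfFintype (SharedString P N)).expect fun x =>
      (ssbLaw P mode (Function.update R (uid ℓ) x) uid G (ssbInit ids uid T₀)
        (2 * (s₀ + a))).expect (tokenPotential (ids ℓ) K (u - a))) ≤
    ((PMF.uniformOfFintype (SharedString P N)).expect fun x =>
      (ssbLaw P mode (Function.update R (uid ℓ) x) uid G (ssbInit ids uid T₀)
        (2 * s₀)).expect (tokenPotential (ids ℓ) K u)) := by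
    intro a
    induction a with
    | zero => intro _; exact le_rfl
    | succ a ih =>
      intro ha
      refine le_trans ?_ (ih (by omega))
      have hs : s₀ + a < P.groups N := by omega
      rw [show 2 * (s₀ + (a + 1)) = 2 * (s₀ + a) + 1 + 1 by ring,
        show u - a = u - (a + 1) + 1 by omega]
      set r := u - (a + 1)
      -- the round of BitConvergence
      have h1 : ((PMF.uniformOfFintype (SharedString P N)).expect fun x =>
          (ssbLaw P mode (Function.update R (uid ℓ) x) uid G (ssbInit ids uid T₀)
            (2 * (s₀ + a) + 1 + 1)).expect (tokenPotential (ids ℓ) K r)) ≤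
          (PMF.uniformOfFintype (SharedString P N)).expect fun x =>
          (ssbLaw P mode (Function.update R (uid ℓ) x) uid G (ssbInit ids uid T₀)
            (2 * (s₀ + a) + 1)).expect (tokenPotential (ids ℓ) K r) := by
        refine PMF.expect_mono fun x => ?_
        rw [hsucc]
        exact PMF.expect_mono_of_mem_support fun σ hσ =>
          expect_tokenPotential_le r (hinv x _ σ hσ)
      refine h1.trans ?_
      -- in the round of SharedBit, the group in use is replaced by a fresh one
      simp only [hsucc]
      rw [← PMF.expect_resample_univ (⟨s₀ + a, hs⟩ : Fin (P.groups N))]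
      refine PMF.expect_mono fun x => ?_
      have hlaw : ∀ g, ssbLaw P mode (Function.update R (uid ℓ)
            (Function.update x ⟨s₀ + a, hs⟩ g)) uid G (ssbInit ids uid T₀) (2 * (s₀ + a)) =
          ssbLaw P mode (Function.update R (uid ℓ) x) uid G (ssbInit ids uid T₀)
            (2 * (s₀ + a)) := by
        intro g
        refine ssbLaw_congr (fun s hs' k hk => ?_) _
        by_cases hkl : k = uid ℓ
        · subst hkl
          rw [Function.update_self, Function.update_self, Function.update_of_ne]
          intro heq
          have := congrArg Fin.val heq
          simp only at this
          omega
        · rw [Function.update_of_ne hkl, Function.update_of_ne hkl]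
      simp only [hlaw]
      rw [PMF.expect_comm]
      exact PMF.expect_mono_of_mem_support fun σ hσ =>
        expect_expect_tokenPotential_le hN huid hids (hG _) r hs x (hinv x _ σ hσ)
  have := key u le_rfl
  rwa [Nat.sub_self] at this

end SharedBitTime

/-! ### The failure probability with a random string -/

section FailureProbability

variable {P : SSBConstants} {mode : IdMode} {N m : ℕ} [NeZero N] [NeZero m]
  {V : Type} [Fintype V] {uid : V → Fin N}
  {ids : V → ℕ} {T₀ : V → Finset (Fin N)} {ℓ : V}

open Classical in
/-- The indicator of the event that some node does not know some token. -/
noncomputable def gossipFails (T₀ : V → Finset (Fin N)) (σ : V → SSBState N m) : ℝ≥0∞ :=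
  if ∀ v w, T₀ w ⊆ (σ v).tokens then 0 else 1

omit [NeZero N] [NeZero m] in
theorem gossipFails_le_one (σ : V → SSBState N m) : gossipFails T₀ σ ≤ 1 := by
  unfold gossipFails
  split_ifs <;> simp

omit [NeZero N] in
/-- Tokens are never forgotten. -/
theorem expect_gossipFails_antitone {R : Fin m → SharedString P N} {G : ℕ → SimpleGraph V}
    (σ₀ : V → SSBState N m) {s t : ℕ} (hst : s ≤ t) :
    (ssbLaw P mode R uid G σ₀ t).expect (gossipFails T₀) ≤
      (ssbLaw P mode R uid G σ₀ s).expect (gossipFails T₀) := by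
  refine MTMAlgorithm.expect_lawFrom_le (A := simSharedBit P mode R) (σ₀ := σ₀) (fun _ => True)
    trivial (fun _ _ _ _ _ => trivial) (fun _ => gossipFails T₀) hst fun i _ _ σ _ => ?_
  refine PMF.expect_le_of_le fun σ' hσ' => ?_
  unfold gossipFails
  split_ifs with h1 h2 h2
  · exact le_rfl
  · exact zero_le
  · exact absurd (fun v w => (h2 v w).trans (leaderId_le_of_mem_support hσ' v).2) h1
  · exact le_rfl

open Classical in
/-- When the string of the node with the smallest identifier is uniformly random, gossip fails only
if no common leader is elected in time, or if the subsequent rounds of SharedBit with the random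
string do not suffice. -/
theorem expect_string_gossipFails_le (hN : 2 ≤ N) (R : Fin N → SharedString P N)
    (hV : 2 ≤ Fintype.card V) (huid : Function.Injective uid)
    (hids : Function.Injective ids) {G : ℕ → SimpleGraph V} (hG : ∀ i, (G i).Connected)
    (hα : 0 < dynExpansion G) (hℓ : ∀ w, ids ℓ ≤ ids w)
    (hidlt : ∀ w, ids w < 2 ^ P.idBits N mode) {q : ℕ} (hq : 1 ≤ q) (M u : ℕ)
    (hu : P.idBits N mode * (M * (P.idBits N mode * (2 * Nat.clog 2 N))) + u ≤ P.groups N) :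
    ((PMF.uniformOfFintype (SharedString P N)).expect fun x =>
      (ssbLaw P mode (Function.update R (uid ℓ) x) uid G (ssbInit ids uid T₀)
        (2 * (P.idBits N mode * (M * (P.idBits N mode * (2 * Nat.clog 2 N))) + u))).expect
        (gossipFails T₀)) ≤
      P.idBits N mode * ENNReal.ofReal (Real.exp (Fintype.card V / (2 * q : ℝ) +
        2 * (4 * (2 * q : ℝ) ^ 2 / dynExpansion G + 1) - (M * (2 * Nat.clog 2 N) : ℕ) / 8)) +
      2 ^ (Fintype.card V * (Finset.univ.biUnion T₀).card) * (7 / 8) ^ u := by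
  set K := Finset.univ.biUnion T₀ with hK
  set s₀ := P.idBits N mode * (M * (P.idBits N mode * (2 * Nat.clog 2 N)))
  have h1 : ∀ σ : V → SSBState N N, gossipFails T₀ σ ≤ tokenPotential (ids ℓ) K 0 σ := by
    intro σ
    unfold tokenPotential
    split_ifs with h2 h3
    · rw [gossipFails, if_pos]
      intro v w
      have h4 := (Finset.sum_eq_zero_iff.1 h3) v (Finset.mem_univ v)
      rw [Finset.card_eq_zero, Finset.sdiff_eq_empty_iff_subset] at h4
      exact (Finset.subset_biUnion_of_mem T₀ (Finset.mem_univ w)).trans h4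
    · rw [pow_zero, mul_one, min_eq_left (one_le_pow₀ one_le_two)]
      exact gossipFails_le_one σ
    · exact gossipFails_le_one σ
  refine (PMF.expect_mono fun x => PMF.expect_mono h1).trans
    ((expect_string_tokenPotential_le hN huid hids hG hℓ s₀ u hu).trans ?_)
  refine PMF.expect_le_of_le fun x _ => ?_
  have h2 : ∀ σ : V → SSBState N N, tokenPotential (ids ℓ) K u σ ≤
      (if agreeing (ids ℓ) 0 σ = Finset.univ then 0 else 1) +
        2 ^ (Fintype.card V * K.card) * (7 / 8) ^ u := by
    intro σ
    unfold tokenPotential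
    split_ifs with h2 h3
    · exact zero_le
    · rw [zero_add]
      refine (min_le_right _ _).trans (mul_le_mul_left (pow_le_pow_right₀ one_le_two ?_) _)
      calc missingTokens K σ ≤ ∑ _v : V, K.card :=
            Finset.sum_le_sum fun v _ => Finset.card_le_card Finset.sdiff_subset
        _ = _ := by simp
    · exact le_self_add
  refine (PMF.expect_mono h2).trans ((PMF.expect_add _ _ _).trans_le ?_)
  rw [PMF.expect_const]
  exact add_le_add_left (expect_no_leader_le hV huid hG hq hα hℓ hidlt M) _

end FailureProbability

/-! ### Running times -/

theorem clog_le_two_mul_logb {N : ℕ} (hN : 2 ≤ N) :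
    (Nat.clog 2 N : ℝ) ≤ 2 * Real.logb 2 N := by
  have h1 : 1 ≤ Real.logb 2 N := by
    rw [Real.le_logb_iff_rpow_le one_lt_two (by positivity)]
    simpa using (by exact_mod_cast hN : (2 : ℝ) ≤ N)
  have h2 : (Nat.clog 2 N : ℝ) < Real.logb 2 N + 1 := by
    have h3 : 2 ^ (Nat.clog 2 N - 1) < N := Nat.pow_pred_clog_lt_self one_lt_two hN
    have h4 : ((Nat.clog 2 N - 1 : ℕ) : ℝ) < Real.logb 2 N := by
      rw [Real.lt_logb_iff_rpow_lt one_lt_two (by positivity), Real.rpow_natCast]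
      exact_mod_cast h3
    have h5 : 0 < Nat.clog 2 N := Nat.clog_pos one_lt_two hN
    rw [Nat.cast_sub h5] at h4
    push_cast at h4
    linarith
  linarith

/-- The number of phases per bit of the identifiers that suffices for the leader election. -/
theorem exists_phases {N n : ℕ} (hN : 2 ≤ N) {α : ℝ} (hα : 0 < α) (hα2 : α ≤ 2) {len : ℕ}
    (hlen : len ≤ 4 * Nat.clog 2 N) :
    ∃ M : ℕ,
      len * ENNReal.ofReal (Real.exp (n / (2 * (Nat.clog 2 N ^ 2 : ℕ) : ℝ) +
        2 * (4 * (2 * (Nat.clog 2 N ^ 2 : ℕ) : ℝ) ^ 2 / α + 1) -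
          (M * (2 * Nat.clog 2 N) : ℕ) / 8)) ≤ ENNReal.ofReal (1 / (16 * N)) ∧
      ((len * (M * (len * (2 * Nat.clog 2 N))) : ℕ) : ℝ) ≤
        64 * n + 6720 * (Nat.clog 2 N ^ 6 / α) := by
  have hL1 : 1 ≤ Nat.clog 2 N := Nat.clog_pos one_lt_two hN
  have hNL : N ≤ 2 ^ Nat.clog 2 N := Nat.le_pow_clog one_lt_two N
  generalize Nat.clog 2 N = L at *
  have hL : (1 : ℝ) ≤ L := by exact_mod_cast hL1
  have hlen' : (len : ℝ) ≤ 4 * L := by exact_mod_cast hlen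
  push_cast
  set E₀ := n / (2 * (L : ℝ) ^ 2) + 2 * (4 * (2 * (L : ℝ) ^ 2) ^ 2 / α + 1) with hE
  have hE0 : 0 ≤ E₀ := by positivity
  set x := 8 * (E₀ + 2 * L + 6) / (2 * L) with hx
  have hx0 : 0 ≤ x := by positivity
  have hx1 : x * (2 * L) = 8 * (E₀ + 2 * L + 6) := by rw [hx]; field_simp
  refine ⟨⌈x⌉₊, ?_, ?_⟩
  · have h1 : x ≤ ⌈x⌉₊ := Nat.le_ceil x
    have h2 : 8 * (E₀ + 2 * L + 6) ≤ ⌈x⌉₊ * (2 * (L : ℝ)) := by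
      rw [← hx1]; gcongr
    rw [← ENNReal.ofReal_natCast, ← ENNReal.ofReal_mul (by positivity)]
    refine ENNReal.ofReal_le_ofReal ?_
    have h3 : Real.exp (E₀ - ⌈x⌉₊ * (2 * (L : ℝ)) / 8) ≤ Real.exp (-(2 * L + 6)) :=
      Real.exp_le_exp.2 (by linarith)
    have h4 : (2 : ℝ) ^ L ≤ Real.exp L := by
      have : (2 : ℝ) ≤ Real.exp 1 := by have := Real.add_one_le_exp (1 : ℝ); linarith
      calc (2 : ℝ) ^ L ≤ Real.exp 1 ^ L := by gcongr
        _ = Real.exp L := by rw [← Real.exp_nat_mul, mul_one]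
    have h5 : (N : ℝ) ≤ Real.exp L := le_trans (by exact_mod_cast hNL) h4
    have h6 : (L : ℝ) ≤ Real.exp L := by have := Real.add_one_le_exp (L : ℝ); linarith
    have h7 : (64 : ℝ) ≤ Real.exp 6 := by
      have : (2 : ℝ) ≤ Real.exp 1 := by have := Real.add_one_le_exp (1 : ℝ); linarith
      calc (64 : ℝ) = 2 ^ 6 := by norm_num
        _ ≤ Real.exp 1 ^ 6 := by gcongr
        _ = Real.exp 6 := by rw [← Real.exp_nat_mul]; norm_num
    have hN0 : (0 : ℝ) < N := by exact_mod_cast (by omega : 0 < N)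
    rw [le_div_iff₀ (by positivity)]
    calc len * Real.exp (E₀ - ⌈x⌉₊ * (2 * (L : ℝ)) / 8) * (16 * N)
        ≤ (4 * L) * Real.exp (-(2 * L + 6)) * (16 * Real.exp L) := by gcongr
      _ = 64 * L * Real.exp L * Real.exp (-(2 * L + 6)) := by ring
      _ ≤ Real.exp 6 * Real.exp L * Real.exp L * Real.exp (-(2 * L + 6)) := by gcongr
      _ = 1 := by
        rw [← Real.exp_add, ← Real.exp_add, ← Real.exp_add]
        convert Real.exp_zero using 2
        ring
  · have h1 : (⌈x⌉₊ : ℝ) ≤ x + 1 := (Nat.ceil_lt_add_one hx0).le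
    have h2 : ⌈x⌉₊ * (2 * (L : ℝ)) ≤ 8 * (E₀ + 2 * L + 6) + 2 * L := by
      rw [← hx1]
      nlinarith
    have h3 : (L : ℝ) ^ 2 * E₀ = n / 2 + 32 * (L ^ 6 / α) + 2 * L ^ 2 := by
      rw [hE]; field_simp; ring
    have h4 : (L : ℝ) ^ 3 ≤ 2 * (L ^ 6 / α) := by
      rw [← mul_div_assoc, le_div_iff₀ hα]
      have h5 : (L : ℝ) ^ 3 ≤ L ^ 6 := pow_le_pow_right₀ hL (by norm_num)
      have h6 : (0 : ℝ) ≤ L ^ 3 := by positivity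
      nlinarith
    have h5 : (L : ℝ) ^ 2 ≤ L ^ 3 := pow_le_pow_right₀ hL (by norm_num)
    calc (len : ℝ) * (⌈x⌉₊ * (len * (2 * L))) = len * len * (⌈x⌉₊ * (2 * L)) := by ring
      _ ≤ (4 * L) * (4 * L) * (8 * (E₀ + 2 * L + 6) + 2 * L) := by gcongr
      _ = 128 * (L ^ 2 * E₀) + 288 * L ^ 3 + 768 * L ^ 2 := by ring
      _ ≤ 64 * n + 6720 * (L ^ 6 / α) := by rw [h3]; linarith

/-- The number of rounds of SharedBit that suffices for moving `k` tokens; note `(7 / 8) ^ 6 ≤ 1 / 2`. -/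
theorem two_pow_mul_seven_eighths_pow_le {N : ℕ} (hN : 2 ≤ N) (k : ℕ) :
    (2 : ℝ≥0∞) ^ k * (7 / 8) ^ (6 * (k + Nat.clog 2 N + 4)) ≤ ENNReal.ofReal (1 / (16 * N)) := by
  have hNL : N ≤ 2 ^ Nat.clog 2 N := Nat.le_pow_clog one_lt_two N
  generalize Nat.clog 2 N = L at *
  have h78 : (7 / 8 : ℝ≥0∞) = ENNReal.ofReal (7 / 8) := by
    rw [ENNReal.ofReal_div_of_pos (by norm_num)]; simp
  have h2 : (2 : ℝ≥0∞) = ENNReal.ofReal 2 := by simp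
  rw [h78, h2, ← ENNReal.ofReal_pow (by norm_num), ← ENNReal.ofReal_pow (by norm_num),
    ← ENNReal.ofReal_mul (by positivity)]
  refine ENNReal.ofReal_le_ofReal ?_
  have hN0 : (0 : ℝ) < N := by exact_mod_cast (by omega : 0 < N)
  have hNL' : (N : ℝ) ≤ 2 ^ L := by exact_mod_cast hNL
  rw [le_div_iff₀ (by positivity)]
  calc (2 : ℝ) ^ k * (7 / 8) ^ (6 * (k + L + 4)) * (16 * N)
      ≤ 2 ^ k * (1 / 2) ^ (k + L + 4) * (16 * 2 ^ L) := by
        rw [pow_mul]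
        gcongr
        norm_num
    _ = 1 := by
      rw [pow_add, pow_add, one_div_pow, one_div_pow]
      field_simp
      norm_num

/-! ### Sampling a small multiset of strings -/

theorem Real.exp_le_one_add_two_mul {x : ℝ} (h0 : 0 ≤ x) (h1 : x ≤ 1) :
    Real.exp x ≤ 1 + 2 * x := by
  have h2 := Real.abs_exp_sub_one_sub_id_le (x := x) (by rwa [abs_of_nonneg h0])
  have h3 := (abs_le.1 h2).2
  nlinarith

/-- A random sample of sufficiently many points is representative for all members of a finite family
of functions: if the average of every function is at most `δ`, some sample has the property that the
average of every function over the sample is at most `4 * δ`. -/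
theorem exists_sample {X I : Type*} [Fintype X] [Nonempty X] [Fintype I] (φ : I → X → ℝ)
    (h0 : ∀ i x, 0 ≤ φ i x) (h1 : ∀ i x, φ i x ≤ 1) {δ : ℝ}
    (hδ : ∀ i, ∑ x, φ i x ≤ δ * Fintype.card X) (m : ℕ)
    (hm : (Fintype.card I : ℝ) < Real.exp (2 * δ * m)) :
    ∃ R : Fin m → X, ∀ i, ∑ j, φ i (R j) ≤ 4 * δ * m := by
  -- compare lower and upper bounds for the exponential moment of a uniformly random sample
  by_contra! hbad
  have hX : (0 : ℝ) < Fintype.card X := by exact_mod_cast Fintype.card_pos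
  have hlow : (Fintype.card X : ℝ) ^ m * Real.exp (4 * δ * m) ≤
      ∑ R : Fin m → X, ∑ i, Real.exp (∑ j, φ i (R j)) := by
    have : (Fintype.card X : ℝ) ^ m * Real.exp (4 * δ * m) =
        ∑ _R : Fin m → X, Real.exp (4 * δ * m) := by simp
    rw [this]
    refine Finset.sum_le_sum fun R _ => ?_
    obtain ⟨i, hi⟩ := hbad R
    exact (Real.exp_le_exp.2 hi.le).trans (Finset.single_le_sum
      (f := fun i => Real.exp (∑ j, φ i (R j))) (fun i _ => (Real.exp_pos _).le)
      (Finset.mem_univ i))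
  have hup : ∑ R : Fin m → X, ∑ i, Real.exp (∑ j, φ i (R j)) ≤
      Fintype.card I * ((Fintype.card X : ℝ) ^ m * Real.exp (2 * δ * m)) := by
    rw [Finset.sum_comm, ← nsmul_eq_mul, ← Finset.card_univ, ← Finset.sum_const]
    refine Finset.sum_le_sum fun i _ => ?_
    simp only [Real.exp_sum]
    rw [← Fintype.sum_pow (fun x => Real.exp (φ i x)) m]
    have h2 : ∑ x, Real.exp (φ i x) ≤ Fintype.card X * Real.exp (2 * δ) := by
      calc ∑ x, Real.exp (φ i x) ≤ ∑ x, (1 + 2 * φ i x) :=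
            Finset.sum_le_sum fun x _ => Real.exp_le_one_add_two_mul (h0 i x) (h1 i x)
        _ = Fintype.card X + 2 * ∑ x, φ i x := by
            rw [Finset.sum_add_distrib, ← Finset.mul_sum]; simp
        _ ≤ Fintype.card X * (2 * δ + 1) := by linarith [hδ i]
        _ ≤ _ := by gcongr; exact Real.add_one_le_exp _
    calc (∑ x, Real.exp (φ i x)) ^ m ≤ (Fintype.card X * Real.exp (2 * δ)) ^ m :=
          pow_le_pow_left₀ (Finset.sum_nonneg fun x _ => (Real.exp_pos _).le) h2 m
      _ = _ := by
          rw [mul_pow, ← Real.exp_nat_mul]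
          congr 2
          ring
  have h3 := hlow.trans hup
  rw [mul_left_comm] at h3
  have h4 : Real.exp (4 * δ * m) = Real.exp (2 * δ * m) * Real.exp (2 * δ * m) := by
    rw [← Real.exp_add]; congr 1; ring
  rw [h4] at h3
  have h5 := le_of_mul_le_mul_left h3 (pow_pos hX m)
  have h6 := le_of_mul_le_mul_right h5 (Real.exp_pos _)
  linarith

section Instances

variable {P : SSBConstants} {mode : IdMode} {N : ℕ} [NeZero N]

/-- The failure probability of gossip by time `t`, with initial identifiers `ids`, when the string
selected by the node with UID `j` is `y j`. -/
noncomputable def failProb (P : SSBConstants) (mode : IdMode) {n : ℕ} (uid : Fin n → Fin N)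
    (G : ℕ → SimpleGraph (Fin n)) (T₀ : Fin n → Finset (Fin N)) (ids : Fin n → ℕ)
    (y : Fin N → SharedString P N) (t : ℕ) : ℝ≥0∞ :=
  (ssbLaw P mode y uid G (ssbInit ids uid T₀) t).expect (gossipFails T₀)

theorem failProb_le_one {n : ℕ} (uid : Fin n → Fin N)
    (G : ℕ → SimpleGraph (Fin n)) (T₀ : Fin n → Finset (Fin N)) (ids : Fin n → ℕ)
    (y : Fin N → SharedString P N) (t : ℕ) : failProb P mode uid G T₀ ids y t ≤ 1 :=
  PMF.expect_le_of_le fun σ _ => gossipFails_le_one σ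

/-- Everything on which the failure probability by a time at most `Tm`, as a function of the string
of one node, depends: the number of nodes, the UIDs, the topologies, the initial tokens, the
identifiers, the strings, the UID of the distinguished node, and the time.  Functions on `[n]` are
extended to `[N]`. -/
abbrev InstanceCode (P : SSBConstants) (mode : IdMode) (N Tm : ℕ) : Type :=
  Fin (N + 1) × (Fin N → Fin N) × (Fin Tm → Fin N → Fin N → Bool) × (Fin N → Finset (Fin N)) ×
    (Fin N → Fin (2 ^ P.idBits N mode)) × (Fin N → SharedString P N) × Fin N × Fin (Tm + 1)

/-- The failure probability of an encoded instance as a function of one string. -/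
noncomputable def codeFailProb {Tm : ℕ} (c : InstanceCode P mode N Tm) (x : SharedString P N) :
    ℝ≥0∞ :=
  let emb : Fin c.1.val → Fin N := Fin.castLE (Nat.le_of_lt_succ c.1.2)
  failProb P mode (fun v => c.2.1 (emb v))
    (fun i => if h : i < Tm then
      SimpleGraph.fromRel fun a b => c.2.2.1 ⟨i, h⟩ (emb a) (emb b) = true else ⊥)
    (fun v => c.2.2.2.1 (emb v)) (fun v => (c.2.2.2.2.1 (emb v)).val)
    (Function.update c.2.2.2.2.2.1 c.2.2.2.2.2.2.1 x) c.2.2.2.2.2.2.2.val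

/-- Every instance has a code.  Topologies after the time `t` do not matter. -/
theorem exists_code {n : ℕ} (hn : n ≤ N) {Tm t : ℕ} (ht : t ≤ Tm) (uid : Fin n → Fin N)
    (G : ℕ → SimpleGraph (Fin n)) (T₀ : Fin n → Finset (Fin N)) {ids : Fin n → ℕ}
    (hids : ∀ v, ids v < 2 ^ P.idBits N mode) (y : Fin N → SharedString P N) (j : Fin N) :
    ∃ c : InstanceCode P mode N Tm, ∀ x,
      codeFailProb c x = failProb P mode uid G T₀ ids (Function.update y j x) t := by
  classical
  refine ⟨⟨⟨n, Nat.lt_succ_of_le hn⟩, fun k => if h : k.val < n then uid ⟨k, h⟩ else 0,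
    fun i a b => if h : a.val < n ∧ b.val < n then decide ((G i).Adj ⟨a, h.1⟩ ⟨b, h.2⟩) else false,
    fun k => if h : k.val < n then T₀ ⟨k, h⟩ else ∅,
    fun k => if h : k.val < n then ⟨ids ⟨k, h⟩, hids _⟩ else ⟨0, by positivity⟩, y, j,
    ⟨t, Nat.lt_succ_of_le ht⟩⟩, fun x => ?_⟩
  simp only [codeFailProb, Fin.val_castLE, Fin.is_lt, dite_true, and_self, Fin.eta,
    decide_eq_true_eq]
  unfold failProb
  congr 1
  refine MTMAlgorithm.lawFrom_congr _ _ _ fun i hi => ?_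
  rw [dif_pos (hi.trans_le ht)]
  ext a b
  simp only [SimpleGraph.fromRel_adj]
  constructor
  · rintro ⟨-, h | h⟩
    · exact h
    · exact h.symm
  · intro h
    exact ⟨h.ne, Or.inl h⟩

omit [NeZero N] in
/-- There are so few codes that a union bound over all of them is possible for `N ^ 32` samples. -/
theorem card_instanceCode_lt (hN : 2 ≤ N) (hc : P.c = 70) (hcBC : P.cBC = 6780) (hβ : P.β = 4) :
    (Fintype.card (InstanceCode P mode N (2 * P.groups N)) : ℝ) <
      Real.exp (2 * (1 / (8 * N)) * (N ^ 32 : ℕ)) := by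
  have : NeZero N := ⟨by omega⟩
  set g := P.groups N with hg
  set len := P.idBits N mode with hlen
  set L := Nat.clog 2 N with hL
  have hLN : L ≤ N := Nat.clog_le_of_le_pow Nat.lt_two_pow_self.le
  have hlenN : len ≤ 4 * N := by
    cases mode <;> simp only [hlen, SSBConstants.idBits, hβ] <;> omega
  have hgN : g ≤ 6850 * N ^ 8 := by
    simp only [hg, SSBConstants.groups, hc, hcBC]
    calc 70 * N ^ 2 + 6780 * N ^ 2 * L ^ 6 ≤ 70 * N ^ 8 + 6780 * N ^ 2 * N ^ 6 := by
          gcongr <;> omega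
      _ = 6850 * N ^ 8 := by ring
  have hcard : Fintype.card (InstanceCode P mode N (2 * g)) ≤ 2 ^ (N ^ 28) := by
    have hle : Fintype.card (InstanceCode P mode N (2 * g)) =
        (N + 1) * (N ^ N * (((2 ^ N) ^ N) ^ (2 * g) * ((2 ^ N) ^ N * ((2 ^ len) ^ N *
          ((((2 ^ (L + 1)) ^ N) ^ g) ^ N * (N * (2 * g + 1))))))) := by
      simp [InstanceCode, SharedString, hlen, hg, hL]
    rw [hle]
    have h2N : N + 1 ≤ 2 ^ N := Nat.lt_two_pow_self
    have h2N' : N ≤ 2 ^ N := Nat.lt_two_pow_self.le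
    have h2g : 2 * g + 1 ≤ 2 ^ (2 * g) := Nat.lt_two_pow_self
    calc _ ≤ 2 ^ N * ((2 ^ N) ^ N * (((2 ^ N) ^ N) ^ (2 * g) * ((2 ^ N) ^ N * ((2 ^ len) ^ N *
          ((((2 ^ (L + 1)) ^ N) ^ g) ^ N * (2 ^ N * 2 ^ (2 * g))))))) := by gcongr
      _ = 2 ^ (N + (N * N + (N * N * (2 * g) + (N * N + (len * N +
          ((L + 1) * N * g * N + (N + 2 * g))))))) := by
          simp only [← pow_mul, ← pow_add]
      _ ≤ 2 ^ (N ^ 28) := by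
          refine Nat.pow_le_pow_right two_pos ?_
          have hN3 : 1 ≤ N := by omega
          have e1 : N ≤ N ^ 11 := Nat.le_self_pow (by norm_num) N
          have e2 : N * N ≤ N ^ 11 := by
            rw [← sq]; exact Nat.pow_le_pow_right hN3 (by norm_num)
          have e8 : N ^ 8 ≤ N ^ 11 := Nat.pow_le_pow_right hN3 (by norm_num)
          have e10 : N ^ 10 ≤ N ^ 11 := Nat.pow_le_pow_right hN3 (by norm_num)
          have e3 : N * N * (2 * g) ≤ 13700 * N ^ 11 := by
            calc N * N * (2 * g) ≤ N * N * (2 * (6850 * N ^ 8)) := by gcongr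
              _ = 13700 * N ^ 10 := by ring
              _ ≤ _ := by omega
          have e4 : len * N ≤ 4 * N ^ 11 := by
            calc len * N ≤ 4 * N * N := by gcongr
              _ = 4 * (N * N) := by ring
              _ ≤ _ := by omega
          have e5 : (L + 1) * N * g * N ≤ 13700 * N ^ 11 := by
            calc (L + 1) * N * g * N ≤ (N + N) * N * (6850 * N ^ 8) * N := by gcongr
              _ = 13700 * N ^ 11 := by ring
          have e6 : 2 ^ 17 * N ^ 11 ≤ N ^ 28 := by
            calc 2 ^ 17 * N ^ 11 ≤ N ^ 17 * N ^ 11 := by gcongr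
              _ = N ^ 28 := by ring
          omega
  have hNr : (2 : ℝ) ≤ N := by exact_mod_cast hN
  calc (Fintype.card (InstanceCode P mode N (2 * g)) : ℝ) ≤ 2 ^ (N ^ 28) := by exact_mod_cast hcard
    _ < Real.exp 1 ^ (N ^ 28) := by
        refine pow_lt_pow_left₀ ?_ (by norm_num) (by positivity)
        have := Real.add_one_lt_exp (x := (1 : ℝ)) (by norm_num)
        linarith
    _ = Real.exp ((N : ℝ) ^ 28) := by rw [← Real.exp_nat_mul, mul_one]; push_cast; rfl
    _ ≤ _ := by
        refine Real.exp_le_exp.2 ?_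
        have h1 : 2 * (1 / (8 * (N : ℝ))) * ((N ^ 32 : ℕ) : ℝ) = N ^ 28 * (N ^ 3 / 4) := by
          push_cast; field_simp; ring
        rw [h1]
        have h2 : (2 : ℝ) ^ 3 ≤ N ^ 3 := by gcongr
        nlinarith [pow_pos (by linarith : (0 : ℝ) < N) 28]

/-- There is a small multiset of strings which is almost as good as a random string for all instances
in which a random string is good. -/
theorem exists_strings (hN : 2 ≤ N) (hc : P.c = 70) (hcBC : P.cBC = 6780) (hβ : P.β = 4) :
    ∃ R : Fin (N ^ 32) → SharedString P N, ∀ c : InstanceCode P mode N (2 * P.groups N),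
      (PMF.uniformOfFintype (SharedString P N)).expect (codeFailProb c) ≤
        ENNReal.ofReal (1 / (8 * N)) →
      ∑ j, codeFailProb c (R j) ≤ ENNReal.ofReal (1 / (2 * N)) * (N ^ 32 : ℕ) := by
  classical
  have hN0 : (0 : ℝ) < N := by exact_mod_cast (by omega : 0 < N)
  have hle1 : ∀ (c : InstanceCode P mode N (2 * P.groups N)) x, codeFailProb c x ≤ 1 :=
    fun c x => failProb_le_one _ _ _ _ _ _
  have hfin : ∀ (c : InstanceCode P mode N (2 * P.groups N)) x, codeFailProb c x ≠ ∞ :=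
    fun c x => ne_top_of_le_ne_top ENNReal.one_ne_top (hle1 c x)
  let good : InstanceCode P mode N (2 * P.groups N) → Prop := fun c =>
    (PMF.uniformOfFintype (SharedString P N)).expect (codeFailProb c) ≤ ENNReal.ofReal (1 / (8 * N))
  obtain ⟨R, hR⟩ := exists_sample
    (fun c x => if good c then (codeFailProb c x).toReal else 0)
    (fun c x => by split_ifs <;> simp)
    (fun c x => by
      split_ifs
      · exact ENNReal.toReal_le_of_le_ofReal zero_le_one (by simpa using hle1 c x)
      · exact zero_le_one)
    (δ := 1 / (8 * N))
    (fun c => by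
      split_ifs with hgood
      · have h1 := hgood
        simp only [good] at h1
        rw [PMF.expect_uniformOfFintype] at h1
        rw [← ENNReal.toReal_sum fun x _ => hfin c x]
        refine ENNReal.toReal_le_of_le_ofReal (by positivity) ?_
        rw [ENNReal.ofReal_mul (by positivity), ENNReal.ofReal_natCast]
        rwa [ENNReal.div_le_iff (by simp) (by simp)] at h1
      · simp only [Finset.sum_const_zero]
        positivity)
    (N ^ 32) (card_instanceCode_lt hN hc hcBC hβ)
  refine ⟨R, fun c hgood => ?_⟩
  have h1 := hR c
  simp only [if_pos (show good c from hgood)] at h1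
  rw [← ENNReal.toReal_sum fun x _ => hfin c _] at h1
  have h2 := (ENNReal.le_ofReal_iff_toReal_le (ENNReal.sum_ne_top.2 fun j _ => hfin c _)
    (by positivity)).2 h1
  refine h2.trans_eq ?_
  rw [ENNReal.ofReal_mul (by positivity), ENNReal.ofReal_natCast]
  congr 2
  field_simp
  norm_num

end Instances

/-! ### Random identifiers and seeds -/

/-- A random family of pairs consists of two independent random families. -/
theorem PMF.expect_uniformOfFintype_arrow_prod {ι α β : Type} [Fintype ι] [DecidableEq ι]
    [Fintype α] [Nonempty α] [Fintype β] [Nonempty β] (f : (ι → α × β) → ℝ≥0∞) :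
    (PMF.uniformOfFintype (ι → α × β)).expect f =
      (PMF.uniformOfFintype (ι → α)).expect fun a => (PMF.uniformOfFintype (ι → β)).expect fun b =>
        f fun i => (a i, b i) := by
  simp only [PMF.expect_uniformOfFintype, ENNReal.div_eq_inv_mul, ← Finset.mul_sum]
  rw [← mul_assoc, ← Fintype.sum_prod_type',
    ← (Equiv.arrowProdEquivProdArrow ι (fun _ => α) fun _ => β).symm.sum_comp f]
  congr 1
  rw [← ENNReal.mul_inv (by simp) (by simp)]
  congr 1
  simp [mul_pow]

open Classical in
/-- Uniformly random tags are distinct with high probability. -/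
theorem expect_not_injective_le {V : Type} [Fintype V] [DecidableEq V] {D : ℕ} [NeZero D] :
    ((PMF.uniformOfFintype (V → Fin D)).expect fun a =>
      if Function.Injective a then 0 else 1) ≤ (Fintype.card V * Fintype.card V : ℕ) / D := by
  have h1 : ∀ a : V → Fin D, (if Function.Injective a then (0 : ℝ≥0∞) else 1) ≤
      ∑ q : V × V, if q.1 ≠ q.2 ∧ a q.1 = a q.2 then 1 else 0 := by
    intro a
    split_ifs with h
    · exact zero_le
    · simp only [Function.Injective, not_forall] at h
      obtain ⟨u, v, huv, hne⟩ := h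
      refine le_trans ?_ (Finset.single_le_sum (fun _ _ => zero_le) (Finset.mem_univ (u, v)))
      rw [if_pos ⟨hne, huv⟩]
  refine (PMF.expect_mono h1).trans ?_
  rw [PMF.expect_finsetSum]
  have h2 : ∀ q : V × V, ((PMF.uniformOfFintype (V → Fin D)).expect fun a =>
      if q.1 ≠ q.2 ∧ a q.1 = a q.2 then 1 else 0) ≤ 1 / D := by
    rintro ⟨u, v⟩
    rw [← PMF.expect_resample_univ u]
    refine PMF.expect_le_of_le fun a _ => ?_
    rw [PMF.expect_uniformOfFintype, Fintype.card_fin]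
    refine ENNReal.div_le_div_right ?_ _
    calc _ ≤ ∑ x : Fin D, if x = a v then (1 : ℝ≥0∞) else 0 := by
          refine Finset.sum_le_sum fun x _ => ?_
          split_ifs with h3 h4 h4
          · exact le_rfl
          · refine absurd ?_ h4
            rw [Function.update_self, Function.update_of_ne h3.1.symm] at h3
            exact h3.2
          · exact zero_le
          · exact le_rfl
      _ = 1 := by simp
  refine (Finset.sum_le_sum fun q _ => h2 q).trans_eq ?_
  simp [ENNReal.div_eq_inv_mul, mul_comm]

theorem extend_update {α β γ : Type} [DecidableEq α] [DecidableEq β] {f : α → β}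
    (hf : Function.Injective f) (s : α → γ) (e : β → γ) (a : α) (c : γ) :
    Function.extend f (Function.update s a c) e =
      Function.update (Function.extend f s e) (f a) c := by
  funext k
  by_cases hk : ∃ a', f a' = k
  · obtain ⟨a', rfl⟩ := hk
    rw [hf.extend_apply]
    by_cases h : a' = a
    · subst h; simp
    · rw [Function.update_of_ne h, Function.update_of_ne (hf.ne h), hf.extend_apply]
  · rw [Function.extend_apply' _ _ _ hk, Function.update_of_ne, Function.extend_apply' _ _ _ hk]
    rintro rfl
    exact hk ⟨a, rfl⟩

section Identifiers

variable {P : SSBConstants} {mode : IdMode} {N : ℕ} [NeZero N]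

/-- The identifier of the node with UID `u` whose random tag is `a`. -/
def identifier (mode : IdMode) {D : ℕ} (u : Fin N) (a : Fin D) : ℕ :=
  match mode with
  | .uid => u.val
  | .randomTag => a.val

omit [NeZero N] in
theorem identifier_lt (u : Fin N) (a : Fin (2 ^ P.idBits N mode)) :
    identifier mode u a < 2 ^ P.idBits N mode := by
  cases mode with
  | uid => exact u.2.trans_le (Nat.le_pow_clog one_lt_two N)
  | randomTag => exact a.2

/-- The failure probability of SimSharedBit, averaged over the identifiers, in terms of the strings
that the nodes select by their seeds. -/
theorem expect_law_gossipFails {m : ℕ} [NeZero m] (R : Fin m → SharedString P N) {n : ℕ}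
    {uid : Fin n → Fin N} (huid : Function.Injective uid) (G : ℕ → SimpleGraph (Fin n))
    (T₀ : Fin n → Finset (Fin N)) (t : ℕ) :
    PMF.expect ((simSharedBit P mode R).law uid G T₀ t) (gossipFails T₀) =
      (PMF.uniformOfFintype (Fin n → Fin (2 ^ P.idBits N mode))).expect fun a =>
        (PMF.uniformOfFintype (Fin n → Fin m)).expect fun s =>
          failProb P mode uid G T₀ (fun v => identifier mode (uid v) (a v))
            (fun k => R (Function.extend uid s (fun _ => 0) k)) t := by
  rw [MTMAlgorithm.law_eq_bind_lawFrom]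
  refine (PMF.expect_bind _ _ _).trans ((PMF.expect_uniformOfFintype_arrow_prod _).trans ?_)
  refine congrArg _ (funext fun a => congrArg _ (funext fun s => ?_))
  set S : Fin N → Fin m := Function.extend uid s fun _ => 0 with hS
  have hinit : (fun v => (simSharedBit P mode R).init (uid v) (T₀ v) (a v, s v)) =
      fun v => (ssbInit (fun v => identifier mode (uid v) (a v)) uid T₀ v).mapSeed S := by
    funext v
    simp only [simSharedBit, SSBState.mapSeed, ssbInit, hS, huid.extend_apply]
    cases mode <;> rfl
  have h1 := ssbLaw_mapSeed (P := P) (mode := mode) (R := R) (uid := uid) (G := G) S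
    (ssbInit (fun v => identifier mode (uid v) (a v)) uid T₀) t
  rw [← hinit] at h1
  exact (congrArg (fun p => PMF.expect p (gossipFails T₀)) h1).trans (PMF.expect_map _ _ _)

/-- For distinct identifiers, only the seed of the node with the smallest one matters. -/
theorem expect_seeds_failProb_le {m : ℕ} [NeZero m] {R : Fin m → SharedString P N} {n : ℕ}
    {uid : Fin n → Fin N} (huid : Function.Injective uid) {G : ℕ → SimpleGraph (Fin n)}
    {T₀ : Fin n → Finset (Fin N)} {ids : Fin n → ℕ} {t : ℕ} (ℓ : Fin n) {c : ℝ≥0∞}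
    (h : ∀ y : Fin N → SharedString P N,
      ∑ j, failProb P mode uid G T₀ ids (Function.update y (uid ℓ) (R j)) t ≤ c * m) :
    ((PMF.uniformOfFintype (Fin n → Fin m)).expect fun s =>
      failProb P mode uid G T₀ ids (fun k => R (Function.extend uid s (fun _ => 0) k)) t) ≤ c := by
  rw [← PMF.expect_resample_univ ℓ]
  refine PMF.expect_le_of_le fun s _ => ?_
  rw [PMF.expect_uniformOfFintype, Fintype.card_fin,
    ENNReal.div_le_iff (by simpa using NeZero.ne m) (by simp)]
  refine le_trans (le_of_eq (Finset.sum_congr rfl fun j _ => ?_))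
    (h fun k => R (Function.extend uid s (fun _ => 0) k))
  congr 1
  funext k
  rw [extend_update huid]
  by_cases hk : k = uid ℓ
  · subst hk; simp
  · rw [Function.update_of_ne hk, Function.update_of_ne hk]

omit [NeZero N] in
open Classical in
/-- Random tags from a range of size `N ^ 4` are distinct with high probability. -/
theorem expect_val_not_injective_le {n D : ℕ} [NeZero D] (hN : 2 ≤ N) (hn : n ≤ N)
    (hD : N ^ 4 ≤ D) :
    ((PMF.uniformOfFintype (Fin n → Fin D)).expect fun a =>
      if Function.Injective fun v => (a v).val then 0 else 1) ≤ ENNReal.ofReal (1 / (2 * N)) := by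
  refine le_trans (PMF.expect_mono fun a => ?_)
    ((expect_not_injective_le (V := Fin n) (D := D)).trans ?_)
  · split_ifs with h1 h2
    · exact zero_le
    · exact zero_le
    · exact absurd (Fin.val_injective.comp ‹_›) h1
    · exact le_rfl
  have hN0 : (0 : ℝ) < N := by exact_mod_cast (by omega : 0 < N)
  have hDr : (N : ℝ) ^ 4 ≤ (D : ℝ) := by exact_mod_cast hD
  have hD0 : (0 : ℝ) < (D : ℝ) := lt_of_lt_of_le (by positivity) hDr
  rw [Fintype.card_fin, ← ENNReal.ofReal_natCast, ← ENNReal.ofReal_natCast D,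
    ← ENNReal.ofReal_div_of_pos hD0]
  refine ENNReal.ofReal_le_ofReal ?_
  have hnr : (n : ℝ) ≤ N := by exact_mod_cast hn
  have hNr : (2 : ℝ) ≤ N := by exact_mod_cast hN
  rw [div_le_div_iff₀ hD0 (by positivity)]
  calc ((n * n : ℕ) : ℝ) * (2 * N) ≤ N * N * (N * N) := by
        push_cast; gcongr
    _ = N ^ 4 := by ring
    _ ≤ _ := by rw [one_mul]; exact hDr

omit [NeZero N] in
open Classical in
/-- In both variants, the identifiers are distinct with high probability. -/
theorem expect_identifier_not_injective_le (hN : 2 ≤ N) (hβ : P.β = 4) {n : ℕ} (hn : n ≤ N)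
    {uid : Fin n → Fin N} (huid : Function.Injective uid) :
    ((PMF.uniformOfFintype (Fin n → Fin (2 ^ P.idBits N mode))).expect fun a =>
      if Function.Injective fun v => identifier mode (uid v) (a v) then 0 else 1) ≤
      ENNReal.ofReal (1 / (2 * N)) := by
  cases mode with
  | uid =>
    refine PMF.expect_le_of_le fun a _ => ?_
    rw [if_pos]
    · exact zero_le
    · exact Fin.val_injective.comp huid
  | randomTag =>
    have hD : N ^ 4 ≤ 2 ^ P.idBits N .randomTag := by
      simp only [SSBConstants.idBits, hβ]
      rw [mul_comm, pow_mul]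
      exact Nat.pow_le_pow_left (Nat.le_pow_clog one_lt_two N) 4
    exact expect_val_not_injective_le hN hn hD

end Identifiers

/-! ### Gossip in time -/

section Gossip

variable {P : SSBConstants} {mode : IdMode} {N : ℕ} [NeZero N]

/-- If the string of the leader is uniformly random, all tokens are spread in time. -/
theorem exists_time (hN : 2 ≤ N) (hc : P.c = 70) (hcBC : P.cBC = 6780) (hβ : P.β = 4) {n : ℕ}
    (hn2 : 2 ≤ n) (hn : n ≤ N) {uid : Fin n → Fin N} (huid : Function.Injective uid)
    {G : ℕ → SimpleGraph (Fin n)} (hG : ∀ i, (G i).Connected) (T₀ : Fin n → Finset (Fin N))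
    (hk : 1 ≤ (Finset.univ.biUnion T₀).card) :
    ∃ t ≤ 2 * P.groups N,
      (t : ℝ) ≤ 10 ^ 6 * (((Finset.univ.biUnion T₀).card : ℝ) * n +
        1 / dynExpansion G * Real.logb 2 N ^ 6) ∧
      ∀ ids : Fin n → ℕ, Function.Injective ids → (∀ v, ids v < 2 ^ P.idBits N mode) →
      ∀ ℓ, (∀ w, ids ℓ ≤ ids w) → ∀ y : Fin N → SharedString P N,
        ((PMF.uniformOfFintype (SharedString P N)).expect fun x =>
          failProb P mode uid G T₀ ids (Function.update y (uid ℓ) x) t) ≤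
          ENNReal.ofReal (1 / (8 * N)) := by
  set k := (Finset.univ.biUnion T₀).card with hkdef
  set α := dynExpansion G with hαdef
  set L := Nat.clog 2 N with hL
  set len := P.idBits N mode with hlendef
  have hV : 2 ≤ Fintype.card (Fin n) := by simpa using hn2
  have hn0 : (0 : ℝ) < n := by exact_mod_cast (by omega : 0 < n)
  have hαn : 1 / (n : ℝ) ≤ α := by simpa using inv_card_le_dynExpansion hV hG
  have hα : 0 < α := lt_of_lt_of_le (by positivity) hαn
  have hα2 : α ≤ 2 := (dynExpansion_le G 0).trans (vertexExpansion_le_two hV _)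
  have hL1 : 1 ≤ L := Nat.clog_pos one_lt_two hN
  have hlen : len ≤ 4 * L := by
    cases mode <;> simp only [hlendef, SSBConstants.idBits, hβ] <;> omega
  obtain ⟨M, hM1, hM2⟩ := exists_phases (n := n) hN hα hα2 hlen
  set t₁ := len * (M * (len * (2 * L))) with ht₁
  set u := 6 * (n * k + L + 4) with hu
  have hkN : k ≤ N := (Finset.card_le_univ _).trans_eq (Fintype.card_fin N)
  have hLr : (1 : ℝ) ≤ L := by exact_mod_cast hL1
  have hkr : (1 : ℝ) ≤ k := by exact_mod_cast hk
  have hA : (L : ℝ) ≤ 2 * (L ^ 6 / α) := by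
    rw [← mul_div_assoc, le_div_iff₀ hα]
    have h1 : (L : ℝ) ≤ L ^ 6 := le_self_pow₀ hLr (by norm_num)
    nlinarith
  have htot : ((t₁ + u : ℕ) : ℝ) ≤ 70 * (k * n) + 6780 * (L ^ 6 / α) := by
    have h1 : (n : ℝ) ≤ k * n := le_mul_of_one_le_left hn0.le hkr
    rw [← hL] at hM2
    rw [hu]
    push_cast
    linarith
  -- SharedBit does not run out of groups before that time
  have hgroups : t₁ + u ≤ P.groups N := by
    have h1 : (L : ℝ) ^ 6 / α ≤ N ^ 2 * L ^ 6 := by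
      rw [div_le_iff₀ hα]
      have h2 : (n : ℝ) ≤ N := by exact_mod_cast hn
      have h3 : 1 ≤ (N : ℝ) ^ 2 * α := by
        calc (1 : ℝ) ≤ n := by exact_mod_cast (by omega : 1 ≤ n)
          _ = n ^ 2 * (1 / n) := by field_simp
          _ ≤ N ^ 2 * α := by gcongr
      calc (L : ℝ) ^ 6 = L ^ 6 * 1 := by ring
        _ ≤ L ^ 6 * (N ^ 2 * α) := by gcongr
        _ = _ := by ring
    have h2 : (k : ℝ) * n ≤ N ^ 2 := by
      rw [sq]
      exact_mod_cast Nat.mul_le_mul hkN hn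
    have h3 : ((t₁ + u : ℕ) : ℝ) ≤ ((70 * N ^ 2 + 6780 * N ^ 2 * L ^ 6 : ℕ) : ℝ) := by
      refine htot.trans ?_
      push_cast
      linarith
    rw [SSBConstants.groups, hc, hcBC]
    exact_mod_cast h3
  refine ⟨2 * (t₁ + u), by omega, ?_, ?_⟩
  · have h1 : (L : ℝ) ^ 6 ≤ 64 * Real.logb 2 N ^ 6 := by
      calc (L : ℝ) ^ 6 ≤ (2 * Real.logb 2 N) ^ 6 := by
            gcongr
            exact clog_le_two_mul_logb hN
        _ = _ := by ring
    have h2 : (L : ℝ) ^ 6 / α ≤ 64 * (1 / α * Real.logb 2 N ^ 6) := by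
      rw [div_le_iff₀ hα]
      refine h1.trans_eq ?_
      field_simp
    have h3 : (0 : ℝ) ≤ k * n := by positivity
    have h4 : (0 : ℝ) ≤ 1 / α * Real.logb 2 N ^ 6 := by
      have : (0 : ℝ) ≤ L ^ 6 / α := by positivity
      linarith
    calc ((2 * (t₁ + u) : ℕ) : ℝ) = 2 * ((t₁ + u : ℕ) : ℝ) := by push_cast; ring
      _ ≤ _ := by linarith
  · intro ids hids hidlt ℓ hℓ y
    have h1 := expect_string_gossipFails_le (T₀ := T₀) hN y hV huid hids hG hα hℓ hidlt
      (q := L ^ 2) (Nat.one_le_pow _ _ hL1) M u hgroups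
    refine h1.trans ?_
    rw [Fintype.card_fin]
    refine (add_le_add hM1 (two_pow_mul_seven_eighths_pow_le hN (n * k))).trans_eq ?_
    rw [← ENNReal.ofReal_add (by positivity) (by positivity)]
    congr 1
    field_simp
    norm_num

end Gossip

theorem one_le_dynMaxDegree {V : Type} [Fintype V] (hV : 2 ≤ Fintype.card V)
    {G : ℕ → SimpleGraph V} (hG : ∀ i, (G i).Connected) : 1 ≤ dynMaxDegree G := by
  classical
  have hbdd : BddAbove (Set.range fun i => (G i).maxDegree) := by
    refine ⟨Fintype.card V, ?_⟩
    rintro _ ⟨i, rfl⟩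
    exact (G i).maxDegree_le_of_forall_degree_le _ fun v => (G i).degree_lt_card_verts v |>.le
  have : Nontrivial V := Fintype.one_lt_card_iff_nontrivial.1 hV
  obtain ⟨v⟩ : Nonempty V := inferInstance
  have h1 : 1 ≤ (G 0).maxDegree :=
    ((hG 0).preconnected.degree_pos_of_nontrivial v).trans_le ((G 0).degree_le_maxDegree v)
  refine h1.trans ?_
  unfold dynMaxDegree
  convert le_ciSup hbdd 0

theorem stabilityExponent_nonneg (τ : ℕ∞) : 0 ≤ stabilityExponent τ := by
  cases τ with
  | top => exact le_rfl
  | coe τ => exact div_nonneg zero_le_one (Nat.cast_nonneg τ)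

theorem mainTheorem1 :
    ∃ (P : SSBConstants) (C : ℝ) (d₁ d₂ : ℕ), 0 < C ∧ 1 ≤ d₁ ∧
      ∀ (mode : IdMode) (N : ℕ), 2 ≤ N →
        ∃ (m : ℕ) (_ : NeZero m) (R : Fin m → SharedString P N),
          N ^ d₁ ≤ m ∧ m ≤ N ^ d₂ ∧
          ∀ (n : ℕ), 2 ≤ n →
          ∀ (uid : Fin n → Fin N), Function.Injective uid →
          ∀ (τ : ℕ∞), 1 ≤ τ →
          ∀ (G : ℕ → SimpleGraph (Fin n)), (∀ i, (G i).Connected) → IsStable G τ →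
          ∀ (T₀ : Fin n → Finset (Fin N)),
            (∀ u v, u ≠ v → Disjoint (T₀ u) (T₀ v)) →
            (simSharedBit P mode R).SolvesGossipBy uid G T₀
              (C * (((Finset.univ.biUnion T₀).card : ℝ) * (n : ℝ) +
                1 / dynExpansion G * (dynMaxDegree G : ℝ) ^ stabilityExponent τ *
                  Real.logb 2 (N : ℝ) ^ 6)) := by
  classical
  refine ⟨⟨70, 6780, 4, 1, by norm_num, by norm_num, by norm_num, le_rfl⟩, 10 ^ 6, 32, 32,
    by norm_num, by norm_num, fun mode N hN => ?_⟩
  set P : SSBConstants := ⟨70, 6780, 4, 1, by norm_num, by norm_num, by norm_num, le_rfl⟩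
  have hN0 : NeZero N := ⟨by omega⟩
  obtain ⟨R, hR⟩ := exists_strings (P := P) (mode := mode) hN rfl rfl rfl
  refine ⟨N ^ 32, inferInstance, R, le_rfl, le_rfl,
    fun n hn2 uid huid τ _ G hG _ T₀ _ t hft => ?_⟩
  have hn : n ≤ N := by simpa using Fintype.card_le_of_injective uid huid
  set A := simSharedBit P mode R with hAdef
  -- a failure probability is easier to average than a success probability
  suffices hfail : PMF.expect (A.law uid G T₀ t) (gossipFails T₀) ≤ 1 / (Fintype.card (Fin n)) by
    rw [PMF.toOuterMeasure_eq_expect]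
    refine tsub_le_iff_right.2 ?_
    refine le_trans ?_ (add_le_add_right hfail _)
    refine le_trans ?_ (PMF.expect_add _ _ _).le
    refine (PMF.expect_const _ 1).symm.trans_le (PMF.expect_mono fun σ => ?_)
    by_cases h : ∀ v w, T₀ w ⊆ A.tokens (σ v)
    · exact le_trans (Set.indicator_of_mem (s := {σ : Fin n → A.State |
        ∀ v w, T₀ w ⊆ A.tokens (σ v)}) h fun _ => (1 : ℝ≥0∞)).ge le_self_add
    · exact le_trans (if_neg h : gossipFails T₀ σ = 1).ge le_add_self
  rw [expect_law_gossipFails R huid]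
  rcases Nat.eq_zero_or_pos (Finset.univ.biUnion T₀).card with hk | hk
  -- If there are no tokens, nothing can fail.  Otherwise `n ≤ k * n`, so that the time `O(n)` needed
  -- for the leader election is covered.
  · refine PMF.expect_le_of_le fun a _ => PMF.expect_le_of_le fun s _ =>
      PMF.expect_le_of_le fun σ _ => ?_
    rw [gossipFails, if_pos]
    · exact zero_le
    · intro v w
      rw [Finset.card_eq_zero] at hk
      exact (Finset.subset_biUnion_of_mem T₀ (Finset.mem_univ w)).trans (by simp [hk])
  obtain ⟨t₀, ht₀, ht₀f, hstr⟩ :=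
    exists_time (P := P) (mode := mode) hN rfl rfl rfl hn2 hn huid hG T₀ hk
  have hV : 2 ≤ Fintype.card (Fin n) := by simpa using hn2
  have htt : t₀ ≤ t := by
    have h1 : (1 : ℝ) ≤ (dynMaxDegree G : ℝ) ^ stabilityExponent τ :=
      Real.one_le_rpow (by exact_mod_cast one_le_dynMaxDegree hV hG) (stabilityExponent_nonneg τ)
    have h2 : 0 ≤ dynExpansion G :=
      (by positivity : (0 : ℝ) ≤ 1 / (Fintype.card (Fin n) : ℝ)).trans
        (inv_card_le_dynExpansion hV hG)
    have h3 : 1 / dynExpansion G * Real.logb 2 N ^ 6 ≤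
        1 / dynExpansion G * (dynMaxDegree G : ℝ) ^ stabilityExponent τ * Real.logb 2 N ^ 6 := by
      have h4 : 0 ≤ 1 / dynExpansion G := by positivity
      have h5 : (0 : ℝ) ≤ Real.logb 2 N ^ 6 := by positivity
      exact mul_le_mul_of_nonneg_right (le_mul_of_one_le_right h4 h1) h5
    have h4 : (t₀ : ℝ) ≤ t := by linarith
    exact_mod_cast h4
  have hids : ∀ a : Fin n → Fin (2 ^ P.idBits N mode),
      ((PMF.uniformOfFintype (Fin n → Fin (N ^ 32))).expect fun s =>
          failProb P mode uid G T₀ (fun v => identifier mode (uid v) (a v))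
            (fun k => R (Function.extend uid s (fun _ => 0) k)) t) ≤
        (if Function.Injective fun v => identifier mode (uid v) (a v) then 0 else 1) +
          ENNReal.ofReal (1 / (2 * N)) := by
    intro a
    split_ifs with hinj
    · rw [zero_add]
      have : Nonempty (Fin n) := ⟨⟨0, by omega⟩⟩
      obtain ⟨ℓ, hℓ⟩ := Finite.exists_min fun v => identifier mode (uid v) (a v)
      -- `ℓ` becomes the leader; the bound for the sample applies for all strings `y` of the others
      refine expect_seeds_failProb_le huid ℓ fun y => ?_
      obtain ⟨c, hc⟩ := exists_code (P := P) (mode := mode) hn ht₀ uid G T₀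
        (fun v => identifier_lt (uid v) (a v)) y (uid ℓ)
      have h1 := hR c (by
        simp only [funext hc]
        exact hstr _ hinj (fun v => identifier_lt (uid v) (a v)) ℓ hℓ y)
      simp only [hc] at h1
      refine le_trans (Finset.sum_le_sum fun j _ => ?_) h1
      exact expect_gossipFails_antitone _ htt
    · exact (PMF.expect_le_of_le fun s _ => failProb_le_one _ _ _ _ _ _).trans le_self_add
  refine (PMF.expect_mono hids).trans ?_
  rw [PMF.expect_add, PMF.expect_const, Fintype.card_fin]
  refine (add_le_add_left (expect_identifier_not_injective_le hN rfl hn huid) _).trans ?_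
  have hn0 : (0 : ℝ) < n := by exact_mod_cast (by omega : 0 < n)
  have hnN : (n : ℝ) ≤ N := by exact_mod_cast hn
  have hNr : (0 : ℝ) < N := hn0.trans_le hnN
  rw [← ENNReal.ofReal_add (by positivity) (by positivity), ← ENNReal.ofReal_natCast,
    ← ENNReal.ofReal_one, ← ENNReal.ofReal_div_of_pos hn0]
  refine ENNReal.ofReal_le_ofReal ?_
  rw [show 1 / (2 * (N : ℝ)) + 1 / (2 * N) = 1 / N by field_simp; norm_num]
  exact one_div_le_one_div_of_le hn0 hnN
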